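/- Work over $\mathbb{C}$. Let $\mathfrak{g}=\mathfrak{g}_{\bar 0}\oplus\mathfrak{g}_{\bar 1}$ be a Lie superalgebra (possibly infinite-dimensional) and let $\mathfrak{t}\subset\mathfrak{g}_{\bar 0}$ be a maximal toral subalgebra: $\mathfrak{t}$ is finite-dimensional, commutative, acts diagonally on $\mathfrak{g}$, and $\mathfrak{g}_{\bar 0}^{\mathfrak{t}}=\mathfrak{t}$. Put $\mathfrak{h}=\mathfrak{g}^{\mathfrak{t}}$ (so $\mathfrak{h}_{\bar 0}=\mathfrak{t}$), and let $\Delta\subset\mathfrak{t}^*\setminus\{0\}$ be the set of roots, so that $\mathfrak{g}=\mathfrak{h}\oplus\bigoplus_{\alpha\in\Delta}\mathfrak{g}_\alpha$; assume that $\mathfrak{h}$ and all $\mathfrak{g}_\alpha$ are finite-dimensional. Fix a group homomorphism $\gamma:\mathbb{Z}\Delta\to\mathbb{R}$ with $\gamma(\alpha)\neq0$ for all $\alpha\in\Delta$, and put $\Delta^{\pm}=\{\alpha\in\Delta:\pm\gamma(\alpha)>0\}$, $\mathfrak{n}^{\pm}=\bigoplus_{\alpha\in\Delta^\pm}\mathfrak{g}_\alpha$,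 $\mathfrak{b}=\mathfrak{h}\oplus\mathfrak{n}^+$, $Q^-=\mathbb{N}\Delta^-$; write $\nu\le\lambda$ if $\nu-\lambda\in Q^-$. Assume that all weight spaces $(\mathcal{U}\mathfrak{n}^-)_\nu$ are finite-dimensional. All modules are $\mathbb{Z}/2$-graded, morphisms are even, and $\Pi$ is the parity shift. For $\lambda\in\mathfrak{t}^*$ let $F_\lambda$ be the symmetric bilinear form $F_\lambda(H,H')=\lambda([H,H'])$ on $\mathfrak{h}_{\bar 1}$, and $\operatorname{corank}F_\lambda$ the dimension of its kernel. Let $C(\lambda)$ be a simple $\mathfrak{h}$-module on which $\mathfrak{t}$ acts by $\lambda$; it is unique up to isomorphism and parity shift, and we fix an arbitrary choice for every $\lambda$. Let $M(\lambda)=\operatorname{Ind}_{\mathfrak{b}}^{\mathfrak{g}}C(\lambda)$, with $\mathfrak{n}^+$ acting on $C(\lambda)$ by zero, and let $L(\lambda)$ be its unique simple quotient. For an $\mathfrak{h}$-module $N$ with diagonal action of $\mathfrak{t}$ and finite-dimensional weight spaces, its supercharacter is the formal (possibly infinite) sum $\operatorname{sch}_{\mathfrak{h}}N=\sum_{\nu}m_\nu[C(\nu)]$,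 where $m_\nu=[N_\nu:C(\nu)]-[N_\nu:\Pi C(\nu)]\in\mathbb{Z}$ if $\operatorname{rank}F_\nu$ is even, and $m_\nu=[N_\nu:C(\nu)]\bmod 2\in\mathbb{Z}/2$ if $\operatorname{rank}F_\nu$ is odd (in which case $C(\nu)\cong\Pi C(\nu)$). Let $\mathcal{O}$ be the category of finitely generated $\mathfrak{g}$-modules with diagonal action of $\mathfrak{t}$ and finite-dimensional weight spaces, whose weights lie in a finite union of sets $\{\nu:\nu\le\lambda_i\}$. Its blocks are the classes of simple objects under the equivalence relation generated by the existence of a non-split extension. Write $\lambda\sim\mu$ if, up to parity shift, $L(\lambda)$ and $L(\mu)$ lie in the same block, i.e. if $L(\lambda)$ lies in the block of $L(\mu)$ or in that of $\Pi L(\mu)$. Assume: (A1) $\gamma(Q^-)$ is a discrete subset of $\mathbb{R}$, i.e. it has only finitely many points in each bounded interval; (A2) $F_\nu\neq0$ for each $\nu\in Q^-\setminus\{0\}$; (A3) $M(\lambda)$ has finite length as a $\mathfrak{g}$-module for each $\lambda\in\mathfrak{t}^*$ with $\operatorname{corank}F_\lambda\le1$. Theorem. Let $\Lambda\subset\mathfrak{t}^*$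 be an equivalence class of $\sim$ such that, if $\dim\mathfrak{h}_{\bar 1}$ is even, $\operatorname{corank}F_\lambda\le1$ for each $\lambda\in\Lambda$, and, if $\dim\mathfrak{h}_{\bar 1}$ is odd, $\operatorname{corank}F_\lambda=0$ for each $\lambda\in\Lambda$. Then for each $\lambda\in\Lambda$ there are integers $m_\mu$ $(\mu\in\Lambda)$ such that $$\operatorname{sch}_{\mathfrak{h}}L(\lambda)=\sum_{\mu\in\Lambda}m_\mu\operatorname{sch}_{\mathfrak{h}}C(\mu).$$ -/

import Mathlib

open scoped TensorProduct

noncomputable section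

namespace SuperLie

universe u

/-- The sign `(-1)^(ij)` for parities `i, j`. -/
def sgn (i j : ZMod 2) : ℂ := if i = 1 ∧ j = 1 then -1 else 1

/-- A super vector space over `ℂ` is a vector space `V` with its parity operator `δ`, a linear
involution; `degOf δ i` is the component `V_i`, the eigenspace of `δ` with eigenvalue `(-1)^i`. -/
def degOf {V : Type u} [AddCommGroup V] [Module ℂ V] (δ : V →ₗ[ℂ] V) (i : ZMod 2) :
    Submodule ℂ V where
  carrier := {v | δ v = (if i = 0 then (1 : ℂ) else -1) • v}
  add_mem' := by
    intro a b ha hb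
    simp only [Set.mem_ofPred_eq] at *
    rw [map_add, ha, hb, smul_add]
  zero_mem' := by simp
  smul_mem' := by
    intro c x hx
    simp only [Set.mem_ofPred_eq] at *
    rw [map_smul, hx, smul_comm]

/-- Lie superalgebras over `ℂ`, of arbitrary dimension. The bracket is even, and satisfies
super-skew-symmetry and the super Jacobi identity (in the form: `[x, -]` is a superderivation). -/
class LieSuperalgebra (𝔤 : Type u) [AddCommGroup 𝔤] [Module ℂ 𝔤] where
  δ : 𝔤 →ₗ[ℂ] 𝔤
  δ_δ : ∀ x, δ (δ x) = x
  br : 𝔤 →ₗ[ℂ] 𝔤 →ₗ[ℂ] 𝔤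
  δ_br : ∀ x y, δ (br x y) = br (δ x) (δ y)
  skew : ∀ (i j : ZMod 2), ∀ x ∈ degOf δ i, ∀ y ∈ degOf δ j, br x y = -(sgn i j • br y x)
  jacobi : ∀ (i j : ZMod 2), ∀ x ∈ degOf δ i, ∀ y ∈ degOf δ j, ∀ z,
    br x (br y z) = br (br x y) z + sgn i j • br y (br x z)

open LieSuperalgebra (δ δ_δ br δ_br)

/-- The homogeneous component `𝔤_i`. -/
abbrev deg (𝔤 : Type u) [AddCommGroup 𝔤] [Module ℂ 𝔤] [LieSuperalgebra 𝔤] (i : ZMod 2) :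
    Submodule ℂ 𝔤 := degOf (δ (𝔤 := 𝔤)) i

/-! ### Modules over a Lie superalgebra -/

/-- A (`ℤ/2`-graded) module structure over `𝔤` on the vector space `V`. -/
structure SuperRep (𝔤 : Type u) [AddCommGroup 𝔤] [Module ℂ 𝔤] [LieSuperalgebra 𝔤]
    (V : Type u) [AddCommGroup V] [Module ℂ V] where
  par : V →ₗ[ℂ] V
  par_par : ∀ v, par (par v) = v
  act : 𝔤 →ₗ[ℂ] V →ₗ[ℂ] V
  par_act : ∀ x v, par (act x v) = act (δ x) (par v)
  act_br : ∀ (i j : ZMod 2), ∀ x ∈ deg 𝔤 i, ∀ y ∈ deg 𝔤 j, ∀ v,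
    act (br x y) v = act x (act y v) - sgn i j • act y (act x v)

namespace SuperRep

variable {𝔤 : Type u} [AddCommGroup 𝔤] [Module ℂ 𝔤] [LieSuperalgebra 𝔤]
  {V : Type u} [AddCommGroup V] [Module ℂ V] {V' : Type u} [AddCommGroup V'] [Module ℂ V']

/-- The parity shift `Π V`. -/
def shift (ρ : SuperRep 𝔤 V) : SuperRep 𝔤 V where
  par := -ρ.par
  par_par := by intro v; simp [ρ.par_par]
  act := ρ.act
  par_act := by intro x v; simp [ρ.par_act]
  act_br := ρ.act_br

/-- `W` is a (graded) submodule. -/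
def Invariant (ρ : SuperRep 𝔤 V) (W : Submodule ℂ V) : Prop :=
  (∀ v ∈ W, ρ.par v ∈ W) ∧ ∀ x, ∀ v ∈ W, ρ.act x v ∈ W

/-- The ordered set of (graded) submodules. -/
abbrev Sub (ρ : SuperRep 𝔤 V) : Type u := {W : Submodule ℂ V // ρ.Invariant W}

/-- A (graded) submodule as a module. -/
def sub (ρ : SuperRep 𝔤 V) (W : ρ.Sub) : SuperRep 𝔤 W.1 where
  par := ρ.par.restrict W.2.1
  par_par := by intro v; ext; simp [ρ.par_par]
  act :=
    { toFun := fun x => (ρ.act x).restrict (W.2.2 x)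
      map_add' := by intro x y; ext v; simp
      map_smul' := by intro c x; ext v; simp }
  par_act := by intro x v; ext; simp [ρ.par_act]
  act_br := by intro i j x hx y hy v; ext; simp [ρ.act_br i j x hx y hy]

/-- The quotient by a (graded) submodule. -/
def quot (ρ : SuperRep 𝔤 V) (W : ρ.Sub) : SuperRep 𝔤 (V ⧸ W.1) where
  par := W.1.mapQ W.1 ρ.par (fun v hv => W.2.1 v hv)
  par_par := by
    intro v
    obtain ⟨v, rfl⟩ := W.1.mkQ_surjective v
    simp [ρ.par_par]
  act :=
    { toFun := fun x => W.1.mapQ W.1 (ρ.act x) (fun v hv => W.2.2 x v hv)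
      map_add' := by intro x y; ext v; simp
      map_smul' := by intro c x; ext v; simp }
  par_act := by
    intro x v
    obtain ⟨v, rfl⟩ := W.1.mkQ_surjective v
    simp [ρ.par_act]
  act_br := by
    intro i j x hx y hy v
    obtain ⟨v, rfl⟩ := W.1.mkQ_surjective v
    simp [ρ.act_br i j x hx y hy]

/-- `f` is a morphism of modules (an even `𝔤`-equivariant map). -/
def IsHom (ρ : SuperRep 𝔤 V) (σ : SuperRep 𝔤 V') (f : V →ₗ[ℂ] V') : Prop :=
  (∀ v, f (ρ.par v) = σ.par (f v)) ∧ ∀ x v, f (ρ.act x v) = σ.act x (f v)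

/-- Isomorphism of modules. -/
def Iso (ρ : SuperRep 𝔤 V) (σ : SuperRep 𝔤 V') : Prop :=
  ∃ f : V ≃ₗ[ℂ] V', ρ.IsHom σ f.toLinearMap

/-- Isomorphism up to parity shift. -/
def IsoUpToShift (ρ : SuperRep 𝔤 V) (σ : SuperRep 𝔤 V') : Prop :=
  ρ.Iso σ ∨ ρ.Iso σ.shift

/-- Simple (irreducible) modules. -/
def IsSimple (ρ : SuperRep 𝔤 V) : Prop :=
  Nontrivial V ∧ ∀ W : ρ.Sub, W.1 = ⊥ ∨ W.1 = ⊤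

/-- Finite length: existence of a composition series. -/
def FiniteLength (ρ : SuperRep 𝔤 V) : Prop :=
  ∃ (n : ℕ) (W : Fin (n + 1) → ρ.Sub), (W 0).1 = ⊥ ∧ (W (Fin.last n)).1 = ⊤ ∧
    ∀ i : Fin n, W i.castSucc ⋖ W i.succ

/-- For submodules `A ≤ B`, the subquotient `B / A` is isomorphic to `σ`. -/
def FactorIso (ρ : SuperRep 𝔤 V) (A B : ρ.Sub) (σ : SuperRep 𝔤 V') : Prop :=
  A ≤ B ∧ ∃ f : B.1 →ₗ[ℂ] V', (ρ.sub B).IsHom σ f ∧ Function.Surjective f ∧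
    ∀ v : B.1, f v = 0 ↔ (v : V) ∈ A.1

/-- The multiplicity `[ρ : σ]` of a simple module `σ` as a subquotient of `ρ`: the largest `k`
for which there are submodules `A₁ ≤ B₁ ≤ A₂ ≤ B₂ ≤ ⋯ ≤ A_k ≤ B_k` with all
`B_i / A_i ≅ σ`. For `ρ` of finite length this is the number of factors isomorphic to `σ` in any
composition series. -/
def mult (ρ : SuperRep 𝔤 V) (σ : SuperRep 𝔤 V') : ℕ :=
  sSup {k : ℕ | ∃ A B : Fin k → ρ.Sub,
    (∀ i, ρ.FactorIso (A i) (B i) σ) ∧ ∀ i j, i < j → B i ≤ A j}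

/-- Finite generation. -/
def FinGen (ρ : SuperRep 𝔤 V) : Prop :=
  ∃ s : Finset V, ∀ W : ρ.Sub, (∀ v ∈ s, v ∈ W.1) → W.1 = ⊤

/-- The sum of all proper submodules. -/
def radical (ρ : SuperRep 𝔤 V) : ρ.Sub :=
  ⟨sSup {W | ρ.Invariant W ∧ W ≠ ⊤}, by
    constructor
    · have h : sSup {W | ρ.Invariant W ∧ W ≠ ⊤} ≤
          (sSup {W | ρ.Invariant W ∧ W ≠ ⊤}).comap ρ.par :=
        sSup_le fun W hW v hv => (le_sSup hW : W ≤ _) (hW.1.1 v hv)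
      exact fun v hv => h hv
    · intro x
      have h : sSup {W | ρ.Invariant W ∧ W ≠ ⊤} ≤
          (sSup {W | ρ.Invariant W ∧ W ≠ ⊤}).comap (ρ.act x) :=
        sSup_le fun W hW v hv => (le_sSup hW : W ≤ _) (hW.1.2 x v hv)
      exact fun v hv => h hv⟩

end SuperRep

/-! ### The universal enveloping algebra -/

/-- The defining relations `x y = (-1)^(p(x)p(y)) y x + [x, y]`. -/
inductive URel (𝔤 : Type u) [AddCommGroup 𝔤] [Module ℂ 𝔤] [LieSuperalgebra 𝔤] :
    TensorAlgebra ℂ 𝔤 → TensorAlgebra ℂ 𝔤 → Prop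
  | bracket (i j : ZMod 2) (x y : 𝔤) (hx : x ∈ deg 𝔤 i) (hy : y ∈ deg 𝔤 j) :
      URel 𝔤 (TensorAlgebra.ι ℂ x * TensorAlgebra.ι ℂ y)
        (sgn i j • (TensorAlgebra.ι ℂ y * TensorAlgebra.ι ℂ x) + TensorAlgebra.ι ℂ (br x y))

/-- The universal enveloping algebra `U(𝔤)`. -/
def U (𝔤 : Type u) [AddCommGroup 𝔤] [Module ℂ 𝔤] [LieSuperalgebra 𝔤] : Type u :=
  RingQuot (URel 𝔤)

section Enveloping

variable {𝔤 : Type u} [AddCommGroup 𝔤] [Module ℂ 𝔤] [LieSuperalgebra 𝔤]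

instance : Ring (U 𝔤) := inferInstanceAs (Ring (RingQuot (URel 𝔤)))

instance : Algebra ℂ (U 𝔤) := inferInstanceAs (Algebra ℂ (RingQuot (URel 𝔤)))

/-- The projection from the tensor algebra to `U(𝔤)`. -/
def Umk : TensorAlgebra ℂ 𝔤 →ₐ[ℂ] U 𝔤 := RingQuot.mkAlgHom ℂ (URel 𝔤)

/-- The canonical map `𝔤 → U(𝔤)`. -/
def Uι : 𝔤 →ₗ[ℂ] U 𝔤 := Umk.toLinearMap ∘ₗ TensorAlgebra.ι ℂ

theorem Uι_mul (i j : ZMod 2) (x y : 𝔤) (hx : x ∈ deg 𝔤 i) (hy : y ∈ deg 𝔤 j) :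
    Uι x * Uι y = sgn i j • (Uι y * Uι x) + Uι (br x y) := by
  have h : Umk _ = Umk _ := RingQuot.mkAlgHom_rel ℂ (URel.bracket i j x y hx hy)
  simpa [Uι] using h

theorem δ_mem_deg {i : ZMod 2} {x : 𝔤} (hx : x ∈ deg 𝔤 i) : δ x ∈ deg 𝔤 i := by
  change δ (δ x) = _ • δ x
  rw [show δ x = (if i = 0 then (1 : ℂ) else -1) • x from hx, map_smul,
    show δ x = (if i = 0 then (1 : ℂ) else -1) • x from hx]

/-- The universal property of `U(𝔤)`. -/
def Ulift {A : Type u} [Ring A] [Algebra ℂ A] (f : 𝔤 →ₗ[ℂ] A)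
    (hf : ∀ (i j : ZMod 2), ∀ x ∈ deg 𝔤 i, ∀ y ∈ deg 𝔤 j,
      f x * f y = sgn i j • (f y * f x) + f (br x y)) : U 𝔤 →ₐ[ℂ] A :=
  RingQuot.liftAlgHom ℂ ⟨TensorAlgebra.lift ℂ f, by
    rintro _ _ ⟨i, j, x, y, hx, hy⟩
    simpa using hf i j x hx y hy⟩

theorem Ulift_ι {A : Type u} [Ring A] [Algebra ℂ A] (f : 𝔤 →ₗ[ℂ] A)
    (hf : ∀ (i j : ZMod 2), ∀ x ∈ deg 𝔤 i, ∀ y ∈ deg 𝔤 j,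
      f x * f y = sgn i j • (f y * f x) + f (br x y)) (x : 𝔤) : Ulift f hf (Uι x) = f x := by
  have h : Ulift f hf (Umk (TensorAlgebra.ι ℂ x)) = TensorAlgebra.lift ℂ f (TensorAlgebra.ι ℂ x) :=
    RingQuot.liftAlgHom_mkAlgHom_apply ℂ _ _ _
  simpa [Uι] using h

theorem U_hom_ext {A : Type u} [Ring A] [Algebra ℂ A] (f g : U 𝔤 →ₐ[ℂ] A)
    (h : ∀ x, f (Uι x) = g (Uι x)) : f = g := by
  apply RingQuot.ringQuot_ext' (S := ℂ) (s := URel 𝔤) f g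
  apply TensorAlgebra.hom_ext
  ext x
  exact h x

/-- The parity automorphism of the superalgebra `U(𝔤)`. -/
def Uδ : U 𝔤 →ₐ[ℂ] U 𝔤 :=
  Ulift (Uι ∘ₗ δ) (by
    intro i j x hx y hy
    simpa [δ_br] using Uι_mul i j (δ x) (δ y) (δ_mem_deg hx) (δ_mem_deg hy))

@[simp] theorem Uδ_ι (x : 𝔤) : Uδ (Uι x) = Uι (δ x) := Ulift_ι _ _ x

theorem Uδ_Uδ (a : U 𝔤) : Uδ (Uδ a) = a := by
  have h : (Uδ (𝔤 := 𝔤)).comp Uδ = AlgHom.id ℂ (U 𝔤) := U_hom_ext _ _ (by simp [δ_δ])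
  exact DFunLike.congr_fun h a

end Enveloping

/-! ### Maximal toral subalgebras, weights, triangular decompositions -/

section Toral

variable {𝔤 : Type u} [AddCommGroup 𝔤] [Module ℂ 𝔤] [LieSuperalgebra 𝔤]

/-- The eigenspace `𝔤_ν` of `𝔱` in the adjoint representation. -/
def wtSpace (𝔱 : Submodule ℂ 𝔤) (ν : Module.Dual ℂ 𝔱) : Submodule ℂ 𝔤 where
  carrier := {x | ∀ a : 𝔱, br (a : 𝔤) x = ν a • x}
  add_mem' := by intro x y hx hy a; rw [map_add, hx a, hy a, smul_add]
  zero_mem' := by intro a; simp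
  smul_mem' := by intro c x hx a; rw [map_smul, hx a, smul_comm]

/-- `𝔱 ⊆ 𝔤_0` is a maximal toral subalgebra. -/
structure IsMaximalToral (𝔱 : Submodule ℂ 𝔤) : Prop where
  finiteDimensional : FiniteDimensional ℂ 𝔱
  le_even : 𝔱 ≤ deg 𝔤 0
  comm : ∀ x ∈ 𝔱, ∀ y ∈ 𝔱, br x y = 0
  diagonal : ⨆ ν : Module.Dual ℂ 𝔱, wtSpace 𝔱 ν = ⊤
  centralizer : ∀ x ∈ deg 𝔤 0, (∀ a ∈ 𝔱, br a x = 0) → x ∈ 𝔱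

/-- The set of roots `Δ`. -/
def roots (𝔱 : Submodule ℂ 𝔤) : Set (Module.Dual ℂ 𝔱) := {α | α ≠ 0 ∧ wtSpace 𝔱 α ≠ ⊥}

variable {𝔱 : Submodule ℂ 𝔤}

/-- `Δ⁺ = {α ∈ Δ | γ(α) > 0}`. -/
def posRoots (γ : AddSubgroup.closure (roots 𝔱) →+ ℝ) : Set (Module.Dual ℂ 𝔱) :=
  {α | ∃ h : α ∈ roots 𝔱, 0 < γ ⟨α, AddSubgroup.subset_closure h⟩}

/-- `Δ⁻ = {α ∈ Δ | γ(α) < 0}`. -/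
def negRoots (γ : AddSubgroup.closure (roots 𝔱) →+ ℝ) : Set (Module.Dual ℂ 𝔱) :=
  {α | ∃ h : α ∈ roots 𝔱, γ ⟨α, AddSubgroup.subset_closure h⟩ < 0}

/-- `⨁_{α ∈ S} 𝔤_α`; it is `𝔫⁺` for `S = Δ⁺` and `𝔫⁻` for `S = Δ⁻`. -/
def rootSum (S : Set (Module.Dual ℂ 𝔱)) : Submodule ℂ 𝔤 := ⨆ α ∈ S, wtSpace 𝔱 α

/-- The `ν`-weight space (for the adjoint action of `𝔱`) of the enveloping algebra of
`⨁_{α ∈ S} 𝔤_α`, where that enveloping algebra is regarded as the subalgebra of `U(𝔤)` generated by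
`⨁_{α ∈ S} 𝔤_α`. -/
def UwtSpace (S : Set (Module.Dual ℂ 𝔱)) (ν : Module.Dual ℂ 𝔱) : Submodule ℂ (U 𝔤) where
  carrier := {u | u ∈ Algebra.adjoin ℂ (Uι '' (rootSum S : Set 𝔤)) ∧
    ∀ a : 𝔱, Uι (a : 𝔤) * u - u * Uι (a : 𝔤) = ν a • u}
  add_mem' := by
    rintro u v ⟨hu, hu'⟩ ⟨hv, hv'⟩
    refine ⟨add_mem hu hv, fun a => ?_⟩
    rw [smul_add, ← hu' a, ← hv' a, mul_add, add_mul]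
    abel
  zero_mem' := ⟨zero_mem _, by intro a; simp⟩
  smul_mem' := by
    rintro c u ⟨hu, hu'⟩
    refine ⟨Subalgebra.smul_mem _ hu c, fun a => ?_⟩
    rw [smul_comm, ← hu' a, smul_sub, mul_smul_comm, smul_mul_assoc]

end Toral

/-- A maximal toral subalgebra `𝔱` of `𝔤` together with a triangular decomposition: a group
homomorphism `γ : ℤΔ → ℝ` that does not vanish on `Δ`. All root spaces, `𝔤^𝔱`, and all weight spaces
`(U 𝔫⁻)_ν` are finite-dimensional. -/
structure TriangularDatum (𝔤 : Type u) [AddCommGroup 𝔤] [Module ℂ 𝔤] [LieSuperalgebra 𝔤] where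
  𝔱 : Submodule ℂ 𝔤
  toral : IsMaximalToral 𝔱
  finite_wtSpace : ∀ ν ∈ insert 0 (roots 𝔱), FiniteDimensional ℂ (wtSpace 𝔱 ν)
  γ : AddSubgroup.closure (roots 𝔱) →+ ℝ
  γ_ne_zero : ∀ α (h : α ∈ roots 𝔱), γ ⟨α, AddSubgroup.subset_closure h⟩ ≠ 0
  finite_UwtSpace : ∀ ν ∈ AddSubgroup.closure (roots 𝔱),
    FiniteDimensional ℂ (UwtSpace (negRoots γ) ν)

theorem half_deg {𝔤 : Type u} [AddCommGroup 𝔤] [Module ℂ 𝔤] [LieSuperalgebra 𝔤] (x : 𝔤) :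
    (2⁻¹ : ℂ) • (x + δ x) ∈ deg 𝔤 0 ∧ (2⁻¹ : ℂ) • (x - δ x) ∈ deg 𝔤 1 ∧
      (2⁻¹ : ℂ) • (x + δ x) + (2⁻¹ : ℂ) • (x - δ x) = x := by
  refine ⟨?_, ?_, ?_⟩
  · change δ _ = _ • _
    simp [δ_δ, add_comm]
  · change δ _ = _ • _
    simp [δ_δ, ← smul_neg]
  · module

theorem jacobi_even {𝔤 : Type u} [AddCommGroup 𝔤] [Module ℂ 𝔤] [LieSuperalgebra 𝔤] (a x y : 𝔤)
    (ha : a ∈ deg 𝔤 0) : br a (br x y) = br (br a x) y + br x (br a y) := by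
  obtain ⟨h0, h1, h2⟩ := half_deg x
  have e0 := LieSuperalgebra.jacobi 0 0 a ha _ h0 y
  have e1 := LieSuperalgebra.jacobi 0 1 a ha _ h1 y
  simp only [sgn, zero_ne_one, false_and, if_false, one_smul] at e0 e1
  rw [← h2]
  generalize (2⁻¹ : ℂ) • (x + δ x) = x0 at *
  generalize (2⁻¹ : ℂ) • (x - δ x) = x1 at *
  simp only [map_add, LinearMap.add_apply, e0, e1]
  abel

namespace TriangularDatum

variable {𝔤 : Type u} [AddCommGroup 𝔤] [Module ℂ 𝔤] [LieSuperalgebra 𝔤] (T : TriangularDatum 𝔤)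

/-- The space `𝔱^*` of weights. -/
abbrev Wt : Type u := Module.Dual ℂ T.𝔱

/-- The maximal quasitoral subalgebra `𝔥 = 𝔤^𝔱`. -/
def 𝔥 : Submodule ℂ 𝔤 := wtSpace T.𝔱 0

theorem mem_𝔥 {x : 𝔤} : x ∈ T.𝔥 ↔ ∀ a ∈ T.𝔱, br a x = 0 := by
  simp [𝔥, wtSpace]

theorem 𝔱_le_𝔥 : T.𝔱 ≤ T.𝔥 := fun x hx => T.mem_𝔥.2 fun a ha => T.toral.comm a ha x hx

theorem δ_𝔱 {a : 𝔤} (ha : a ∈ T.𝔱) : δ a = a := by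
  have := T.toral.le_even ha
  simpa [deg, degOf] using this

theorem δ_mem_𝔥 (x : 𝔤) (hx : x ∈ T.𝔥) : δ x ∈ T.𝔥 := by
  rw [mem_𝔥] at *
  intro a ha
  have h := congrArg δ (hx a ha)
  rwa [δ_br, T.δ_𝔱 ha, map_zero] at h

theorem br_mem_𝔥 (x : 𝔤) (hx : x ∈ T.𝔥) (y : 𝔤) (hy : y ∈ T.𝔥) : br x y ∈ T.𝔥 := by
  rw [mem_𝔥] at *
  intro a ha
  rw [jacobi_even a x y (T.toral.le_even ha), hx a ha, hy a ha]
  simp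

theorem coe_mem_degOf (i : ZMod 2) (x : T.𝔥)
    (hx : x ∈ degOf ((δ (𝔤 := 𝔤)).restrict T.δ_mem_𝔥) i) : (x : 𝔤) ∈ deg 𝔤 i :=
  congrArg Subtype.val hx

instance : LieSuperalgebra T.𝔥 where
  δ := (δ (𝔤 := 𝔤)).restrict T.δ_mem_𝔥
  δ_δ := by intro x; ext; simp [δ_δ]
  br :=
    { toFun := fun x => (br (x : 𝔤)).restrict (T.br_mem_𝔥 x x.2)
      map_add' := by intro x y; ext v; simp
      map_smul' := by intro c x; ext v; simp }
  δ_br := by intro x y; ext; simp [δ_br]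
  skew := by
    intro i j x hx y hy
    ext
    simpa using LieSuperalgebra.skew i j _ (T.coe_mem_degOf i x hx) _ (T.coe_mem_degOf j y hy)
  jacobi := by
    intro i j x hx y hy z
    ext
    simpa using
      LieSuperalgebra.jacobi i j _ (T.coe_mem_degOf i x hx) _ (T.coe_mem_degOf j y hy) (z : 𝔤)

/-! ### The forms `F_λ` -/

/-- The odd part `𝔥_1` of `𝔥`. -/
def 𝔥₁ : Submodule ℂ 𝔤 := T.𝔥 ⊓ deg 𝔤 1

theorem br_odd_mem (x y : T.𝔥₁) : br (x : 𝔤) (y : 𝔤) ∈ T.𝔱 := by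
  apply T.toral.centralizer
  · have hx : δ (x : 𝔤) = _ • (x : 𝔤) := x.2.2
    have hy : δ (y : 𝔤) = _ • (y : 𝔤) := y.2.2
    change δ _ = _ • _
    rw [δ_br, hx, hy]
    simp
  · exact T.mem_𝔥.1 (T.br_mem_𝔥 x x.2.1 y y.2.1)

/-- The symmetric bilinear form `F_λ(H, H') = λ([H, H'])` on `𝔥_1`. -/
def F (l : T.Wt) : T.𝔥₁ →ₗ[ℂ] T.𝔥₁ →ₗ[ℂ] ℂ :=
  LinearMap.mk₂ ℂ (fun x y => l ⟨br (x : 𝔤) (y : 𝔤), T.br_odd_mem x y⟩)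
    (by intro x x' y; rw [← map_add]; congr 1; ext; simp)
    (by intro c x y; rw [← map_smul]; congr 1; ext; simp)
    (by intro x y y'; rw [← map_add]; congr 1; ext; simp)
    (by intro c x y; rw [← map_smul]; congr 1; ext; simp)

/-- `rank F_λ`. -/
def rk (l : T.Wt) : ℕ := Module.finrank ℂ (LinearMap.range (T.F l))

/-- `corank F_λ`, the dimension of the kernel of `F_λ`. -/
def corank (l : T.Wt) : ℕ := Module.finrank ℂ (LinearMap.ker (T.F l))

/-- `Q⁻ = ℕ Δ⁻`. -/
def Qneg : AddSubmonoid T.Wt := AddSubmonoid.closure (negRoots T.γ)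

/-- The partial order on `𝔱^*`: `T.le ν l` means `ν ≤ l`, that is `ν - l ∈ ℕ Δ⁻`. -/
def le (ν l : T.Wt) : Prop := ν - l ∈ T.Qneg

/-! ### Weight spaces of modules, the simple `𝔥`-modules `C(λ)` -/

section Modules

variable {V : Type u} [AddCommGroup V] [Module ℂ V]

/-- Restriction of modules from `𝔤` to `𝔥`. -/
def res (ρ : SuperRep 𝔤 V) : SuperRep T.𝔥 V where
  par := ρ.par
  par_par := ρ.par_par
  act := ρ.act ∘ₗ T.𝔥.subtype
  par_act := by intro x v; exact ρ.par_act x v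
  act_br := by
    intro i j x hx y hy v
    exact ρ.act_br i j x (T.coe_mem_degOf i x hx) y (T.coe_mem_degOf j y hy) v

variable {T}

theorem 𝔱_even {a : 𝔤} (ha : a ∈ T.𝔱) : (⟨a, T.𝔱_le_𝔥 ha⟩ : T.𝔥) ∈ deg T.𝔥 0 := by
  have : (δ (⟨a, T.𝔱_le_𝔥 ha⟩ : T.𝔥)) = ⟨a, T.𝔱_le_𝔥 ha⟩ := Subtype.ext (T.δ_𝔱 ha)
  simpa [deg, degOf] using this

/-- The weight space `N_ν` of an `𝔥`-module `N`, a submodule of `N`. -/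
def wt (ρ : SuperRep T.𝔥 V) (ν : T.Wt) : ρ.Sub :=
  ⟨{ carrier := {v | ∀ a : T.𝔱, ρ.act ⟨a, T.𝔱_le_𝔥 a.2⟩ v = ν a • v}
     add_mem' := by intro x y hx hy a; rw [map_add, hx a, hy a, smul_add]
     zero_mem' := by intro a; simp
     smul_mem' := by intro c x hx a; rw [map_smul, hx a, smul_comm] }, by
    constructor
    · intro v hv a
      have h := congrArg ρ.par (hv a)
      rw [ρ.par_act, map_smul] at h
      rw [← h]
      congr 2
      exact Subtype.ext (T.δ_𝔱 a.2).symm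
    · intro x v hv a
      have key : ∀ (j : ZMod 2) (y : T.𝔥), y ∈ deg T.𝔥 j →
          ρ.act ⟨a, T.𝔱_le_𝔥 a.2⟩ (ρ.act y v) = ν a • ρ.act y v := by
        intro j y hy
        have h := ρ.act_br 0 j _ (𝔱_even a.2) y hy v
        have h0 : br (⟨a, T.𝔱_le_𝔥 a.2⟩ : T.𝔥) y = 0 := Subtype.ext (T.mem_𝔥.1 y.2 a a.2)
        rw [h0, map_zero, LinearMap.zero_apply] at h
        simp only [sgn, zero_ne_one, false_and, if_false, one_smul] at h
        rw [← sub_eq_zero.1 h.symm |>.symm, hv a, map_smul]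
      obtain ⟨h0, h1, h2⟩ := half_deg x
      have k0 := key 0 _ h0
      have k1 := key 1 _ h1
      rw [← h2]
      generalize (2⁻¹ : ℂ) • (x + δ x) = x0 at *
      generalize (2⁻¹ : ℂ) • (x - δ x) = x1 at *
      rw [map_add, LinearMap.add_apply, map_add, k0, k1, smul_add]⟩

variable (T)

/-- A simple `𝔥`-module on which `𝔱` acts by `l`, that is, a simple `Cl(𝔥_1, F_l)`-module. Such a
module is unique up to isomorphism and parity shift. -/
structure SimpleMod (l : T.Wt) where
  carrier : Type u
  [addCommGroup : AddCommGroup carrier]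
  [module : Module ℂ carrier]
  rep : SuperRep T.𝔥 carrier
  simple : rep.IsSimple
  weight : (wt rep l).1 = ⊤

attribute [instance] SimpleMod.addCommGroup SimpleMod.module

end Modules

section Existence

open CliffordAlgebra (ι)

variable {T}

/-- The quadratic form `H ↦ F_l(H, H) / 2`; in its Clifford algebra `H H' + H' H = F_l(H, H')`. -/
def quad (l : T.Wt) : QuadraticForm ℂ T.𝔥₁ :=
  LinearMap.BilinMap.toQuadraticMap ((2⁻¹ : ℂ) • T.F l)

theorem F_symm (l : T.Wt) (x y : T.𝔥₁) : T.F l x y = T.F l y x := by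
  have h := LinearMap.congr_arg (f := l) (Subtype.ext (by
    have := LieSuperalgebra.skew 1 1 _ x.2.2 _ y.2.2
    simpa [sgn] using this) :
      (⟨br (x : 𝔤) (y : 𝔤), T.br_odd_mem x y⟩ : T.𝔱) = ⟨br (y : 𝔤) (x : 𝔤), T.br_odd_mem y x⟩)
  exact h

theorem ι_anticomm (l : T.Wt) (x y : T.𝔥₁) :
    ι (quad l) x * ι (quad l) y + ι (quad l) y * ι (quad l) x =
      algebraMap ℂ (CliffordAlgebra (quad l)) (T.F l x y) := by
  rw [CliffordAlgebra.ι_mul_ι_add_swap]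
  congr 1
  rw [quad, LinearMap.BilinMap.polar_toQuadraticMap]
  simp only [LinearMap.smul_apply, smul_eq_mul, F_symm l y x]
  ring

/-- The even part of an element of `𝔥`. -/
def p0 : T.𝔥 →ₗ[ℂ] T.𝔱 :=
  LinearMap.codRestrict T.𝔱 ((2⁻¹ : ℂ) • (T.𝔥.subtype + (δ (𝔤 := 𝔤)) ∘ₗ T.𝔥.subtype)) (by
    intro x
    have hx := (half_deg (x : 𝔤)).1
    refine T.toral.centralizer _ hx (T.mem_𝔥.1 ?_)
    exact T.𝔥.smul_mem _ (T.𝔥.add_mem x.2 (T.δ_mem_𝔥 x x.2)))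

/-- The odd part of an element of `𝔥`. -/
def p1 : T.𝔥 →ₗ[ℂ] T.𝔥₁ :=
  LinearMap.codRestrict T.𝔥₁ ((2⁻¹ : ℂ) • (T.𝔥.subtype - (δ (𝔤 := 𝔤)) ∘ₗ T.𝔥.subtype)) (by
    intro x
    refine ⟨?_, (half_deg (x : 𝔤)).2.1⟩
    exact T.𝔥.smul_mem _ (T.𝔥.sub_mem x.2 (T.δ_mem_𝔥 x x.2)))

/-- The map from `𝔥` to the Clifford algebra of `F_l`. -/
def cl (l : T.Wt) : T.𝔥 →ₗ[ℂ] CliffordAlgebra (quad l) :=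
  Algebra.linearMap ℂ _ ∘ₗ l ∘ₗ p0 + ι (quad l) ∘ₗ p1

theorem cl_even (l : T.Wt) (x : T.𝔥) (hx : (x : 𝔤) ∈ T.𝔱) :
    cl l x = algebraMap ℂ _ (l ⟨x, hx⟩) := by
  have h := T.δ_𝔱 hx
  have h0 : p0 x = ⟨x, hx⟩ := Subtype.ext (by
    change (2⁻¹ : ℂ) • ((x : 𝔤) + δ (x : 𝔤)) = x
    rw [h]; module)
  have h1 : p1 x = 0 := Subtype.ext (by
    change (2⁻¹ : ℂ) • ((x : 𝔤) - δ (x : 𝔤)) = 0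
    rw [h]; simp)
  simp [cl, h0, h1]

theorem cl_odd (l : T.Wt) (x : T.𝔥) (hx : (x : 𝔤) ∈ deg 𝔤 1) :
    cl l x = ι (quad l) ⟨x, x.2, hx⟩ := by
  have h : δ (x : 𝔤) = - x := by simpa [deg, degOf] using hx
  have h0 : p0 x = 0 := Subtype.ext (by
    change (2⁻¹ : ℂ) • ((x : 𝔤) + δ (x : 𝔤)) = 0
    rw [h]; simp)
  have h1 : p1 x = ⟨x, x.2, hx⟩ := Subtype.ext (by
    change (2⁻¹ : ℂ) • ((x : 𝔤) - δ (x : 𝔤)) = x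
    rw [h]; module)
  simp [cl, h0, h1]

theorem even_mem_𝔱 (x : T.𝔥) (hx : (x : 𝔤) ∈ deg 𝔤 0) : (x : 𝔤) ∈ T.𝔱 :=
  T.toral.centralizer _ hx (T.mem_𝔥.1 x.2)

theorem cl_br (l : T.Wt) (i j : ZMod 2) (x : T.𝔥) (hx : (x : 𝔤) ∈ deg 𝔤 i) (y : T.𝔥)
    (hy : (y : 𝔤) ∈ deg 𝔤 j) : cl l (br x y) = cl l x * cl l y - sgn i j • (cl l y * cl l x) := by
  have hbr : ((br x y : T.𝔥) : 𝔤) = br (x : 𝔤) (y : 𝔤) := rfl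
  have ij : ∀ k : ZMod 2, k = 0 ∨ k = 1 := by decide
  rcases ij i with rfl | rfl
  · have hx' := even_mem_𝔱 x hx
    have : br x y = 0 := Subtype.ext (T.mem_𝔥.1 y.2 _ hx')
    rw [this, map_zero, cl_even l x hx']
    simp [sgn, Algebra.commutes]
  · rcases ij j with rfl | rfl
    · have hy' := even_mem_𝔱 y hy
      have : br x y = 0 := Subtype.ext (by
        rw [hbr, LieSuperalgebra.skew 1 0 _ hx _ hy, T.mem_𝔥.1 x.2 _ hy']
        simp)
      rw [this, map_zero, cl_even l y hy']
      simp [sgn, Algebra.commutes]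
    · rw [cl_odd l x hx, cl_odd l y hy]
      have h := ι_anticomm l ⟨x, x.2, hx⟩ ⟨y, y.2, hy⟩
      rw [cl_even l (br x y) (T.br_odd_mem ⟨x, x.2, hx⟩ ⟨y, y.2, hy⟩)]
      simp only [sgn, and_self, if_true, neg_smul, one_smul, sub_neg_eq_add, h]
      rfl

/-- The left regular representation of the Clifford algebra of `F_l`, as an `𝔥`-module. -/
def clRep (l : T.Wt) : SuperRep T.𝔥 (CliffordAlgebra (quad l)) where
  par := (CliffordAlgebra.involute (Q := quad l)).toLinearMap
  par_par := fun v => CliffordAlgebra.involute_involute v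
  act := LinearMap.mul ℂ _ ∘ₗ cl l
  par_act := by
    intro x v
    have h : CliffordAlgebra.involute (cl l x) = cl l (δ x) := by
      have h0 : (p0 (δ x) : T.𝔱) = p0 x := Subtype.ext (by
        change (2⁻¹ : ℂ) • (δ (x : 𝔤) + δ (δ (x : 𝔤))) = (2⁻¹ : ℂ) • ((x : 𝔤) + δ (x : 𝔤))
        rw [δ_δ, add_comm])
      have h1 : (p1 (δ x) : T.𝔥₁) = - p1 x := Subtype.ext (by
        change (2⁻¹ : ℂ) • (δ (x : 𝔤) - δ (δ (x : 𝔤))) = -((2⁻¹ : ℂ) • ((x : 𝔤) - δ (x : 𝔤)))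
        rw [δ_δ]; module)
      simp [cl, h0, h1]
    simp [h]
  act_br := by
    intro i j x hx y hy v
    have h := cl_br l i j x (T.coe_mem_degOf i x hx) y (T.coe_mem_degOf j y hy)
    simp [h, mul_assoc]

/-- Every weight is the weight of a simple `𝔥`-module. -/
theorem nonempty_simpleMod (l : T.Wt) : Nonempty (T.SimpleMod l) := by
  let _ : Invertible (2 : ℂ) := invertibleOfNonzero two_ne_zero
  obtain ⟨W, -, hW⟩ := zorn_le_nonempty₀
    {W : Submodule ℂ (CliffordAlgebra (quad l)) | (clRep l).Invariant W ∧ (1 : _) ∉ W} (by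
      intro c hc hchain y hy
      have hne : c.Nonempty := ⟨y, hy⟩
      have hmem : ∀ {z}, z ∈ sSup c ↔ ∃ W ∈ c, z ∈ W := fun {z} =>
        Submodule.mem_sSup_of_directed hne hchain.directedOn
      refine ⟨sSup c, ⟨⟨?_, ?_⟩, ?_⟩, fun z hz => le_sSup hz⟩
      · intro v hv
        obtain ⟨W, hW, hvW⟩ := hmem.1 hv
        exact hmem.2 ⟨W, hW, (hc hW).1.1 v hvW⟩
      · intro x v hv
        obtain ⟨W, hW, hvW⟩ := hmem.1 hv
        exact hmem.2 ⟨W, hW, (hc hW).1.2 x v hvW⟩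
      · intro h1
        obtain ⟨W, hW, hvW⟩ := hmem.1 h1
        exact (hc hW).2 hvW) ⊥ (by
      refine ⟨⟨?_, ?_⟩, ?_⟩
      · intro v hv; simp_all
      · intro x v hv; simp_all
      · simp)
  have full : ∀ W' : Submodule ℂ (CliffordAlgebra (quad l)), (clRep l).Invariant W' →
      (1 : _) ∈ W' → W' = ⊤ := by
    intro W' hW' h1
    have hs : ∀ a : CliffordAlgebra (quad l), ∀ w ∈ W', a * w ∈ W' := by
      intro a
      induction a using CliffordAlgebra.induction with
      | algebraMap r => intro w hw; rw [← Algebra.smul_def]; exact W'.smul_mem r hw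
      | ι x =>
        intro w hw
        have h := hW'.2 ⟨x, x.2.1⟩ w hw
        have e : (clRep l).act ⟨x, x.2.1⟩ w = cl l ⟨x, x.2.1⟩ * w := rfl
        rw [e, cl_odd l _ x.2.2] at h
        exact h
      | mul a b ha hb => intro w hw; rw [mul_assoc]; exact ha _ (hb _ hw)
      | add a b ha hb => intro w hw; rw [add_mul]; exact W'.add_mem (ha _ hw) (hb _ hw)
    refine eq_top_iff.2 fun a _ => ?_
    simpa using hs a 1 h1
  have hW1 : (clRep l).Invariant W := hW.prop.1
  refine ⟨⟨_, (clRep l).quot ⟨W, hW1⟩, ⟨?_, ?_⟩, ?_⟩⟩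
  · refine Submodule.Quotient.nontrivial_iff.2 ?_
    rintro rfl
    exact hW.prop.2 Submodule.mem_top
  · rintro ⟨W', hW'⟩
    have hinv : (clRep l).Invariant (W'.comap W.mkQ) :=
      ⟨fun v hv => hW'.1 _ hv, fun x v hv => hW'.2 x _ hv⟩
    have hle : W ≤ W'.comap W.mkQ := by
      intro w hw
      have : W.mkQ w = 0 := (Submodule.Quotient.mk_eq_zero W).2 hw
      rw [Submodule.mem_comap, this]
      exact W'.zero_mem
    by_cases h1 : (1 : CliffordAlgebra (quad l)) ∈ W'.comap W.mkQ
    · right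
      have := full _ hinv h1
      refine eq_top_iff.2 fun q _ => ?_
      obtain ⟨a, rfl⟩ := W.mkQ_surjective q
      exact (this ▸ Submodule.mem_top : a ∈ W'.comap W.mkQ)
    · left
      have := hW.le_of_ge ⟨hinv, h1⟩ hle
      refine eq_bot_iff.2 fun q hq => ?_
      obtain ⟨a, rfl⟩ := W.mkQ_surjective q
      exact (Submodule.Quotient.mk_eq_zero W).2 (this hq)
  · refine eq_top_iff.2 fun q _ => ?_
    obtain ⟨v, rfl⟩ := W.mkQ_surjective q
    intro a
    have e : (clRep l).act ⟨a, T.𝔱_le_𝔥 a.2⟩ v = l a • v := by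
      change cl l _ * v = _
      rw [cl_even l _ a.2, ← Algebra.smul_def]
    change W.mkQ ((clRep l).act ⟨a, T.𝔱_le_𝔥 a.2⟩ v) = _
    rw [e, map_smul]

end Existence


/-! ### The modules `M(λ)` and `L(λ)` -/

section HighestWeight

variable {V : Type u} [AddCommGroup V] [Module ℂ V]

/-- The `𝔤`-module `U(𝔤) ⊗_ℂ V` on which `𝔤` acts by left multiplication. -/
def freeRep (σ : SuperRep T.𝔥 V) : SuperRep 𝔤 (U 𝔤 ⊗[ℂ] V) where
  par := TensorProduct.map Uδ.toLinearMap σ.par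
  par_par := by
    intro v
    have h : TensorProduct.map (Uδ (𝔤 := 𝔤)).toLinearMap σ.par ∘ₗ
        TensorProduct.map Uδ.toLinearMap σ.par = LinearMap.id := by
      ext a b
      simp [Uδ_Uδ, σ.par_par]
    exact LinearMap.congr_fun h v
  act := LinearMap.rTensorHom V ∘ₗ LinearMap.mul ℂ (U 𝔤) ∘ₗ Uι
  par_act := by
    intro x v
    induction v with
    | zero => simp
    | tmul a b => simp
    | add a b ha hb => rw [map_add, map_add, ha, hb, map_add, map_add]
  act_br := by
    intro i j x hx y hy v
    have e : Uι (br x y) = Uι x * Uι y - sgn i j • (Uι y * Uι x) :=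
      eq_sub_of_add_eq' (Uι_mul i j x y hx hy).symm
    induction v with
    | zero => simp
    | tmul a b =>
      change (Uι (br x y) * a) ⊗ₜ[ℂ] b = (Uι x * (Uι y * a)) ⊗ₜ[ℂ] b -
        sgn i j • ((Uι y * (Uι x * a)) ⊗ₜ[ℂ] b)
      rw [e, sub_mul, TensorProduct.sub_tmul, smul_mul_assoc, TensorProduct.smul_tmul', mul_assoc,
        mul_assoc]
    | add a b ha hb => simp only [map_add, ha, hb, smul_add]; abel

/-- The relations `u x ⊗ v = u ⊗ x v` (`x ∈ 𝔥`) and `u x ⊗ v = 0` (`x ∈ 𝔫⁺`), by which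
`U(𝔤) ⊗_ℂ V` has to be divided in order to obtain `U(𝔤) ⊗_{U(𝔟)} V`. -/
def indSpan (σ : SuperRep T.𝔥 V) : Submodule ℂ (U 𝔤 ⊗[ℂ] V) :=
  Submodule.span ℂ
    ({w | ∃ (u : U 𝔤) (x : T.𝔥) (v : V), w = (u * Uι (x : 𝔤)) ⊗ₜ[ℂ] v - u ⊗ₜ[ℂ] σ.act x v} ∪
     {w | ∃ (u : U 𝔤) (x : 𝔤) (v : V), x ∈ rootSum (posRoots T.γ) ∧ w = (u * Uι x) ⊗ₜ[ℂ] v})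

theorem δ_mem_wtSpace (α : T.Wt) (x : 𝔤) (hx : x ∈ wtSpace T.𝔱 α) : δ x ∈ wtSpace T.𝔱 α := by
  intro a
  have h := congrArg δ (hx a)
  rwa [δ_br, T.δ_𝔱 a.2, map_smul] at h

theorem δ_mem_rootSum (S : Set T.Wt) (x : 𝔤) (hx : x ∈ rootSum S) : δ x ∈ rootSum S := by
  have h : rootSum S ≤ (rootSum S).comap (δ (𝔤 := 𝔤)) :=
    iSup₂_le fun α hα y hy =>
      (le_iSup₂_of_le α hα le_rfl : wtSpace T.𝔱 α ≤ rootSum S) (T.δ_mem_wtSpace α y hy)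
  exact h hx

theorem indSpan_invariant (σ : SuperRep T.𝔥 V) : (T.freeRep σ).Invariant (T.indSpan σ) := by
  constructor
  · suffices h : T.indSpan σ ≤ (T.indSpan σ).comap (T.freeRep σ).par from fun v hv => h hv
    refine Submodule.span_le.2 ?_
    rintro w (⟨u, x, v, rfl⟩ | ⟨u, x, v, hx, rfl⟩)
    · refine Submodule.subset_span (Or.inl ⟨Uδ u, δ x, σ.par v, ?_⟩)
      have e : ((δ x : T.𝔥) : 𝔤) = δ (x : 𝔤) := rfl
      simp [freeRep, σ.par_act, e]
    · refine Submodule.subset_span (Or.inr ⟨Uδ u, δ x, σ.par v, T.δ_mem_rootSum _ x hx, ?_⟩)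
      simp [freeRep]
  · intro y
    suffices h : T.indSpan σ ≤ (T.indSpan σ).comap ((T.freeRep σ).act y) from fun v hv => h hv
    refine Submodule.span_le.2 ?_
    rintro w (⟨u, x, v, rfl⟩ | ⟨u, x, v, hx, rfl⟩)
    · refine Submodule.subset_span (Or.inl ⟨Uι y * u, x, v, ?_⟩)
      simp [freeRep, mul_assoc]
    · refine Submodule.subset_span (Or.inr ⟨Uι y * u, x, v, hx, ?_⟩)
      simp [freeRep, mul_assoc]

/-- The submodule of `U(𝔤) ⊗_ℂ V` by which one divides. -/
def indSub (σ : SuperRep T.𝔥 V) : (T.freeRep σ).Sub := ⟨T.indSpan σ, T.indSpan_invariant σ⟩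

/-- The induced module `Ind_𝔟^𝔤 V = U(𝔤) ⊗_{U(𝔟)} V`, where `𝔟 = 𝔥 ⊕ 𝔫⁺` and `𝔫⁺` acts on `V`
by zero. -/
def ind (σ : SuperRep T.𝔥 V) : SuperRep 𝔤 ((U 𝔤 ⊗[ℂ] V) ⧸ (T.indSub σ).1) :=
  (T.freeRep σ).quot (T.indSub σ)

variable {T}

/-- `M(λ) = Ind_𝔟^𝔤 C(λ)`. -/
abbrev M {l : T.Wt} (C : T.SimpleMod l) :
    SuperRep 𝔤 ((U 𝔤 ⊗[ℂ] C.carrier) ⧸ (T.indSub C.rep).1) := T.ind C.rep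

/-- `L(λ)`, the simple quotient of `M(λ)`: the quotient by the largest proper submodule. -/
abbrev L {l : T.Wt} (C : T.SimpleMod l) :
    SuperRep 𝔤 (((U 𝔤 ⊗[ℂ] C.carrier) ⧸ (T.indSub C.rep).1) ⧸ (M C).radical.1) :=
  (M C).quot (M C).radical

variable (T)

/-! ### Category `𝒪` and its blocks -/

/-- The objects of category `𝒪`: finitely generated modules with diagonal action of `𝔱` and
finite-dimensional weight spaces, whose weights lie in finitely many cones `{ν | ν ≤ l}`. -/
structure InO (ρ : SuperRep 𝔤 V) : Prop where
  finGen : ρ.FinGen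
  diagonal : ⨆ ν : T.Wt, (wt (T.res ρ) ν).1 = ⊤
  finite_wt : ∀ ν : T.Wt, FiniteDimensional ℂ (wt (T.res ρ) ν).1
  bounded : ∃ s : Finset T.Wt, ∀ ν : T.Wt, (wt (T.res ρ) ν).1 ≠ ⊥ → ∃ l ∈ s, T.le ν l

variable {T}

/-- Up to parity shifts, there is in `𝒪` a non-split extension of `L(μ)` by `L(λ)`. -/
def Linked (C : ∀ l : T.Wt, T.SimpleMod l) (l μ : T.Wt) : Prop :=
  ∃ (E : Type u) (_ : AddCommGroup E) (_ : Module ℂ E) (ρ : SuperRep 𝔤 E) (W : ρ.Sub),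
    T.InO ρ ∧ (ρ.sub W).IsoUpToShift (L (C l)) ∧ (ρ.quot W).IsoUpToShift (L (C μ)) ∧
      ¬ ∃ W' : ρ.Sub, IsCompl W.1 W'.1

/-- `λ ∼ μ`: up to parity shift, `L(λ)` and `L(μ)` lie in the same block of `𝒪`. Blocks are the
classes of the equivalence relation on simple objects generated by the existence of a non-split
extension. -/
def SameBlock (C : ∀ l : T.Wt, T.SimpleMod l) : T.Wt → T.Wt → Prop :=
  Relation.EqvGen (Linked C)

/-! ### Supercharacters -/

variable (T)

/-- The reduced Grothendieck group of `𝔥`-modules with diagonal action of `𝔱` and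
finite-dimensional weight spaces. Its elements are the formal, possibly infinite, sums
`∑_ν m_ν [C(ν)]`; here `m_ν` is an integer if `rank F_ν` is even, and a residue modulo `2` if
`rank F_ν` is odd (then `C(ν) ≅ Π C(ν)`, so that `2 [C(ν)] = 0`). -/
abbrev RedGr : Type u := ∀ ν : T.Wt, ZMod (if Even (T.rk ν) then 0 else 2)

variable {T}

/-- The supercharacter of an `𝔥`-module `N`: its coefficient at `ν` is
`[N_ν : C(ν)] - [N_ν : Π C(ν)]` if `rank F_ν` is even, and `[N_ν : C(ν)] mod 2` otherwise. -/
def sch (C : ∀ l : T.Wt, T.SimpleMod l) (ρ : SuperRep T.𝔥 V) : T.RedGr := fun ν =>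
  ((if Even (T.rk ν) then
      ((ρ.sub (wt ρ ν)).mult (C ν).rep : ℤ) - ((ρ.sub (wt ρ ν)).mult (C ν).rep.shift : ℤ)
    else ((ρ.sub (wt ρ ν)).mult (C ν).rep : ℤ) : ℤ) : ZMod (if Even (T.rk ν) then 0 else 2))

/-- The formal sum `∑_{μ ∈ Λ} m_μ sch_𝔥 C(μ)`; each of its coefficients is a sum with at most one
nonzero term, because `C(μ)` has only the weight `μ`. -/
def schSum (C : ∀ l : T.Wt, T.SimpleMod l) (Λ : Set T.Wt) (m : T.Wt → ℤ) : T.RedGr :=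
  fun ν => ∑ᶠ μ ∈ Λ, m μ • sch C (C μ).rep ν

end HighestWeight

/-! ### The assumptions on the triangular decomposition -/

/-- `γ(Q⁻) ⊆ ℝ` is discrete, that is, it has only finitely many points in each bounded interval
(note that `γ(Q⁻)` lies in `(-∞, 0]`). -/
def A1 : Prop :=
  ∀ c : ℝ, {r : ℝ | c ≤ r ∧ ∃ ν : AddSubgroup.closure (roots T.𝔱),
    (ν : T.Wt) ∈ T.Qneg ∧ T.γ ν = r}.Finite

/-- `F_ν ≠ 0` for each nonzero `ν ∈ Q⁻`. -/
def A2 : Prop := ∀ ν ∈ T.Qneg, ν ≠ 0 → T.F ν ≠ 0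

/-- `M(λ)` has finite length whenever `corank F_λ ≤ 1`. -/
def A3 (C : ∀ l : T.Wt, T.SimpleMod l) : Prop :=
  ∀ l : T.Wt, T.corank l ≤ 1 → (M (C l)).FiniteLength

end TriangularDatum

end SuperLie

end

/-! Since `C(ν)` has coefficient `±1` at `ν` and `0` elsewhere (`exists_sch_C`, `sch_C_of_ne`), a
formal sum supported on `Λ` can match any prescribed coefficients on `Λ`. The theorem therefore says
exactly that the coefficient of `sch L(λ)` at `ν` vanishes whenever `λ ∈ Λ` and `ν ∉ Λ`
(`sch_L_eq_zero`).

The source of the vanishing is that `sch M(λ)` is concentrated at `λ` (`sch_verma_eq_zero`). The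
weight space `M(λ)_ν` is `U(𝔫⁻)_{ν-λ} ⊗ C(λ)`, a tensor product of graded Clifford modules for the
forms `B = F_{ν-λ}` and `B' = F_λ`, hence a Clifford module for `B + B' = F_ν`; for `ν < λ` the form
`B` is nonzero by (A2). Multiplicities of `C(ν)` and `ΠC(ν)` are dimensions of spaces of vacuum
vectors, those killed by one half `a_1, …, a_k` of a system of hyperbolic pairs, sorted by parity
(`mult_eq_finrank_hvac`). The operator `proj = ∏ a_i b_i` projects onto the vacuum vectors, so the
difference of the two multiplicities is the trace of `par * proj`. On the tensor product this trace
expands into products of a trace on the left factor and a trace of `par'` times a word `J` on the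
right factor. The second trace vanishes if `J` has odd length or is shorter than `rank F_λ`. The
corank hypotheses make this happen for every `J` shorter than `dim 𝔥₁`; a term with `|J| = dim 𝔥₁`
even carries the factor `tr par`, which vanishes because `B ≠ 0`. If `rank F_ν` is odd, evenness of
the multiplicity is needed as well; it follows from divisibility of dimensions of Clifford modules
by powers of `2` (`even_finrank_vac_tensor`).

To pass from `M(λ)` to `L(λ)`: the supercharacter is additive on short exact sequences, and every
composition factor of `M(λ)` is, up to parity, some `L(μ)` with `μ ∈ Λ` and `μ ≤ λ`
(`exists_factor`). Those in the radical have `μ ≠ λ`, so that `γ(ν - μ) > γ(ν - λ)`; by (A1) an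
induction on the number of values of `γ(Q⁻)` above `γ(ν - λ)` applies to them. Hence the
coefficients at `ν ∉ Λ` of `M(λ)` and of its radical vanish, and so does that of `L(λ)`.

The description of `M(λ)` as `U(𝔫⁻) ⊗ C(λ)` is obtained without a Poincaré–Birkhoff–Witt basis: a
`𝔤`-action on that space is built by recursion (`verma`) and compared with the induced module
(`vermaEquiv`). -/

noncomputable section

namespace SuperLie

open Module (End finrank)

/-! ### Symmetric bilinear forms: hyperbolic pairs -/

section Witt

variable {Q : Type*} [AddCommGroup Q] [Module ℂ Q]

/-- A maximal system of hyperbolic pairs `(a i, b i)` for a symmetric form `B`; if the rank of `B`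
is odd, there is one more anisotropic vector `c`, orthogonal to all of them. -/
structure WittData (B : Q →ₗ[ℂ] Q →ₗ[ℂ] ℂ) where
  k : ℕ
  a : Fin k → Q
  b : Fin k → Q
  c : Q
  aa : ∀ i j, B (a i) (a j) = 0
  bb : ∀ i j, B (b i) (b j) = 0
  ab : ∀ i j, B (a i) (b j) = if i = j then 1 else 0
  ca : ∀ i, B c (a i) = 0
  cb : ∀ i, B c (b i) = 0
  rank : (c = 0 ∧ finrank ℂ (LinearMap.range B) = 2 * k) ∨
    (B c c = 2 ∧ finrank ℂ (LinearMap.range B) = 2 * k + 1)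
  span : Submodule.span ℂ (Set.range a ∪ Set.range b ∪ {c}) ⊔ LinearMap.ker B = ⊤

/-- In an orthogonal basis the isotropic vectors lie in the kernel of `B`, and the others can be
rescaled by square roots. The functionals `B (w i)` are dual to the `w i`, hence a basis of the
range, so the number of vectors is the rank. -/
theorem exists_orthonormal_span [FiniteDimensional ℂ Q] (B : Q →ₗ[ℂ] Q →ₗ[ℂ] ℂ)
    (hB : ∀ x y, B x y = B y x) :
    ∃ w : Fin (finrank ℂ (LinearMap.range B)) → Q,
      (∀ i j, B (w i) (w j) = if i = j then 1 else 0) ∧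
      Submodule.span ℂ (Set.range w) ⊔ LinearMap.ker B = ⊤ := by
  classical
  let _ : Invertible (2 : ℂ) := invertibleOfNonzero two_ne_zero
  obtain ⟨v, hv⟩ := LinearMap.BilinForm.exists_orthogonal_basis (B := B)
    ⟨fun x y => by simp [hB x y]⟩
  have hv' : ∀ i j, i ≠ j → B (v i) (v j) = 0 := fun i j h => hv h
  let S : Set (Fin (finrank ℂ Q)) := {i | B (v i) (v i) ≠ 0}
  have hsq : ∀ i : S, ∃ s : ℂ, s * s = B (v i) (v i) := fun i => by
    obtain ⟨s, hs⟩ := IsAlgClosed.exists_eq_mul_self (B (v i) (v i))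
    exact ⟨s, hs.symm⟩
  choose s hs using hsq
  have hs0 : ∀ i : S, s i ≠ 0 := fun i h => i.2 (by rw [← hs i, h, zero_mul])
  let w : S → Q := fun i => (s i)⁻¹ • v i
  have hw : ∀ i j, B (w i) (w j) = if i = j then 1 else 0 := by
    intro i j
    simp only [w, map_smul, LinearMap.smul_apply, smul_eq_mul]
    split_ifs with h
    · subst h
      rw [← hs i]
      field_simp [hs0 i]
    · rw [hv' _ _ (fun h' => h (Subtype.ext h')), mul_zero, mul_zero]
  have hspan : Submodule.span ℂ (Set.range w) ⊔ LinearMap.ker B = ⊤ := by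
    rw [eq_top_iff, ← v.span_eq, Submodule.span_le]
    rintro _ ⟨i, rfl⟩
    by_cases hi : B (v i) (v i) = 0
    · refine (le_sup_right : LinearMap.ker B ≤ _) ?_
      refine v.ext fun j => ?_
      by_cases h : i = j
      · subst h; simpa using hi
      · simpa using hv' i j h
    · refine (le_sup_left : Submodule.span ℂ (Set.range w) ≤ _) ?_
      have : v i = s ⟨i, hi⟩ • w ⟨i, hi⟩ := by
        simp only [w, smul_smul]
        rw [mul_inv_cancel₀ (hs0 _), one_smul]
      rw [this]
      exact Submodule.smul_mem _ _ (Submodule.subset_span ⟨_, rfl⟩)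
  have hrange : LinearMap.range B = Submodule.span ℂ (Set.range fun i => B (w i)) := by
    rw [← Submodule.map_top, ← hspan, Submodule.map_sup, Submodule.map_span, ← Set.range_comp]
    have : (LinearMap.ker B).map B = ⊥ := by
      rw [eq_bot_iff]
      rintro _ ⟨x, hx, rfl⟩
      exact hx
    rw [this, sup_bot_eq]
    rfl
  have hli : LinearIndependent ℂ (fun i => B (w i)) := by
    rw [Fintype.linearIndependent_iff]
    intro g hg i
    have := LinearMap.congr_fun hg (w i)
    simpa [hw] using this
  have hcard : Fintype.card S = finrank ℂ (LinearMap.range B) := by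
    rw [hrange, finrank_span_eq_card hli]
  let e : Fin (finrank ℂ (LinearMap.range B)) ≃ S := (Fintype.equivFinOfCardEq hcard).symm
  refine ⟨w ∘ e, fun i j => ?_, ?_⟩
  · simp [hw]
  · rw [e.surjective.range_comp]
    exact hspan

/-- Orthonormal vectors `e, f` combine to the isotropic pair `a = e + i f`, `b = (e - i f) / 2`. A
vector left over in odd rank is scaled to `B c c = 2`, so that the Clifford relation makes `c` act
with square `1`. -/
theorem nonempty_wittData [FiniteDimensional ℂ Q] (B : Q →ₗ[ℂ] Q →ₗ[ℂ] ℂ)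
    (hB : ∀ x y, B x y = B y x) : Nonempty (WittData B) := by
  obtain ⟨w, hw, hspan⟩ := exists_orthonormal_span B hB
  generalize hr : finrank ℂ (LinearMap.range B) = r at w hw hspan
  obtain ⟨k, hk⟩ := Nat.even_or_odd' r
  have hk2 : ∀ i : Fin k, 2 * (i : ℕ) + 1 < r := fun i => by omega
  let e : Fin k → Q := fun i => w ⟨2 * i, by have := hk2 i; omega⟩
  let f : Fin k → Q := fun i => w ⟨2 * i + 1, hk2 i⟩
  have he : ∀ i j, B (e i) (e j) = if i = j then 1 else 0 := fun i j => by
    simp [e, hw, Fin.ext_iff]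
  have hf : ∀ i j, B (f i) (f j) = if i = j then 1 else 0 := fun i j => by
    simp [f, hw, Fin.ext_iff]
  have hef : ∀ i j, B (e i) (f j) = 0 := fun i j => by
    simp only [e, f, hw, Fin.ext_iff]
    rw [if_neg (by omega)]
  have hfe : ∀ i j, B (f i) (e j) = 0 := fun i j => by rw [hB, hef]
  have hI : Complex.I * Complex.I = -1 := Complex.I_mul_I
  obtain ⟨s, hs⟩ := IsAlgClosed.exists_eq_mul_self (2 : ℂ)
  have hs0 : s ≠ 0 := by rintro rfl; norm_num at hs
  let c : Q := if h : 2 * k < r then s • w ⟨2 * k, h⟩ else 0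
  have hce : ∀ i, B c (e i) = 0 := fun i => by
    simp only [c]
    split_ifs with h
    · simp only [e, map_smul, LinearMap.smul_apply, hw, Fin.ext_iff]
      rw [if_neg (by omega), smul_zero]
    · simp
  have hcf : ∀ i, B c (f i) = 0 := fun i => by
    simp only [c]
    split_ifs with h
    · simp only [f, map_smul, LinearMap.smul_apply, hw, Fin.ext_iff]
      rw [if_neg (by omega), smul_zero]
    · simp
  let a : Fin k → Q := fun i => e i + Complex.I • f i
  let b : Fin k → Q := fun i => (2⁻¹ : ℂ) • (e i - Complex.I • f i)
  refine ⟨⟨k, a, b, c, ?_, ?_, ?_, ?_, ?_, ?_, ?_⟩⟩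
  · intro i j
    simp only [a, map_add, map_smul, LinearMap.add_apply, LinearMap.smul_apply, he, hf, hef, hfe,
      smul_eq_mul, zero_add]
    split_ifs
    · linear_combination hI
    · ring
  · intro i j
    simp only [b, map_sub, map_smul, LinearMap.sub_apply, LinearMap.smul_apply, he, hf, hef, hfe,
      smul_eq_mul]
    split_ifs
    · linear_combination (1/4) * hI
    · ring
  · intro i j
    simp only [a, b, map_add, map_sub, map_smul, LinearMap.add_apply, LinearMap.smul_apply, he, hf,
      hef, hfe, smul_eq_mul]
    split_ifs
    · linear_combination (-1/2) * hI
    · ring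
  · intro i; simp [a, hce, hcf]
  · intro i; simp [b, hce, hcf]
  · rcases hk with hk | hk
    · exact Or.inl ⟨by simp [c, hk], hr.trans hk⟩
    · right
      have h : 2 * k < r := by omega
      refine ⟨?_, hr.trans hk⟩
      simp only [c, dif_pos h, map_smul, LinearMap.smul_apply, hw]
      simp [hs]
  · rw [eq_top_iff, ← hspan]
    refine sup_le_sup_right (Submodule.span_le.2 ?_) _
    rintro _ ⟨j, rfl⟩
    have ha : ∀ i, a i ∈ Submodule.span ℂ (Set.range a ∪ Set.range b ∪ {c}) := fun i =>
      Submodule.subset_span (Or.inl (Or.inl ⟨i, rfl⟩))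
    have hb : ∀ i, b i ∈ Submodule.span ℂ (Set.range a ∪ Set.range b ∪ {c}) := fun i =>
      Submodule.subset_span (Or.inl (Or.inr ⟨i, rfl⟩))
    obtain ⟨j, hj⟩ := j
    obtain ⟨i, hi⟩ := Nat.even_or_odd' j
    by_cases hik : i < k
    · rcases hi with rfl | rfl
      · have : w ⟨2 * i, hj⟩ = (2⁻¹ : ℂ) • a ⟨i, hik⟩ + b ⟨i, hik⟩ := by
          change e ⟨i, hik⟩ = _
          simp only [a, b]
          module
        rw [this]
        exact add_mem (Submodule.smul_mem _ _ (ha _)) (hb _)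
      · have : w ⟨2 * i + 1, hj⟩ = (-(2⁻¹ : ℂ) * Complex.I) • a ⟨i, hik⟩ +
            Complex.I • b ⟨i, hik⟩ := by
          change f ⟨i, hik⟩ = _
          simp only [a, b]
          match_scalars <;> first | ring1 | linear_combination hI
        rw [this]
        exact add_mem (Submodule.smul_mem _ _ (ha _)) (Submodule.smul_mem _ _ (hb _))
    · have hj' : j = 2 * k := by omega
      subst hj'
      have : w ⟨2 * k, hj⟩ = s⁻¹ • c := by
        simp only [c, dif_pos hj, smul_smul]
        rw [inv_mul_cancel₀ hs0, one_smul]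
      rw [this]
      exact Submodule.smul_mem _ _ (Submodule.subset_span (Or.inr rfl))

end Witt

/-! ### Clifford modules -/

section Clifford

variable {Q V : Type*} [AddCommGroup Q] [Module ℂ Q] [AddCommGroup V] [Module ℂ V]

/-- `V`, with parity operator `par`, is a `ℤ/2`-graded module over the Clifford algebra of `B`;
`o x` is the action of `x`. -/
structure CliffMod (B : Q →ₗ[ℂ] Q →ₗ[ℂ] ℂ) (par : End ℂ V) (o : Q →ₗ[ℂ] End ℂ V) : Prop where
  par_par : par * par = 1
  par_o : ∀ x, par * o x = -(o x * par)
  rel : ∀ x y, o x * o y + o y * o x = B x y • (1 : End ℂ V)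

/-- The sign `(-1)^p`. -/
def psgn (p : ZMod 2) : ℂ := if p = 0 then 1 else -1

theorem psgn_mul_self (p : ZMod 2) : psgn p * psgn p = 1 := by
  unfold psgn; split_ifs <;> norm_num

theorem psgn_add_one (p : ZMod 2) : psgn (p + 1) = -psgn p := by
  have h : ∀ q : ZMod 2, (q + 1 = 0 ↔ ¬ q = 0) := by decide
  unfold psgn
  by_cases hp : p = 0
  · simp [hp]
  · simp [hp, (h p).2 hp]

namespace WittData

variable {B : Q →ₗ[ℂ] Q →ₗ[ℂ] ℂ} (w : WittData B)

theorem ba (hB : ∀ x y, B x y = B y x) (i j : Fin w.k) :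
    B (w.b i) (w.a j) = if i = j then 1 else 0 := by
  rw [hB, w.ab]; simp [eq_comm]

variable (o : Q →ₗ[ℂ] End ℂ V) (par : End ℂ V)

/-- The product of the elements `a i * b i`, for `i` in a list. -/
def projL (l : List (Fin w.k)) : End ℂ V := (l.map fun i => o (w.a i) * o (w.b i)).prod

/-- The projection to the vacuum space. -/
def proj : End ℂ V := w.projL o (List.finRange w.k)

/-- The vacuum vectors of parity `p`. -/
def vac (p : ZMod 2) : Submodule ℂ V where
  carrier := {v | (∀ i, o (w.a i) v = 0) ∧ par v = psgn p • v}
  add_mem' := by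
    rintro x y ⟨hx, hx'⟩ ⟨hy, hy'⟩
    exact ⟨fun i => by rw [map_add, hx, hy, add_zero], by rw [map_add, hx', hy', smul_add]⟩
  zero_mem' := by simp
  smul_mem' := by
    rintro c x ⟨hx, hx'⟩
    exact ⟨fun i => by rw [map_smul, hx, smul_zero], by rw [map_smul, hx', smul_comm]⟩

/-- The projection to the vacuum vectors of parity `p`. -/
def vproj (p : ZMod 2) : End ℂ V := (2⁻¹ : ℂ) • (1 + psgn p • par) * w.proj o

end WittData

namespace CliffMod

variable {B : Q →ₗ[ℂ] Q →ₗ[ℂ] ℂ} {par : End ℂ V} {o : Q →ₗ[ℂ] End ℂ V}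
  (h : CliffMod B par o) (w : WittData B)

include h

theorem anti {x y : Q} (hxy : B x y = 0) : o x * o y = -(o y * o x) := by
  have := h.rel x y
  rw [hxy, zero_smul] at this
  exact eq_neg_of_add_eq_zero_left this

theorem sq_zero {x : Q} (hx : B x x = 0) : o x * o x = 0 := by
  have := h.rel x x
  rw [hx, zero_smul, ← two_smul ℂ] at this
  exact (smul_eq_zero.1 this).resolve_left two_ne_zero

theorem commute_pair {x y z : Q} (hy : B x y = 0) (hz : B x z = 0) :
    Commute (o x) (o y * o z) := by
  change o x * (o y * o z) = o y * o z * o x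
  rw [← mul_assoc, h.anti hy, neg_mul, mul_assoc, h.anti hz, mul_neg, neg_neg, mul_assoc]

theorem par_commute_pair (x y : Q) : Commute par (o x * o y) := by
  change par * (o x * o y) = o x * o y * par
  rw [← mul_assoc, h.par_o, neg_mul, mul_assoc, h.par_o, mul_neg, neg_neg, mul_assoc]

theorem par_commute_projL (l : List (Fin w.k)) : Commute par (w.projL o l) := by
  unfold WittData.projL
  refine Commute.list_prod_right _ _ fun x hx => ?_
  obtain ⟨i, -, rfl⟩ := List.mem_map.1 hx
  exact h.par_commute_pair _ _

theorem par_commute_proj : Commute par (w.proj o) := h.par_commute_projL w _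

theorem c_commute_proj : Commute (o w.c) (w.proj o) := by
  unfold WittData.proj WittData.projL
  refine Commute.list_prod_right _ _ fun x hx => ?_
  obtain ⟨i, -, rfl⟩ := List.mem_map.1 hx
  exact h.commute_pair (w.ca i) (w.cb i)

theorem commute_a {i j : Fin w.k} (hij : i ≠ j) : Commute (o (w.a i)) (o (w.a j) * o (w.b j)) :=
  h.commute_pair (w.aa i j) (by rw [w.ab, if_neg hij])

theorem commute_b (hB : ∀ x y, B x y = B y x) {i j : Fin w.k} (hij : i ≠ j) :
    Commute (o (w.b i)) (o (w.a j) * o (w.b j)) :=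
  h.commute_pair (by rw [w.ba hB, if_neg hij]) (w.bb i j)

/-- The operator of `a j` commutes past all pairs of other index and meets itself, where its square
is zero. -/
theorem a_mul_projL (l : List (Fin w.k)) (j : Fin w.k) (hj : j ∈ l) :
    o (w.a j) * w.projL o l = 0 := by
  unfold WittData.projL
  induction l with
  | nil => simp at hj
  | cons i l ih =>
    rw [List.map_cons, List.prod_cons]
    by_cases hij : j = i
    · subst hij
      rw [← mul_assoc, ← mul_assoc, h.sq_zero (w.aa j j), zero_mul, zero_mul]
    · rw [← mul_assoc, (h.commute_a w hij).eq, mul_assoc, ih (by simpa [hij] using hj), mul_zero]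

/-- The last occurrence of `j` in the list is the one that kills: everything to its right commutes
with the operator of `b j`, whose square is zero. -/
theorem projL_mul_b (hB : ∀ x y, B x y = B y x) (l : List (Fin w.k)) (j : Fin w.k) (hj : j ∈ l) :
    w.projL o l * o (w.b j) = 0 := by
  have comm : ∀ l : List (Fin w.k), j ∉ l → Commute (o (w.b j)) (w.projL o l) := fun l hl => by
    unfold WittData.projL
    refine Commute.list_prod_right _ _ fun x hx => ?_
    obtain ⟨i, hi, rfl⟩ := List.mem_map.1 hx
    exact h.commute_b w hB (by rintro rfl; exact hl hi)
  induction l with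
  | nil => simp at hj
  | cons i l ih =>
    have e : w.projL o (i :: l) = o (w.a i) * o (w.b i) * w.projL o l := by
      simp [WittData.projL]
    rw [e, mul_assoc]
    by_cases hjl : j ∈ l
    · rw [ih hjl, mul_zero]
    · obtain rfl : j = i := by simpa [hjl] using hj
      rw [← (comm l hjl).eq, ← mul_assoc, mul_assoc (o (w.a j)), h.sq_zero (w.bb j j), mul_zero,
        zero_mul]

theorem a_mul_proj (j : Fin w.k) : o (w.a j) * w.proj o = 0 :=
  h.a_mul_projL w _ j (List.mem_finRange j)

theorem proj_mul_b (hB : ∀ x y, B x y = B y x) (j : Fin w.k) : w.proj o * o (w.b j) = 0 :=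
  h.projL_mul_b w hB _ j (List.mem_finRange j)

/-- On a vacuum vector `a i * b i` acts as `a i * b i + b i * a i = 1`. -/
theorem proj_apply_of_vac {v : V} (hv : ∀ i, o (w.a i) v = 0) : w.proj o v = v := by
  unfold WittData.proj WittData.projL
  induction List.finRange w.k with
  | nil => simp
  | cons i l ih =>
    rw [List.map_cons, List.prod_cons, Module.End.mul_apply, ih]
    have := LinearMap.congr_fun (h.rel (w.a i) (w.b i)) v
    simpa [w.ab, hv] using this

/-- The image of `proj` is killed by every `a i`, `proj` fixes the vacuum vectors, and it commutes
with the parity projector. This turns dimensions of vacuum spaces into traces. -/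
theorem vproj_isProj (p : ZMod 2) : LinearMap.IsProj (w.vac o par p) (w.vproj o par p) := by
  constructor
  · intro v
    have e : w.vproj o par p = w.proj o * (2⁻¹ : ℂ) • (1 + psgn p • par) := by
      have : Commute ((2⁻¹ : ℂ) • (1 + psgn p • par)) (w.proj o) :=
        ((Commute.one_left _).add_left ((h.par_commute_proj w).smul_left _)).smul_left _
      exact this.eq
    refine ⟨fun i => ?_, ?_⟩
    · rw [e]
      exact LinearMap.congr_fun (h.a_mul_proj w i) _
    · have : par * ((2⁻¹ : ℂ) • (1 + psgn p • par)) =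
          psgn p • ((2⁻¹ : ℂ) • (1 + psgn p • par)) := by
        simp only [mul_smul_comm, mul_add, mul_one, h.par_par, smul_add, smul_smul]
        rw [show psgn p * (2⁻¹ * psgn p) = 2⁻¹ * (psgn p * psgn p) by ring, psgn_mul_self]
        module
      exact LinearMap.congr_fun this (w.proj o v)
  · rintro v ⟨hv, hv'⟩
    rw [WittData.vproj, Module.End.mul_apply, h.proj_apply_of_vac w hv]
    simp only [LinearMap.smul_apply, LinearMap.add_apply, Module.End.one_apply, hv', smul_smul,
      psgn_mul_self]
    module

section Trace

variable [FiniteDimensional ℂ V]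

/-- The rank of a projector is its trace. Consequently the even and odd vacuum dimensions differ
exactly by the trace of `par * proj`. -/
theorem two_mul_finrank_vac (p : ZMod 2) :
    2 * (finrank ℂ (w.vac o par p) : ℂ) =
      LinearMap.trace ℂ V (w.proj o) + psgn p * LinearMap.trace ℂ V (par * w.proj o) := by
  rw [← (h.vproj_isProj w p).trace, WittData.vproj, smul_mul_assoc, add_mul, one_mul,
    smul_mul_assoc]
  simp
  ring

/-- If `P` is the product over the remaining pairs, `a i` commutes with `P`, so cyclicity gives `tr
(a i b i P) = tr (b i a i P)`. The two traces add up to `tr P`, so each pair halves the trace. -/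
theorem pow_mul_trace_proj :
    2 ^ w.k * LinearMap.trace ℂ V (w.proj o) = finrank ℂ V := by
  have key : ∀ l : List (Fin w.k), l.Nodup →
      2 ^ l.length * LinearMap.trace ℂ V (w.projL o l) = finrank ℂ V := by
    intro l hl
    induction l with
    | nil => simp [WittData.projL]
    | cons i l ih =>
      obtain ⟨hi, hl⟩ := List.nodup_cons.1 hl
      rw [← ih hl, List.length_cons, pow_succ, mul_assoc]
      congr 1
      have e : w.projL o (i :: l) = o (w.a i) * o (w.b i) * w.projL o l := by
        simp [WittData.projL]
      have ca : Commute (o (w.a i)) (w.projL o l) := by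
        unfold WittData.projL
        refine Commute.list_prod_right _ _ fun x hx => ?_
        obtain ⟨j, hj, rfl⟩ := List.mem_map.1 hx
        exact h.commute_a w (by rintro rfl; exact hi hj)
      have t1 : LinearMap.trace ℂ V (o (w.a i) * o (w.b i) * w.projL o l) =
          LinearMap.trace ℂ V (o (w.b i) * o (w.a i) * w.projL o l) := by
        rw [mul_assoc, LinearMap.trace_mul_comm, mul_assoc, ← ca.eq, mul_assoc]
      have t2 : o (w.b i) * o (w.a i) = 1 - o (w.a i) * o (w.b i) := by
        have := h.rel (w.a i) (w.b i)
        rw [w.ab, if_pos rfl, one_smul] at this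
        rw [← this]; abel
      rw [t2, sub_mul, one_mul, map_sub] at t1
      rw [e]
      linear_combination t1
  have := key _ (List.nodup_finRange w.k)
  rwa [List.length_finRange] at this

end Trace

/-- By polarization some `x` has `B x x ≠ 0`. Its operator is then invertible and anticommutes with
`par`, which forces the trace of `par` to equal its own negative. -/
theorem trace_par_eq_zero (hB : B ≠ 0) (hs : ∀ x y, B x y = B y x) :
    LinearMap.trace ℂ V par = 0 := by
  obtain ⟨x, hx⟩ : ∃ x, B x x ≠ 0 := by
    by_contra! hx
    refine hB (LinearMap.ext fun x => LinearMap.ext fun y => ?_)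
    have := hx (x + y)
    simp only [map_add, LinearMap.add_apply, hx, hs y x] at this
    simpa using this
  have e : B x x • (1 : End ℂ V) = (2 : ℂ) • (o x * o x) := by rw [← h.rel x x, two_smul]
  have t : LinearMap.trace ℂ V (par * (o x * o x)) = 0 := by
    have : LinearMap.trace ℂ V (par * (o x * o x)) = -LinearMap.trace ℂ V (par * (o x * o x)) := by
      conv_lhs => rw [← mul_assoc, h.par_o, neg_mul, map_neg, mul_assoc, LinearMap.trace_mul_comm,
        mul_assoc]
    have h2 : (2 : ℂ) * LinearMap.trace ℂ V (par * (o x * o x)) = 0 := by linear_combination this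
    simpa using h2
  have : B x x * LinearMap.trace ℂ V par = 0 := by
    rw [← smul_eq_mul, ← map_smul, ← mul_one par, ← mul_smul_comm, e, mul_smul_comm, map_smul, t,
      smul_zero]
  exact (mul_eq_zero.1 this).resolve_left hx

end CliffMod

end Clifford

/-! ### Words of Clifford operators and their supertraces -/

section Clifford

variable {Q V : Type*} [AddCommGroup Q] [Module ℂ Q] [AddCommGroup V] [Module ℂ V]

/-- The operator by which a word in `Q` acts. -/
def oprod (o : Q →ₗ[ℂ] End ℂ V) (l : List Q) : End ℂ V := (l.map o).prod

theorem oprod_cons (o : Q →ₗ[ℂ] End ℂ V) (x : Q) (l : List Q) :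
    oprod o (x :: l) = o x * oprod o l := by simp [oprod]

theorem oprod_append (o : Q →ₗ[ℂ] End ℂ V) (l l' : List Q) :
    oprod o (l ++ l') = oprod o l * oprod o l' := by simp [oprod]

/-- The word `a 0, b 0, a 1, b 1, …`. -/
def WittData.word {B : Q →ₗ[ℂ] Q →ₗ[ℂ] ℂ} (w : WittData B) : List Q :=
  (List.finRange w.k).flatMap fun i => [w.a i, w.b i]

theorem WittData.length_word {B : Q →ₗ[ℂ] Q →ₗ[ℂ] ℂ} (w : WittData B) :
    w.word.length = 2 * w.k := by
  simp [WittData.word, List.length_flatMap, mul_comm]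

theorem WittData.proj_eq_oprod {B : Q →ₗ[ℂ] Q →ₗ[ℂ] ℂ} (w : WittData B) (o : Q →ₗ[ℂ] End ℂ V) :
    w.proj o = oprod o w.word := by
  unfold WittData.proj WittData.projL WittData.word oprod
  induction List.finRange w.k with
  | nil => rfl
  | cons i l ih => simp [ih, mul_assoc]

namespace CliffMod

variable {B : Q →ₗ[ℂ] Q →ₗ[ℂ] ℂ} {par : End ℂ V} {o : Q →ₗ[ℂ] End ℂ V}
  (h : CliffMod B par o)

include h

theorem par_mul_oprod (l : List Q) :
    par * oprod o l = (-1 : ℂ) ^ l.length • (oprod o l * par) := by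
  induction l with
  | nil => simp [oprod]
  | cons x l ih =>
    rw [oprod_cons, ← mul_assoc, h.par_o, neg_mul, mul_assoc, ih, List.length_cons, pow_succ,
      mul_smul_comm, mul_assoc]
    simp

theorem mul_oprod_of_orthogonal {y : Q} (l : List Q) (hy : ∀ x ∈ l, B y x = 0) :
    o y * oprod o l = (-1 : ℂ) ^ l.length • (oprod o l * o y) := by
  induction l with
  | nil => simp [oprod]
  | cons x l ih =>
    rw [oprod_cons, ← mul_assoc, h.anti (hy x (by simp)), neg_mul, mul_assoc,
      ih fun z hz => hy z (by simp [hz]), List.length_cons, pow_succ, mul_smul_comm, mul_assoc]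
    simp

/-- Parity anticommutes with a word of odd length, while cyclicity lets it commute inside the trace.
-/
theorem trace_par_mul_oprod_of_odd (l : List Q) (hl : Odd l.length) :
    LinearMap.trace ℂ V (par * oprod o l) = 0 := by
  have e : par * oprod o l = -(oprod o l * par) := by
    rw [h.par_mul_oprod, hl.neg_one_pow, neg_smul, one_smul]
  have := LinearMap.trace_mul_comm ℂ par (oprod o l)
  rw [e, map_neg] at this
  rw [e, map_neg]
  have h2 : (2 : ℂ) * LinearMap.trace ℂ V (oprod o l * par) = 0 := by linear_combination -this
  simpa using h2

/-- For a short word of even length there is `y` outside the kernel of `B` and orthogonal to all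
letters; `y` commutes with the word and anticommutes with `par`. Hence the trace of `par * word * (y
z + z y)` vanishes for every `z`, and for a suitable `z` the bracket is a nonzero scalar. -/
theorem trace_par_mul_oprod [FiniteDimensional ℂ Q] (l : List Q)
    (hl : l.length < finrank ℂ (LinearMap.range B)) :
    LinearMap.trace ℂ V (par * oprod o l) = 0 := by
  rcases Nat.even_or_odd l.length with he | he
  swap
  · exact h.trace_par_mul_oprod_of_odd l he
  let f : Q →ₗ[ℂ] (Fin l.length → ℂ) := LinearMap.pi fun i => B.flip (l.get i)
  -- Dimension count: fewer than `rank B` linear conditions cut out a space of dimension larger than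
  -- that of the kernel of `B`.
  obtain ⟨y, hy, hy'⟩ : ∃ y ∈ LinearMap.ker f, y ∉ LinearMap.ker B := by
    by_contra! hc
    have h1 : finrank ℂ (LinearMap.ker f) ≤ finrank ℂ (LinearMap.ker B) :=
      Submodule.finrank_mono hc
    have h2 := LinearMap.finrank_range_add_finrank_ker f
    have h3 := LinearMap.finrank_range_add_finrank_ker B
    have h4 : finrank ℂ (LinearMap.range f) ≤ l.length := by
      simpa using Submodule.finrank_le (LinearMap.range f)
    omega
  have hyl : ∀ x ∈ l, B y x = 0 := by
    intro x hx
    obtain ⟨i, rfl⟩ := List.get_of_mem hx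
    exact congrFun hy i
  obtain ⟨z, hz⟩ : ∃ z, B y z ≠ 0 := by
    by_contra! hc
    exact hy' (LinearMap.ext hc)
  have c : o y * oprod o l = oprod o l * o y := by
    rw [h.mul_oprod_of_orthogonal l hyl, he.neg_one_pow, one_smul]
  have t : LinearMap.trace ℂ V (par * oprod o l * (o y * o z + o z * o y)) = 0 := by
    rw [mul_add, map_add, ← mul_assoc, ← mul_assoc, LinearMap.trace_mul_comm _ _ (o y),
      mul_assoc par, ← c, ← mul_assoc, ← mul_assoc, ← mul_assoc, h.par_o]
    simp
  rw [h.rel, mul_smul_comm, mul_one, map_smul, smul_eq_mul] at t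
  exact (mul_eq_zero.1 t).resolve_left hz

end CliffMod

end Clifford

/-! ### Tensor products of Clifford modules -/

section Tensor

variable {Q V V' : Type*} [AddCommGroup Q] [Module ℂ Q] [AddCommGroup V] [Module ℂ V]
  [AddCommGroup V'] [Module ℂ V']

/-- The action on a tensor product. -/
def tensorO (o : Q →ₗ[ℂ] End ℂ V) (par : End ℂ V) (o' : Q →ₗ[ℂ] End ℂ V') :
    Q →ₗ[ℂ] End ℂ (V ⊗[ℂ] V') :=
  (TensorProduct.mapBilinear (.id ℂ) V V' V V').flip 1 ∘ₗ o +
    TensorProduct.mapBilinear (.id ℂ) V V' V V' par ∘ₗ o'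

theorem tensorO_apply (o : Q →ₗ[ℂ] End ℂ V) (par : End ℂ V) (o' : Q →ₗ[ℂ] End ℂ V') (x : Q) :
    tensorO o par o' x = TensorProduct.map (o x) 1 + TensorProduct.map par (o' x) := rfl

variable {B B' : Q →ₗ[ℂ] Q →ₗ[ℂ] ℂ} {par : End ℂ V} {o : Q →ₗ[ℂ] End ℂ V} {par' : End ℂ V'}
  {o' : Q →ₗ[ℂ] End ℂ V'}

/-- The cross terms cancel because `o x` anticommutes with the `par` that accompanies `o' y`. So the
forms add, as `F` does in the weight. -/
theorem CliffMod.tensor (h : CliffMod B par o) (h' : CliffMod B' par' o') :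
    CliffMod (B + B') (TensorProduct.map par par') (tensorO o par o') := by
  refine ⟨?_, fun x => ?_, fun x y => ?_⟩
  · rw [← TensorProduct.map_mul, h.par_par, h'.par_par, TensorProduct.map_one]
  · simp only [tensorO_apply, mul_add, add_mul, ← TensorProduct.map_mul, h.par_o, h'.par_o, mul_one,
      one_mul]
    ext v w
    simp [TensorProduct.neg_tmul, TensorProduct.tmul_neg]
    abel
  · have e1 := h.rel x y
    have e2 := h'.rel x y
    have e3 := h.par_o x
    have e4 := h.par_o y
    ext v w
    have e1' := LinearMap.congr_fun e1 v
    have e2' := LinearMap.congr_fun e2 w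
    have e3' := LinearMap.congr_fun e3 v
    have e4' := LinearMap.congr_fun e4 v
    have e5' := LinearMap.congr_fun h.par_par v
    simp only [LinearMap.add_apply, Module.End.mul_apply, LinearMap.smul_apply,
      Module.End.one_apply, LinearMap.neg_apply] at e1' e2' e3' e4' e5'
    simp only [tensorO_apply, LinearMap.add_apply, Module.End.mul_apply, LinearMap.smul_apply,
      Module.End.one_apply, TensorProduct.map_tmul, map_add,
      TensorProduct.AlgebraTensorModule.curry_apply, TensorProduct.curry_apply,
      LinearMap.coe_restrictScalars, e3', e4', e5', TensorProduct.neg_tmul]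
    have f1 : o x (o y v) ⊗ₜ[ℂ] w + o y (o x v) ⊗ₜ[ℂ] w = B x y • v ⊗ₜ[ℂ] w := by
      rw [← TensorProduct.add_tmul, e1', TensorProduct.smul_tmul']
    have f2 : v ⊗ₜ[ℂ] o' x (o' y w) + v ⊗ₜ[ℂ] o' y (o' x w) = B' x y • v ⊗ₜ[ℂ] w := by
      rw [← TensorProduct.tmul_add, e2', TensorProduct.tmul_smul]
    rw [add_smul, ← f1, ← f2]
    abel

/-- Expanding letter by letter, each letter acts either on the left factor, where it is absorbed
into the arbitrary operator `A`, or on the right one, where it lengthens `J`. Every resulting trace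
is a product whose right factor is the supertrace of a word shorter than `n`. -/
theorem trace_par_mul_oprod_tensor_aux [FiniteDimensional ℂ V] [FiniteDimensional ℂ V']
    [FiniteDimensional ℂ Q] (n : ℕ)
    (hn : ∀ J : List Q, J.length < n → LinearMap.trace ℂ V' (par' * oprod o' J) = 0)
    (l : List Q) : ∀ (J : List Q) (A : End ℂ V), J.length + l.length < n →
      LinearMap.trace ℂ (V ⊗[ℂ] V') (TensorProduct.map par par' *
        TensorProduct.map A (oprod o' J) * oprod (tensorO o par o') l) = 0 := by
  induction l with
  | nil =>
    intro J A hJ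
    rw [show oprod (tensorO o par o') [] = 1 by simp [oprod], mul_one, ← TensorProduct.map_mul,
      LinearMap.trace_tensorProduct', hn J (by simpa using hJ), mul_zero]
  | cons x l ih =>
    intro J A hJ
    rw [List.length_cons] at hJ
    rw [oprod_cons, ← mul_assoc, tensorO_apply, mul_assoc (TensorProduct.map par par'), mul_add,
      ← TensorProduct.map_mul, ← TensorProduct.map_mul, mul_one, mul_add, add_mul, map_add,
      ih J _ (by omega), zero_add]
    have e : oprod o' J * o' x = oprod o' (J ++ [x]) := by
      rw [oprod_append]; simp [oprod]
    rw [e, ih _ _ (by simp; omega)]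

/-- In total length exactly `n`, as soon as one letter acts on the left the right word stays shorter
than `n` and the preceding lemma applies. What is left is the term with all letters on the right,
where the left operator is `par ^ n`: an odd right word has supertrace zero, and for even `n` the
factor `tr par` appears. -/
theorem trace_par_mul_oprod_tensor [FiniteDimensional ℂ V] [FiniteDimensional ℂ V']
    [FiniteDimensional ℂ Q] (h : CliffMod B par o) (h' : CliffMod B' par' o') (n : ℕ)
    (hn : ∀ J : List Q, J.length < n → LinearMap.trace ℂ V' (par' * oprod o' J) = 0)
    (hodd : Odd n ∨ LinearMap.trace ℂ V par = 0)
    (l : List Q) : ∀ (J : List Q), J.length + l.length = n →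
      LinearMap.trace ℂ (V ⊗[ℂ] V') (TensorProduct.map par par' *
        TensorProduct.map (par ^ J.length) (oprod o' J) * oprod (tensorO o par o') l) = 0 := by
  induction l with
  | nil =>
    intro J hJ
    rw [show oprod (tensorO o par o') [] = 1 by simp [oprod], mul_one, ← TensorProduct.map_mul,
      LinearMap.trace_tensorProduct']
    rcases Nat.even_or_odd J.length with he | he
    · obtain ⟨m, hm⟩ := he
      have : par ^ J.length = 1 := by
        rw [hm, ← two_mul, pow_mul, pow_two, h.par_par, one_pow]
      have ho : ¬ Odd n := by
        rw [← hJ, List.length_nil, add_zero, hm, Nat.not_odd_iff_even]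
        exact ⟨m, rfl⟩
      rw [this, mul_one, hodd.resolve_left ho, zero_mul]
    · rw [h'.trace_par_mul_oprod_of_odd J he, mul_zero]
  | cons x l ih =>
    intro J hJ
    rw [List.length_cons] at hJ
    rw [oprod_cons, ← mul_assoc, tensorO_apply, mul_assoc (TensorProduct.map par par'), mul_add,
      ← TensorProduct.map_mul, ← TensorProduct.map_mul, mul_one, mul_add, add_mul, map_add,
      trace_par_mul_oprod_tensor_aux n hn l J _ (by omega), zero_add]
    have e : oprod o' J * o' x = oprod o' (J ++ [x]) := by
      rw [oprod_append]; simp [oprod]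
    have e' : par ^ J.length * par = par ^ (J ++ [x]).length := by
      rw [← pow_succ]; simp
    rw [e, e', ih _ (by simp; omega)]

end Tensor

/-! ### Vacuum dimensions and divisibility -/

section Clifford

variable {Q V : Type*} [AddCommGroup Q] [Module ℂ Q] [AddCommGroup V] [Module ℂ V]

namespace CliffMod

variable {B : Q →ₗ[ℂ] Q →ₗ[ℂ] ℂ} {par : End ℂ V} {o : Q →ₗ[ℂ] End ℂ V}
  (h : CliffMod B par o) (w : WittData B)

include h

/-- The operator of `c` has square `1`, commutes with `proj` and anticommutes with `par`. In odd
rank it thus exchanges even and odd vacuum vectors. -/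
theorem trace_par_mul_proj_of_odd (hc : B w.c w.c = 2) :
    LinearMap.trace ℂ V (par * w.proj o) = 0 := by
  have e : o w.c * o w.c = 1 := by
    have := h.rel w.c w.c
    rw [hc, ← two_smul ℂ] at this
    exact smul_right_injective _ two_ne_zero this
  have t : LinearMap.trace ℂ V (par * w.proj o * o w.c * o w.c) =
      -LinearMap.trace ℂ V (par * w.proj o * o w.c * o w.c) := by
    conv_lhs => rw [LinearMap.trace_mul_comm, ← mul_assoc, ← mul_assoc, ← neg_neg (o w.c * par),
      ← h.par_o, neg_mul, mul_assoc par, (h.c_commute_proj w).eq, ← mul_assoc, neg_mul, map_neg]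
  rw [mul_assoc _ (o w.c), e, mul_one] at t
  have h2 : (2 : ℂ) * LinearMap.trace ℂ V (par * w.proj o) = 0 := by linear_combination t
  simpa using h2

variable [FiniteDimensional ℂ V]

theorem finrank_eq_pow_mul :
    finrank ℂ V = 2 ^ w.k * (finrank ℂ (w.vac o par 0) + finrank ℂ (w.vac o par 1)) := by
  have h0 := h.two_mul_finrank_vac w 0
  have h1 := h.two_mul_finrank_vac w 1
  have ht := h.pow_mul_trace_proj w
  simp only [psgn, if_true, one_ne_zero, if_false] at h0 h1
  have : ((finrank ℂ V : ℕ) : ℂ) =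
      ((2 ^ w.k * (finrank ℂ (w.vac o par 0) + finrank ℂ (w.vac o par 1)) : ℕ) : ℂ) := by
    push_cast
    rw [← ht]
    linear_combination (-(2 : ℂ) ^ w.k / 2) * (h0 + h1)
  exact_mod_cast this

theorem finrank_vac_eq_of_trace (ht : LinearMap.trace ℂ V (par * w.proj o) = 0) (p q : ZMod 2) :
    finrank ℂ (w.vac o par p) = finrank ℂ (w.vac o par q) := by
  have h0 := h.two_mul_finrank_vac w p
  have h1 := h.two_mul_finrank_vac w q
  rw [ht, mul_zero, add_zero] at h0 h1
  have : (finrank ℂ (w.vac o par p) : ℂ) = finrank ℂ (w.vac o par q) := by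
    linear_combination (1 / 2) * (h0 - h1)
  exact_mod_cast this

/-- The exponent is half the rank, rounded up. The factor `2 ^ k` comes from the hyperbolic pairs;
in odd rank a further factor `2` comes from the equality of the two vacuum dimensions. -/
theorem pow_dvd_finrank (w : WittData B) :
    2 ^ ((finrank ℂ (LinearMap.range B) + 1) / 2) ∣ finrank ℂ V := by
  rw [h.finrank_eq_pow_mul w]
  rcases w.rank with ⟨-, hr⟩ | ⟨hc, hr⟩
  · rw [hr, show (2 * w.k + 1) / 2 = w.k by omega]
    exact dvd_mul_right _ _
  · rw [hr, show (2 * w.k + 1 + 1) / 2 = w.k + 1 by omega,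
      h.finrank_vac_eq_of_trace w (h.trace_par_mul_proj_of_odd w hc) 0 1, ← two_mul, ← mul_assoc,
      ← pow_succ]
    exact dvd_mul_right _ _

end CliffMod

section

variable {V' : Type*} [AddCommGroup V'] [Module ℂ V'] {B B' : Q →ₗ[ℂ] Q →ₗ[ℂ] ℂ} {par : End ℂ V}
  {o : Q →ₗ[ℂ] End ℂ V} {par' : End ℂ V'} {o' : Q →ₗ[ℂ] End ℂ V'}
  [FiniteDimensional ℂ V] [FiniteDimensional ℂ V'] [FiniteDimensional ℂ Q]

/-- The corank hypotheses are what makes an even number below `dim Q` lie below `rank B'`: for even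
`dim Q` it is at most `dim Q - 2` while `rank B' ≥ dim Q - 1`, and for odd `dim Q` the form `B'` is
nondegenerate. -/
theorem trace_par_mul_proj_tensor (h : CliffMod B par o) (h' : CliffMod B' par' o')
    (hs : ∀ x y, B x y = B y x) (hB : B ≠ 0) (w : WittData (B + B'))
    (hc : finrank ℂ (LinearMap.ker B') ≤ 1)
    (hodd : Odd (finrank ℂ Q) → finrank ℂ (LinearMap.ker B') = 0) :
    LinearMap.trace ℂ (V ⊗[ℂ] V')
      (TensorProduct.map par par' * w.proj (tensorO o par o')) = 0 := by
  have hr := LinearMap.finrank_range_add_finrank_ker B'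
  have hr2 := LinearMap.finrank_range_add_finrank_ker (B + B')
  have hn : ∀ J : List Q, J.length < finrank ℂ Q →
      LinearMap.trace ℂ V' (par' * oprod o' J) = 0 := by
    intro J hJ
    rcases Nat.even_or_odd J.length with he | he
    · refine h'.trace_par_mul_oprod J ?_
      rcases Nat.even_or_odd (finrank ℂ Q) with hne | hno
      · obtain ⟨i, hi⟩ := he
        obtain ⟨j, hj⟩ := hne
        omega
      · have := hodd hno
        omega
    · exact h'.trace_par_mul_oprod_of_odd J he
  have hk : 2 * w.k ≤ finrank ℂ Q := by rcases w.rank with ⟨-, h⟩ | ⟨-, h⟩ <;> omega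
  rw [w.proj_eq_oprod]
  -- The word has length `2 * k`. Only if this equals `dim Q` does the term with all letters on the
  -- right survive, and then `B ≠ 0` kills it through `tr par = 0`.
  rcases hk.lt_or_eq with hk | hk
  · have := trace_par_mul_oprod_tensor_aux (par := par) (o := o) (finrank ℂ Q) hn w.word [] 1
      (by rw [w.length_word]; simpa using hk)
    simpa [oprod, ← Module.End.one_eq_id, TensorProduct.map_one] using this
  · have := trace_par_mul_oprod_tensor h h' (finrank ℂ Q) hn
      (Or.inr (h.trace_par_eq_zero hB hs)) w.word [] (by rw [w.length_word]; simpa using hk)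
    simpa [oprod, ← Module.End.one_eq_id, TensorProduct.map_one] using this

theorem finrank_vac_tensor_eq (h : CliffMod B par o) (h' : CliffMod B' par' o')
    (hs : ∀ x y, B x y = B y x) (hB : B ≠ 0) (w : WittData (B + B'))
    (hc : finrank ℂ (LinearMap.ker B') ≤ 1)
    (hodd : Odd (finrank ℂ Q) → finrank ℂ (LinearMap.ker B') = 0) (p q : ZMod 2) :
    finrank ℂ (w.vac (tensorO o par o') (TensorProduct.map par par') p) =
      finrank ℂ (w.vac (tensorO o par o') (TensorProduct.map par par') q) :=
  (h.tensor h').finrank_vac_eq_of_trace w (trace_par_mul_proj_tensor h h' hs hB w hc hodd) p q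

/-- Equality of the two vacuum dimensions gives `dim V * dim V' = 2 ^ (k + 1) * dim vac`. Here `2`
divides `dim V` because `B ≠ 0`, and `2 ^ (k + 1)` divides `dim V'` because the corank hypotheses
force `rank B' ≥ 2 * k + 1`. -/
theorem even_finrank_vac_tensor (h : CliffMod B par o) (h' : CliffMod B' par' o')
    (hs : ∀ x y, B x y = B y x) (hs' : ∀ x y, B' x y = B' y x) (hB : B ≠ 0)
    (w : WittData (B + B')) (hw : (B + B') w.c w.c = 2)
    (hc : finrank ℂ (LinearMap.ker B') ≤ 1)
    (hodd : Odd (finrank ℂ Q) → finrank ℂ (LinearMap.ker B') = 0) (p : ZMod 2) :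
    Even (finrank ℂ (w.vac (tensorO o par o') (TensorProduct.map par par') p)) := by
  obtain ⟨w1⟩ := nonempty_wittData B hs
  obtain ⟨w2⟩ := nonempty_wittData B' hs'
  have hd := (h.tensor h').finrank_eq_pow_mul w
  have e := finrank_vac_tensor_eq h h' hs hB w hc hodd
  rw [e 0 p, e 1 p, ← two_mul, ← mul_assoc, ← pow_succ, Module.finrank_tensorProduct] at hd
  have hr := LinearMap.finrank_range_add_finrank_ker B'
  have hr2 := LinearMap.finrank_range_add_finrank_ker (B + B')
  have hk : 2 * w.k + 1 ≤ finrank ℂ Q := by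
    rcases w.rank with ⟨h, -⟩ | ⟨-, h⟩
    · rw [h] at hw; norm_num at hw
    · omega
  have hB1 : 1 ≤ finrank ℂ (LinearMap.range B) := by
    rw [Nat.one_le_iff_ne_zero]
    intro h0
    exact hB (LinearMap.range_eq_bot.1 (Submodule.finrank_eq_zero.1 h0))
  have d1 : 2 ∣ finrank ℂ V :=
    (dvd_pow_self 2 (by omega)).trans (h.pow_dvd_finrank w1)
  have d2 : 2 ^ (w.k + 1) ∣ finrank ℂ V' := by
    refine (pow_dvd_pow 2 ?_).trans (h'.pow_dvd_finrank w2)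
    rcases Nat.even_or_odd (finrank ℂ Q) with hne | hno
    · obtain ⟨j, hj⟩ := hne
      omega
    · have := hodd hno
      omega
  have d3 := mul_dvd_mul d2 d1
  rw [mul_comm (finrank ℂ V'), hd] at d3
  exact even_iff_two_dvd.2 (Nat.dvd_of_mul_dvd_mul_left (by positivity) d3)

end

/-! ### Vacuum spaces: exactness and cyclic modules -/

section Exact

variable {V₁ V₂ V₃ : Type*} [AddCommGroup V₁] [Module ℂ V₁] [AddCommGroup V₂] [Module ℂ V₂]
  [AddCommGroup V₃] [Module ℂ V₃] {B : Q →ₗ[ℂ] Q →ₗ[ℂ] ℂ} {par₁ : End ℂ V₁}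
  {o₁ : Q →ₗ[ℂ] End ℂ V₁} {par₂ : End ℂ V₂} {o₂ : Q →ₗ[ℂ] End ℂ V₂} {par₃ : End ℂ V₃}
  {o₃ : Q →ₗ[ℂ] End ℂ V₃} (w : WittData B)

theorem WittData.map_proj (g : V₂ →ₗ[ℂ] V₃) (go : ∀ x v, g (o₂ x v) = o₃ x (g v)) (v : V₂) :
    g (w.proj o₂ v) = w.proj o₃ (g v) := by
  unfold WittData.proj WittData.projL
  induction List.finRange w.k with
  | nil => simp
  | cons i l ih => simp [go, ih]

theorem WittData.map_vproj (g : V₂ →ₗ[ℂ] V₃) (gp : ∀ v, g (par₂ v) = par₃ (g v))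
    (go : ∀ x v, g (o₂ x v) = o₃ x (g v)) (p : ZMod 2) (v : V₂) :
    g (w.vproj o₂ par₂ p v) = w.vproj o₃ par₃ p (g v) := by
  simp [WittData.vproj, gp, w.map_proj g go]

/-- Vacuum vectors of a given parity are the image of an idempotent built from the action alone,
hence natural in the module. Taking them is therefore exact. -/
theorem WittData.finrank_vac_exact [FiniteDimensional ℂ V₂] (h₂ : CliffMod B par₂ o₂)
    (h₃ : CliffMod B par₃ o₃) (f : V₁ →ₗ[ℂ] V₂) (g : V₂ →ₗ[ℂ] V₃)
    (fp : ∀ v, f (par₁ v) = par₂ (f v)) (fo : ∀ x v, f (o₁ x v) = o₂ x (f v))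
    (gp : ∀ v, g (par₂ v) = par₃ (g v)) (go : ∀ x v, g (o₂ x v) = o₃ x (g v))
    (hf : Function.Injective f) (hg : Function.Surjective g)
    (hfg : LinearMap.range f = LinearMap.ker g) (p : ZMod 2) :
    finrank ℂ (w.vac o₂ par₂ p) =
      finrank ℂ (w.vac o₁ par₁ p) + finrank ℂ (w.vac o₃ par₃ p) := by
  let g' := g.domRestrict (w.vac o₂ par₂ p)
  have hr : LinearMap.range g' = w.vac o₃ par₃ p := by
    apply le_antisymm
    · rintro _ ⟨⟨v, hv, hv'⟩, rfl⟩
      exact ⟨fun i => by simp [g', ← go, hv], by simp [g', ← gp, hv']⟩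
    · intro u hu
      obtain ⟨v, rfl⟩ := hg u
      refine ⟨⟨w.vproj o₂ par₂ p v, (h₂.vproj_isProj w p).map_mem v⟩, ?_⟩
      change g (w.vproj o₂ par₂ p v) = g v
      rw [w.map_vproj g gp go, (h₃.vproj_isProj w p).map_id _ hu]
  have hk : (LinearMap.ker g').map (w.vac o₂ par₂ p).subtype = (w.vac o₁ par₁ p).map f := by
    ext u
    constructor
    · rintro ⟨⟨v, hv, hv'⟩, hgv, rfl⟩
      have : v ∈ LinearMap.range f := hfg ▸ hgv
      obtain ⟨y, rfl⟩ := this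
      refine ⟨y, ⟨fun i => hf ?_, hf ?_⟩, rfl⟩
      · rw [fo, hv, map_zero]
      · rw [fp, hv', map_smul]
    · rintro ⟨y, ⟨hy, hy'⟩, rfl⟩
      refine ⟨⟨f y, fun i => ?_, ?_⟩, ?_, rfl⟩
      · rw [← fo, hy, map_zero]
      · rw [← fp, hy', map_smul]
      · change f y ∈ LinearMap.ker g
        rw [← hfg]
        exact ⟨y, rfl⟩
  have e1 := LinearMap.finrank_range_add_finrank_ker g'
  have e2 : finrank ℂ (LinearMap.ker g') = finrank ℂ (w.vac o₁ par₁ p) := by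
    rw [← Submodule.finrank_map_subtype_eq, hk]
    exact (Submodule.equivMapOfInjective f hf _).symm.finrank_eq
  rw [← e1, hr, e2, add_comm]

end Exact

namespace CliffMod

variable {B : Q →ₗ[ℂ] Q →ₗ[ℂ] ℂ} {par : End ℂ V} {o : Q →ₗ[ℂ] End ℂ V}
  (h : CliffMod B par o) (w : WittData B)

include h

/-- A nonzero vector is multiplied successively by each `a j` that does not kill it; as the `a j`
anticommute and square to zero, earlier annihilations persist. Finally an even or odd part is
chosen. -/
theorem exists_vac_ne_zero [Nontrivial V] : ∃ p, ∃ v ∈ w.vac o par p, v ≠ 0 := by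
  have key : ∀ l : List (Fin w.k), ∃ v : V, v ≠ 0 ∧ ∀ i ∈ l, o (w.a i) v = 0 := by
    intro l
    induction l with
    | nil =>
      obtain ⟨v, hv⟩ := exists_ne (0 : V)
      exact ⟨v, hv, by simp⟩
    | cons j l ih =>
      obtain ⟨v, hv, hl⟩ := ih
      by_cases hj : o (w.a j) v = 0
      · exact ⟨v, hv, by simpa [hj] using hl⟩
      · refine ⟨_, hj, fun i hi => ?_⟩
        rcases List.mem_cons.1 hi with rfl | hi
        · exact LinearMap.congr_fun (h.sq_zero (w.aa i i)) v
        · have := LinearMap.congr_fun (h.anti (w.aa i j)) v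
          simpa [hl i hi] using this
  obtain ⟨v, hv, hl⟩ := key (List.finRange w.k)
  have hl' : ∀ i, o (w.a i) v = 0 := fun i => hl i (List.mem_finRange i)
  have hp : par (par v) = v := LinearMap.congr_fun h.par_par v
  have ha : ∀ i, o (w.a i) (par v) = 0 := fun i => by
    have := LinearMap.congr_fun (h.par_o (w.a i)) v
    simpa [hl'] using this.symm
  by_cases h0 : v + par v = 0
  · refine ⟨1, v, ⟨hl', ?_⟩, hv⟩
    rw [eq_neg_of_add_eq_zero_right h0]
    simp [psgn]
  · refine ⟨0, v + par v, ⟨fun i => by rw [map_add, hl', ha, add_zero], ?_⟩, h0⟩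
    rw [map_add, hp]
    simp [psgn, add_comm]

theorem c_mul_c_apply (v : V) : ∃ r : ℂ, o w.c (o w.c v) = r • v := by
  refine ⟨2⁻¹ * B w.c w.c, ?_⟩
  have := LinearMap.congr_fun (h.rel w.c w.c) v
  simp only [LinearMap.add_apply, Module.End.mul_apply, LinearMap.smul_apply,
    Module.End.one_apply] at this
  rw [mul_smul, ← this]
  module

omit h in
/-- The span of the words of length at most `m` applied to `v`. -/
def gen (o : Q →ₗ[ℂ] End ℂ V) (v : V) : ℕ → Submodule ℂ V
  | 0 => Submodule.span ℂ {v}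
  | m + 1 => gen o v m ⊔ ⨆ x, (gen o v m).map (o x)

omit h in
theorem gen_induction {v : V} {m : ℕ} {S : Submodule ℂ V} (h0 : gen o v m ≤ S)
    (h1 : ∀ x, ∀ u ∈ gen o v m, o x u ∈ S) : gen o v (m + 1) ≤ S :=
  sup_le h0 (iSup_le fun x => Submodule.map_le_iff_le_comap.2 (h1 x))

omit h in
theorem o_mem_gen {v : V} {m : ℕ} (x : Q) {u : V} (hu : u ∈ gen o v m) :
    o x u ∈ gen o v (m + 1) :=
  (le_sup_of_le_right (le_iSup_of_le x le_rfl) : (gen o v m).map (o x) ≤ gen o v (m + 1))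
    ⟨u, hu, rfl⟩

omit h in
theorem gen_le_succ (v : V) (m : ℕ) : gen o v m ≤ gen o v (m + 1) := le_sup_left

/-- Moving `a i` to the right through a word costs only shorter words, and at the end it kills `v`;
so it does not raise the filtration degree. -/
theorem a_mem_gen {v : V} (hv : ∀ i, o (w.a i) v = 0) (m : ℕ) (i : Fin w.k) :
    ∀ u ∈ gen o v m, o (w.a i) u ∈ gen o v m := by
  induction m with
  | zero =>
    intro u hu
    obtain ⟨r, rfl⟩ := Submodule.mem_span_singleton.1 hu
    rw [map_smul, hv, smul_zero]
    exact zero_mem _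
  | succ m ih =>
    refine gen_induction (S := (gen o v (m + 1)).comap (o (w.a i)))
      (fun u hu => gen_le_succ v m (ih u hu)) fun x u hu => ?_
    have := LinearMap.congr_fun (h.rel (w.a i) x) u
    simp only [LinearMap.add_apply, Module.End.mul_apply, LinearMap.smul_apply,
      Module.End.one_apply] at this
    rw [Submodule.mem_comap, eq_sub_of_add_eq this]
    exact sub_mem (Submodule.smul_mem _ _ (gen_le_succ v m hu)) (o_mem_gen x (ih u hu))

/-- Induction on the length of words: a leading `a i` does not raise the length, a leading `b i` is
killed by `proj`, `c` commutes with `proj` and has scalar square, and the kernel of `B` acts by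
zero. -/
theorem proj_gen_le (hB : ∀ x y, B x y = B y x) (hz : ∀ z ∈ LinearMap.ker B, o z = 0) {v : V}
    (hv : ∀ i, o (w.a i) v = 0) (m : ℕ) :
    ∀ u ∈ gen o v m, w.proj o u ∈ Submodule.span ℂ {v, o w.c v} := by
  induction m with
  | zero =>
    intro u hu
    obtain ⟨r, rfl⟩ := Submodule.mem_span_singleton.1 hu
    rw [map_smul, h.proj_apply_of_vac w hv]
    exact Submodule.smul_mem _ _ (Submodule.subset_span (by simp))
  | succ m ih =>
    refine gen_induction (S := (Submodule.span ℂ {v, o w.c v}).comap (w.proj o)) ih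
      fun x u hu => ?_
    have hx : x ∈ Submodule.span ℂ (Set.range w.a ∪ Set.range w.b ∪ {w.c}) ⊔ LinearMap.ker B := by
      rw [w.span]; trivial
    let S : Submodule ℂ Q := ((Submodule.span ℂ {v, o w.c v}).comap (w.proj o)).comap (o.flip u)
    have key : Submodule.span ℂ (Set.range w.a ∪ Set.range w.b ∪ {w.c}) ⊔ LinearMap.ker B ≤ S := by
      refine sup_le (Submodule.span_le.2 ?_) fun z hzB => ?_
      · rintro _ ((⟨i, rfl⟩ | ⟨i, rfl⟩) | rfl)
        · exact ih _ (h.a_mem_gen w hv m i u hu)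
        · change w.proj o (o (w.b i) u) ∈ Submodule.span ℂ {v, o w.c v}
          rw [show w.proj o (o (w.b i) u) = 0 from
            LinearMap.congr_fun (h.proj_mul_b w hB i) u]
          exact zero_mem _
        · change w.proj o (o w.c u) ∈ Submodule.span ℂ {v, o w.c v}
          rw [show w.proj o (o w.c u) = o w.c (w.proj o u) from
            (LinearMap.congr_fun (h.c_commute_proj w).eq u).symm]
          obtain ⟨r, s, hrs⟩ := Submodule.mem_span_pair.1 (ih u hu)
          obtain ⟨t, ht⟩ := h.c_mul_c_apply w v
          rw [← hrs, map_add, map_smul, map_smul, ht]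
          exact Submodule.mem_span_pair.2 ⟨s * t, r, by rw [mul_smul, add_comm]⟩
      · change w.proj o (o z u) ∈ Submodule.span ℂ {v, o w.c v}
        rw [hz z hzB, LinearMap.zero_apply, map_zero]
        exact zero_mem _
    exact key hx

/-- Let `K l` be the common kernel of the `a i` with `i` in `l`. On `K l` the operator of a further
`a i` has both its kernel and its image inside `K (i :: l)`, so finite dimension passes from the
smaller kernel to the larger one, up to the whole space. -/
theorem finiteDimensional_of_vac
    (hf : ∃ S : Submodule ℂ V, FiniteDimensional ℂ S ∧ ∀ v, (∀ i, o (w.a i) v = 0) → v ∈ S) :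
    FiniteDimensional ℂ V := by
  let K : List (Fin w.k) → Submodule ℂ V := fun l =>
    l.foldr (fun i S => LinearMap.ker (o (w.a i)) ⊓ S) ⊤
  have mem_K : ∀ l v, v ∈ K l ↔ ∀ i ∈ l, o (w.a i) v = 0 := by
    intro l v
    induction l with
    | nil => simp [K]
    | cons i l ih => simpa [K] using fun _ => ih
  have key : ∀ l, FiniteDimensional ℂ (K l) → FiniteDimensional ℂ V := by
    intro l
    induction l with
    | nil =>
      intro hl
      have : FiniteDimensional ℂ (⊤ : Submodule ℂ V) := hl
      exact Module.Finite.equiv (Submodule.topEquiv (R := ℂ) (M := V))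
    | cons i l ih =>
      intro hl
      refine ih ?_
      let g : K l →ₗ[ℂ] K (i :: l) := LinearMap.codRestrict _ ((o (w.a i)).domRestrict (K l)) (by
        rintro ⟨v, hv⟩
        rw [mem_K] at hv ⊢
        intro j hj
        rcases List.mem_cons.1 hj with rfl | hj
        · exact LinearMap.congr_fun (h.sq_zero (w.aa j j)) v
        · have := LinearMap.congr_fun (h.anti (w.aa j i)) v
          simpa [hv j hj] using this)
      let e : LinearMap.ker g →ₗ[ℂ] K (i :: l) :=
        LinearMap.codRestrict _ ((K l).subtype ∘ₗ (LinearMap.ker g).subtype) (by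
        rintro ⟨⟨v, hv⟩, hgv⟩
        rw [mem_K] at hv ⊢
        intro j hj
        rcases List.mem_cons.1 hj with rfl | hj
        · exact congrArg Subtype.val hgv
        · exact hv j hj)
      have he : Function.Injective e := by
        rintro ⟨⟨v, hv⟩, hgv⟩ ⟨⟨v', hv'⟩, hgv'⟩ hvv
        have : v = v' := congrArg Subtype.val hvv
        subst this
        rfl
      have f1 : FiniteDimensional ℂ (LinearMap.ker g) := Module.Finite.of_injective e he
      have f2 : FiniteDimensional ℂ (LinearMap.range g) :=
        FiniteDimensional.finiteDimensional_submodule _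
      have f3 : FiniteDimensional ℂ (K l ⧸ LinearMap.ker g) :=
        Module.Finite.equiv g.quotKerEquivRange.symm
      exact Module.Finite.of_submodule_quotient (LinearMap.ker g)
  obtain ⟨S, hS, hv⟩ := hf
  exact key (List.finRange w.k) (Submodule.finiteDimensional_of_le (S₂ := S) fun v hK =>
    hv v fun i => (mem_K _ v).1 hK i (List.mem_finRange i))

end CliffMod

end Clifford

universe u

open LieSuperalgebra (δ δ_δ br δ_br)

namespace SuperRep

variable {𝔤 : Type u} [AddCommGroup 𝔤] [Module ℂ 𝔤] [LieSuperalgebra 𝔤]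
  {V : Type u} [AddCommGroup V] [Module ℂ V] {V' : Type u} [AddCommGroup V'] [Module ℂ V']
  {V'' : Type u} [AddCommGroup V''] [Module ℂ V'']
  {ρ : SuperRep 𝔤 V} {σ : SuperRep 𝔤 V'} {τ : SuperRep 𝔤 V''}

/-! ### Submodules and morphisms -/

theorem Invariant.bot : ρ.Invariant ⊥ := ⟨by simp, by simp⟩

theorem Invariant.top : ρ.Invariant ⊤ := ⟨by simp, by simp⟩

theorem Invariant.inf {A B : Submodule ℂ V} (hA : ρ.Invariant A) (hB : ρ.Invariant B) :
    ρ.Invariant (A ⊓ B) :=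
  ⟨fun v hv => ⟨hA.1 v hv.1, hB.1 v hv.2⟩, fun x v hv => ⟨hA.2 x v hv.1, hB.2 x v hv.2⟩⟩

theorem Invariant.sup {A B : Submodule ℂ V} (hA : ρ.Invariant A) (hB : ρ.Invariant B) :
    ρ.Invariant (A ⊔ B) := by
  constructor
  · intro v hv
    obtain ⟨a, ha, b, hb, rfl⟩ := Submodule.mem_sup.1 hv
    rw [map_add]
    exact Submodule.add_mem_sup (hA.1 a ha) (hB.1 b hb)
  · intro x v hv
    obtain ⟨a, ha, b, hb, rfl⟩ := Submodule.mem_sup.1 hv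
    rw [map_add]
    exact Submodule.add_mem_sup (hA.2 x a ha) (hB.2 x b hb)

instance : Lattice ρ.Sub := Subtype.lattice (fun _ _ => Invariant.sup) (fun _ _ => Invariant.inf)

instance : BoundedOrder ρ.Sub where
  top := ⟨⊤, .top⟩
  bot := ⟨⊥, .bot⟩
  le_top A := (le_top : A.1 ≤ ⊤)
  bot_le A := (bot_le : ⊥ ≤ A.1)

@[simp] theorem coe_top : (⊤ : ρ.Sub).1 = ⊤ := rfl
@[simp] theorem coe_bot : (⊥ : ρ.Sub).1 = ⊥ := rfl

/-- Modularity is used both to bound chains by a composition series and to move covering relations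
along diamonds of submodules. -/
instance : IsModularLattice ρ.Sub where
  sup_inf_le_assoc_of_le {x} y z hxz :=
    (IsModularLattice.sup_inf_le_assoc_of_le (x := x.1) y.1 (z := z.1) hxz)

theorem IsHom.comap {f : V →ₗ[ℂ] V'} (hf : ρ.IsHom σ f) {W : Submodule ℂ V'}
    (hW : σ.Invariant W) : ρ.Invariant (W.comap f) :=
  ⟨fun v hv => by rw [Submodule.mem_comap, hf.1]; exact hW.1 _ hv,
    fun x v hv => by rw [Submodule.mem_comap, hf.2]; exact hW.2 x _ hv⟩

theorem IsHom.map {f : V →ₗ[ℂ] V'} (hf : ρ.IsHom σ f) {W : Submodule ℂ V}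
    (hW : ρ.Invariant W) : σ.Invariant (W.map f) := by
  constructor
  · rintro _ ⟨v, hv, rfl⟩
    exact ⟨_, hW.1 v hv, hf.1 v⟩
  · rintro x _ ⟨v, hv, rfl⟩
    exact ⟨_, hW.2 x v hv, hf.2 x v⟩

theorem IsHom.ker {f : V →ₗ[ℂ] V'} (hf : ρ.IsHom σ f) : ρ.Invariant (LinearMap.ker f) :=
  hf.comap (W := ⊥) .bot

theorem IsHom.range {f : V →ₗ[ℂ] V'} (hf : ρ.IsHom σ f) : σ.Invariant (LinearMap.range f) := by
  rw [LinearMap.range_eq_map]; exact hf.map .top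

theorem IsHom.comp {f : V →ₗ[ℂ] V'} {g : V' →ₗ[ℂ] V''} (hg : σ.IsHom τ g) (hf : ρ.IsHom σ f) :
    ρ.IsHom τ (g ∘ₗ f) :=
  ⟨fun v => by simp [hf.1, hg.1], fun x v => by simp [hf.2, hg.2]⟩

theorem IsHom.symm {f : V ≃ₗ[ℂ] V'} (hf : ρ.IsHom σ f.toLinearMap) :
    σ.IsHom ρ f.symm.toLinearMap := by
  constructor
  · intro v
    apply f.injective
    have := hf.1 (f.symm v)
    simpa using this.symm
  · intro x v
    apply f.injective
    have := hf.2 x (f.symm v)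
    simpa using this.symm

theorem IsHom.shift {f : V →ₗ[ℂ] V'} (hf : ρ.IsHom σ f) : ρ.shift.IsHom σ.shift f :=
  ⟨fun v => by simp [SuperRep.shift, hf.1], hf.2⟩

theorem shift_shift : ρ.shift.shift = ρ := by
  unfold SuperRep.shift
  simp

theorem Iso.symm (h : ρ.Iso σ) : σ.Iso ρ := by
  obtain ⟨f, hf⟩ := h
  exact ⟨f.symm, hf.symm⟩

theorem Iso.trans (h : ρ.Iso σ) (h' : σ.Iso τ) : ρ.Iso τ := by
  obtain ⟨f, hf⟩ := h
  obtain ⟨g, hg⟩ := h'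
  exact ⟨f.trans g, hg.comp hf⟩

theorem Iso.shift (h : ρ.Iso σ) : ρ.shift.Iso σ.shift := by
  obtain ⟨f, hf⟩ := h
  exact ⟨f, hf.shift⟩

theorem Iso.trans_isoUpToShift (h : ρ.Iso σ) (h' : σ.IsoUpToShift τ) : ρ.IsoUpToShift τ :=
  h'.imp h.trans h.trans

theorem invariant_shift {W : Submodule ℂ V} : ρ.shift.Invariant W ↔ ρ.Invariant W := by
  simp [Invariant, SuperRep.shift]

theorem IsSimple.shift (h : ρ.IsSimple) : ρ.shift.IsSimple :=
  ⟨h.1, fun W => h.2 ⟨W.1, invariant_shift.1 W.2⟩⟩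

theorem isHom_subtype (W : ρ.Sub) : (ρ.sub W).IsHom ρ W.1.subtype :=
  ⟨fun _ => rfl, fun _ _ => rfl⟩

theorem isHom_mkQ (W : ρ.Sub) : ρ.IsHom (ρ.quot W) W.1.mkQ :=
  ⟨fun _ => rfl, fun _ _ => rfl⟩

theorem isHom_inclusion {A B : ρ.Sub} (h : A ≤ B) :
    (ρ.sub A).IsHom (ρ.sub B) (Submodule.inclusion h) :=
  ⟨fun _ => rfl, fun _ _ => rfl⟩

/-- Two surjective morphisms with the same kernel have isomorphic targets. -/
theorem iso_of_ker_eq {f : V →ₗ[ℂ] V'} {g : V →ₗ[ℂ] V''} (hf : ρ.IsHom σ f) (hg : ρ.IsHom τ g)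
    (hf' : Function.Surjective f) (hg' : Function.Surjective g)
    (h : LinearMap.ker f = LinearMap.ker g) : σ.Iso τ := by
  let e : V' ≃ₗ[ℂ] V'' := (f.quotKerEquivOfSurjective hf').symm.trans
    ((Submodule.quotEquivOfEq _ _ h).trans (g.quotKerEquivOfSurjective hg'))
  have he : ∀ v, e (f v) = g v := fun v => by
    have : (f.quotKerEquivOfSurjective hf').symm (f v) = Submodule.Quotient.mk v := by
      rw [LinearEquiv.symm_apply_eq]; rfl
    simp only [e, LinearEquiv.trans_apply, this]
    rfl
  refine ⟨e, fun v => ?_, fun x v => ?_⟩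
  · obtain ⟨v, rfl⟩ := hf' v
    change e _ = τ.par (e _)
    rw [← hf.1, he, he, hg.1]
  · obtain ⟨v, rfl⟩ := hf' v
    change e _ = τ.act x (e _)
    rw [← hf.2, he, he, hg.2]

theorem Iso.isSimple (h : ρ.Iso σ) (hρ : ρ.IsSimple) : σ.IsSimple := by
  obtain ⟨f, hf⟩ := h
  have := hρ.1
  refine ⟨f.symm.toEquiv.nontrivial, fun W => ?_⟩
  have hW : W.1 = (W.1.comap f.toLinearMap).map f.toLinearMap :=
    (Submodule.map_comap_eq_of_surjective f.surjective _).symm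
  rcases hρ.2 ⟨_, hf.comap W.2⟩ with h | h
  · left; rw [hW, show W.1.comap f.toLinearMap = ⊥ from h, Submodule.map_bot]
  · right
    rw [hW, show W.1.comap f.toLinearMap = ⊤ from h, Submodule.map_top,
      LinearMap.range_eq_top.2 f.surjective]

/-! ### Subquotients -/

/-- `A ⊓ B` as a submodule of `B`. -/
def subSub (A B : ρ.Sub) : (ρ.sub B).Sub := ⟨A.1.comap B.1.subtype, (isHom_subtype B).comap A.2⟩

/-- The subquotient `B / (A ⊓ B)`. -/
abbrev sq (A B : ρ.Sub) : SuperRep 𝔤 (B.1 ⧸ (subSub A B).1) := (ρ.sub B).quot (subSub A B)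

theorem factorIso_sq {A B : ρ.Sub} (h : A ≤ B) : ρ.FactorIso A B (sq A B) :=
  ⟨h, _, isHom_mkQ _, Submodule.mkQ_surjective _, fun v => by
    rw [← LinearMap.mem_ker, Submodule.ker_mkQ]; rfl⟩

theorem FactorIso.trans_iso {A B : ρ.Sub} (h : ρ.FactorIso A B σ) (h' : σ.Iso τ) :
    ρ.FactorIso A B τ := by
  obtain ⟨hAB, f, hf, hs, hk⟩ := h
  obtain ⟨g, hg⟩ := h'
  exact ⟨hAB, g.toLinearMap ∘ₗ f, hg.comp hf, g.surjective.comp hs, fun v => by simp [hk]⟩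

theorem FactorIso.ker_eq {A B : ρ.Sub} {f : B.1 →ₗ[ℂ] V'}
    (hk : ∀ v : B.1, f v = 0 ↔ (v : V) ∈ A.1) : LinearMap.ker f = A.1.comap B.1.subtype := by
  ext v; exact hk v

theorem FactorIso.iso {A B : ρ.Sub} (h : ρ.FactorIso A B σ) (h' : ρ.FactorIso A B τ) :
    σ.Iso τ := by
  obtain ⟨-, f, hf, hs, hk⟩ := h
  obtain ⟨-, g, hg, hs', hk'⟩ := h'
  exact iso_of_ker_eq hf hg hs hs' ((FactorIso.ker_eq hk).trans (FactorIso.ker_eq hk').symm)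

theorem isSimple_sq {A B : ρ.Sub} (h : A ⋖ B) : (sq A B).IsSimple := by
  constructor
  · refine Submodule.Quotient.nontrivial_iff.2 fun ht => h.lt.not_ge ?_
    intro v hv
    have : (⟨v, hv⟩ : B.1) ∈ (subSub A B).1 := by rw [ht]; trivial
    exact this
  · intro W
    let C : ρ.Sub := ⟨(W.1.comap (subSub A B).1.mkQ).map B.1.subtype,
      (isHom_subtype B).map ((isHom_mkQ (subSub A B)).comap W.2)⟩
    have hAC : A ≤ C := fun v hv => ⟨⟨v, h.le hv⟩, by
      have : (subSub A B).1.mkQ ⟨v, h.le hv⟩ = 0 := (Submodule.Quotient.mk_eq_zero _).2 hv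
      change (subSub A B).1.mkQ ⟨v, h.le hv⟩ ∈ W.1
      rw [this]; exact zero_mem _, rfl⟩
    have hCB : C ≤ B := by
      rintro _ ⟨v, -, rfl⟩
      exact v.2
    have hmem : ∀ v : B.1, (v : V) ∈ C.1 ↔ (subSub A B).1.mkQ v ∈ W.1 := by
      intro v
      constructor
      · rintro ⟨v', hv', hvv⟩
        obtain rfl : v' = v := Subtype.ext hvv
        exact hv'
      · intro hv
        exact ⟨v, hv, rfl⟩
    rcases h.eq_or_eq hAC hCB with hC | hC
    · left
      rw [eq_bot_iff]
      intro q hq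
      obtain ⟨v, rfl⟩ := Submodule.mkQ_surjective _ q
      have := (hmem v).2 hq
      rw [hC] at this
      exact (Submodule.Quotient.mk_eq_zero _).2 this
    · right
      rw [eq_top_iff]
      intro q _
      obtain ⟨v, rfl⟩ := Submodule.mkQ_surjective _ q
      refine (hmem v).1 ?_
      rw [hC]
      exact v.2

/-- The product of two modules. -/
def prod (ρ : SuperRep 𝔤 V) (σ : SuperRep 𝔤 V') : SuperRep 𝔤 (V × V') where
  par := ρ.par.prodMap σ.par
  par_par := by rintro ⟨v, w⟩; simp [ρ.par_par, σ.par_par]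
  act :=
    { toFun := fun x => (ρ.act x).prodMap (σ.act x)
      map_add' := by intro x y; ext <;> simp
      map_smul' := by intro c x; ext <;> simp }
  par_act := by rintro x ⟨v, w⟩; simp [ρ.par_act, σ.par_act]
  act_br := by
    rintro i j x hx y hy ⟨v, w⟩
    simp [ρ.act_br i j x hx y hy, σ.act_br i j x hx y hy]

end SuperRep

namespace TriangularDatum

open SuperRep CliffMod

variable {𝔤 : Type u} [AddCommGroup 𝔤] [Module ℂ 𝔤] [LieSuperalgebra 𝔤] {T : TriangularDatum 𝔤}
  {V : Type u} [AddCommGroup V] [Module ℂ V] {V' : Type u} [AddCommGroup V'] [Module ℂ V']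

instance : FiniteDimensional ℂ T.𝔥 := T.finite_wtSpace 0 (Or.inl rfl)

instance : FiniteDimensional ℂ T.𝔥₁ :=
  Submodule.finiteDimensional_of_le (inf_le_left : T.𝔥₁ ≤ T.𝔥)

/-! ### Modules over `𝔥` of weight `ν` are Clifford modules -/

/-- The action of `𝔥₁`. -/
def oAct (ρ : SuperRep T.𝔥 V) : T.𝔥₁ →ₗ[ℂ] End ℂ V :=
  ρ.act ∘ₗ Submodule.inclusion (inf_le_left : T.𝔥₁ ≤ T.𝔥)

theorem odd_mem (x : T.𝔥₁) : (⟨x, x.2.1⟩ : T.𝔥) ∈ deg T.𝔥 1 :=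
  Subtype.ext (by
    have : δ (x : 𝔤) = _ := x.2.2
    exact this)

theorem act_eq (ρ : SuperRep T.𝔥 V) {ν : T.Wt} (hρ : (wt ρ ν).1 = ⊤) (x : T.𝔥) (v : V) :
    ρ.act x v = ν (p0 x) • v + oAct ρ (p1 x) v := by
  have hv : v ∈ (wt ρ ν).1 := by rw [hρ]; trivial
  have e : x = ⟨p0 x, T.𝔱_le_𝔥 (p0 x).2⟩ + ⟨p1 x, (p1 x).2.1⟩ :=
    Subtype.ext (half_deg (x : 𝔤)).2.2.symm
  conv_lhs => rw [e]
  rw [map_add, LinearMap.add_apply, hv (p0 x)]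
  rfl

/-- Odd elements of `𝔥` have their brackets in `𝔱`, which acts by the scalars `ν`; the
representation identity becomes the Clifford relation of `F ν`. -/
theorem cliffMod (ρ : SuperRep T.𝔥 V) {ν : T.Wt} (hρ : (wt ρ ν).1 = ⊤) :
    CliffMod (T.F ν) ρ.par (oAct ρ) := by
  refine ⟨LinearMap.ext ρ.par_par, fun x => LinearMap.ext fun v => ?_,
    fun x y => LinearMap.ext fun v => ?_⟩
  · have hx : δ (⟨x, x.2.1⟩ : T.𝔥) = -⟨x, x.2.1⟩ := by simpa [deg, degOf] using odd_mem x
    have := ρ.par_act ⟨x, x.2.1⟩ v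
    rw [hx, map_neg, LinearMap.neg_apply] at this
    exact this
  · have hv : v ∈ (wt ρ ν).1 := by rw [hρ]; trivial
    have := ρ.act_br 1 1 _ (odd_mem x) _ (odd_mem y) v
    simp only [sgn, and_self, if_true, neg_smul, one_smul, sub_neg_eq_add] at this
    have h2 := hv ⟨br (x : 𝔤) (y : 𝔤), T.br_odd_mem x y⟩
    exact this.symm.trans h2

theorem invariant_of_oAct {ρ : SuperRep T.𝔥 V} {ν : T.Wt} (hρ : (wt ρ ν).1 = ⊤)
    {W : Submodule ℂ V} (hp : ∀ v ∈ W, ρ.par v ∈ W) (ho : ∀ x, ∀ v ∈ W, oAct ρ x v ∈ W) :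
    ρ.Invariant W :=
  ⟨hp, fun x v hv => by
    rw [act_eq ρ hρ]; exact add_mem (W.smul_mem _ hv) (ho _ v hv)⟩

theorem IsHom.map_wt {ρ : SuperRep T.𝔥 V} {σ : SuperRep T.𝔥 V'} {f : V →ₗ[ℂ] V'}
    (hf : ρ.IsHom σ f) {ν : T.Wt} {v : V} (hv : v ∈ (wt ρ ν).1) : f v ∈ (wt σ ν).1 :=
  fun a => by rw [← hf.2, hv a, map_smul]

theorem wt_sub {ρ : SuperRep T.𝔥 V} {ν : T.Wt} (W : ρ.Sub) :
    (wt (ρ.sub W) ν).1 = (wt ρ ν).1.comap W.1.subtype := by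
  ext v
  exact forall_congr' fun a => Subtype.ext_iff

theorem wt_sub_eq_top {ρ : SuperRep T.𝔥 V} {ν : T.Wt} (W : ρ.Sub) (h : W ≤ wt ρ ν) :
    (wt (ρ.sub W) ν).1 = ⊤ := by
  rw [wt_sub, eq_top_iff]
  intro v _
  exact h v.2

theorem wt_eq_top_of_surjective {ρ : SuperRep T.𝔥 V} {σ : SuperRep T.𝔥 V'} {f : V →ₗ[ℂ] V'}
    (hf : ρ.IsHom σ f) (hs : Function.Surjective f) {ν : T.Wt} (hρ : (wt ρ ν).1 = ⊤) :
    (wt σ ν).1 = ⊤ := by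
  rw [eq_top_iff]
  intro v _
  obtain ⟨v, rfl⟩ := hs v
  exact IsHom.map_wt hf (by rw [hρ]; trivial)

/-! ### Simple modules -/

/-- An element `z` of the radical of the form anticommutes with all of `𝔥₁`, so the kernel of its
operator is a submodule. By simplicity it is zero or everything; as `z` acts with square zero, the
operator vanishes in either case. -/
theorem ker_act_zero {ρ : SuperRep T.𝔥 V} (hs : ρ.IsSimple) {ν : T.Wt} (hρ : (wt ρ ν).1 = ⊤) :
    ∀ z ∈ LinearMap.ker (T.F ν), oAct ρ z = 0 := by
  intro z hz
  have h := cliffMod ρ hρ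
  have hz' : ∀ x, T.F ν z x = 0 := fun x => LinearMap.congr_fun hz x
  have hinv : ρ.Invariant (LinearMap.ker (oAct ρ z)) := by
    refine invariant_of_oAct hρ (fun v hv => ?_) fun x v hv => ?_
    · have := LinearMap.congr_fun (h.par_o z) v
      have hv' : oAct ρ z v = 0 := hv
      simpa [hv'] using this.symm
    · have := LinearMap.congr_fun (h.anti (hz' x)) v
      have hv' : oAct ρ z v = 0 := hv
      simpa [hv'] using this
  have hsq := h.sq_zero (hz' z)
  rcases hs.2 ⟨_, hinv⟩ with h0 | h0
  · have h0' : LinearMap.ker (oAct ρ z) = ⊥ := h0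
    ext v
    have : oAct ρ z v ∈ LinearMap.ker (oAct ρ z) := LinearMap.congr_fun hsq v
    rw [h0'] at this
    exact this
  · exact LinearMap.ker_eq_top.1 h0

/-- The submodule generated by a homogeneous vector. -/
def genSub (ρ : SuperRep T.𝔥 V) {ν : T.Wt} (hρ : (wt ρ ν).1 = ⊤) (v : V) {s : ℂ}
    (hv : ρ.par v = s • v) : ρ.Sub :=
  ⟨⨆ m, gen (oAct ρ) v m, by
    have h := cliffMod ρ hρ
    have hp : ∀ m, gen (oAct ρ) v m ≤ (gen (oAct ρ) v m).comap ρ.par := by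
      intro m
      induction m with
      | zero =>
        intro u hu
        obtain ⟨r, rfl⟩ := Submodule.mem_span_singleton.1 hu
        rw [Submodule.mem_comap, map_smul, hv]
        exact Submodule.smul_mem _ _ (Submodule.smul_mem _ _ (Submodule.mem_span_singleton_self v))
      | succ m ih =>
        refine gen_induction (fun u hu => gen_le_succ v m (ih hu)) fun x u hu => ?_
        have := LinearMap.congr_fun (h.par_o x) u
        rw [Submodule.mem_comap, show ρ.par (oAct ρ x u) = -(oAct ρ x (ρ.par u)) from this]
        exact neg_mem (o_mem_gen x (ih hu))
    refine invariant_of_oAct hρ ?_ ?_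
    · suffices hh : (⨆ m, gen (oAct ρ) v m) ≤ (⨆ m, gen (oAct ρ) v m).comap ρ.par from
        fun u hu => hh hu
      exact iSup_le fun m => (hp m).trans (Submodule.comap_mono (le_iSup _ m))
    · intro x
      suffices hh : (⨆ m, gen (oAct ρ) v m) ≤ (⨆ m, gen (oAct ρ) v m).comap (oAct ρ x) from
        fun u hu => hh hu
      exact iSup_le fun m u hu => (le_iSup (gen (oAct ρ) v) (m + 1)) (o_mem_gen x hu)⟩

theorem mem_genSub {ρ : SuperRep T.𝔥 V} {ν : T.Wt} (hρ : (wt ρ ν).1 = ⊤) {v : V} {s : ℂ}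
    (hv : ρ.par v = s • v) : v ∈ (genSub ρ hρ v hv).1 :=
  (le_iSup (gen (oAct ρ) v) 0) (Submodule.mem_span_singleton_self v)

theorem proj_genSub {ρ : SuperRep T.𝔥 V} {ν : T.Wt} (hρ : (wt ρ ν).1 = ⊤) {v : V} {s : ℂ}
    (hv : ρ.par v = s • v) (w : WittData (T.F ν)) (hz : ∀ z ∈ LinearMap.ker (T.F ν), oAct ρ z = 0)
    (ha : ∀ i, oAct ρ (w.a i) v = 0) {u : V} (hu : u ∈ (genSub ρ hρ v hv).1) :
    w.proj (oAct ρ) u ∈ Submodule.span ℂ {v, oAct ρ w.c v} := by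
  have : (⨆ m, gen (oAct ρ) v m) ≤
      (Submodule.span ℂ {v, oAct ρ w.c v}).comap (w.proj (oAct ρ)) :=
    iSup_le fun m u hu => (cliffMod ρ hρ).proj_gen_le w (F_symm ν) hz ha m u hu
  exact this hu

/-- The vacuum vectors of parity `p`. -/
abbrev hvac {ν : T.Wt} (w : WittData (T.F ν)) (ρ : SuperRep T.𝔥 V) (p : ZMod 2) :
    Submodule ℂ V := w.vac (oAct ρ) ρ.par p

theorem IsSimple.genSub_eq_top {ρ : SuperRep T.𝔥 V} (hs : ρ.IsSimple) {ν : T.Wt}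
    (hρ : (wt ρ ν).1 = ⊤) {v : V} (hv0 : v ≠ 0) {s : ℂ} (hv : ρ.par v = s • v) :
    (genSub ρ hρ v hv).1 = ⊤ := by
  refine (hs.2 _).resolve_left fun h => hv0 ?_
  have := mem_genSub hρ hv
  rw [h] at this
  exact this

theorem eq_zero_of_par {ρ : SuperRep T.𝔥 V} {p : ZMod 2} {v : V} (h : ρ.par v = psgn p • v)
    (h' : ρ.par v = psgn (p + 1) • v) : v = 0 := by
  rw [h, psgn_add_one, neg_smul] at h'
  have hp : psgn p ≠ 0 := fun h0 => by simpa [h0] using psgn_mul_self p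
  have : (2 * psgn p) • v = 0 := by
    rw [mul_smul, two_smul]; exact eq_neg_iff_add_eq_zero.1 h'
  exact (smul_eq_zero.1 this).resolve_left (mul_ne_zero two_ne_zero hp)

theorem par_oAct {ρ : SuperRep T.𝔥 V} {ν : T.Wt} (hρ : (wt ρ ν).1 = ⊤) {p : ZMod 2} {v : V}
    (hv : ρ.par v = psgn p • v) (x : T.𝔥₁) :
    ρ.par (oAct ρ x v) = psgn (p + 1) • oAct ρ x v := by
  have := LinearMap.congr_fun ((cliffMod ρ hρ).par_o x) v
  simp only [Module.End.mul_apply, LinearMap.neg_apply, hv, map_smul] at this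
  rw [this, psgn_add_one, neg_smul]

/-- A simple module is generated by any nonzero homogeneous vacuum vector `v`, and `proj` maps the
generated module into the span of `v` and `c v` while fixing `u`. -/
theorem vac_le_span {ρ : SuperRep T.𝔥 V} (hs : ρ.IsSimple) {ν : T.Wt} (hρ : (wt ρ ν).1 = ⊤)
    (w : WittData (T.F ν)) {p : ZMod 2} {v : V} (hv : v ∈ hvac w ρ p) (hv0 : v ≠ 0) {u : V}
    (hu : ∀ i, oAct ρ (w.a i) u = 0) : u ∈ Submodule.span ℂ {v, oAct ρ w.c v} := by
  have h1 := proj_genSub hρ hv.2 w (ker_act_zero hs hρ) hv.1 (u := u)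
    (by rw [IsSimple.genSub_eq_top hs hρ hv0 hv.2]; trivial)
  rwa [(cliffMod ρ hρ).proj_apply_of_vac w hu] at h1

/-- The vector `c v` has the parity opposite to `v`, so within one parity only the line of `v`
remains. -/
theorem hvac_eq_span {ρ : SuperRep T.𝔥 V} (hs : ρ.IsSimple) {ν : T.Wt} (hρ : (wt ρ ν).1 = ⊤)
    (w : WittData (T.F ν)) {p : ZMod 2} {v : V} (hv : v ∈ hvac w ρ p) (hv0 : v ≠ 0) :
    hvac w ρ p = Submodule.span ℂ {v} := by
  apply le_antisymm
  · intro u hu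
    obtain ⟨r, s, rfl⟩ := Submodule.mem_span_pair.1 (vac_le_span hs hρ w hv hv0 hu.1)
    have h1 : s • oAct ρ w.c v ∈ hvac w ρ p := by
      have := sub_mem hu (Submodule.smul_mem _ r hv)
      rwa [add_sub_cancel_left] at this
    have h2 := eq_zero_of_par h1.2 (by rw [map_smul, par_oAct hρ hv.2, smul_comm])
    rw [h2, add_zero]
    exact Submodule.smul_mem _ _ (Submodule.mem_span_singleton_self v)
  · exact (Submodule.span_singleton_le_iff_mem _ _).2 hv

theorem finrank_hvac_eq_one {ρ : SuperRep T.𝔥 V} (hs : ρ.IsSimple) {ν : T.Wt}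
    (hρ : (wt ρ ν).1 = ⊤) (w : WittData (T.F ν)) {p : ZMod 2} (hv : hvac w ρ p ≠ ⊥) :
    finrank ℂ (hvac w ρ p) = 1 := by
  obtain ⟨v, hv, hv0⟩ := Submodule.exists_mem_ne_zero_of_ne_bot hv
  rw [hvac_eq_span hs hρ w hv hv0]
  exact finrank_span_singleton hv0

/-- The vacuum space lies in the span of two vectors, and a Clifford module with finite-dimensional
vacuum space is finite-dimensional. -/
theorem IsSimple.finiteDimensional {ρ : SuperRep T.𝔥 V} (hs : ρ.IsSimple) {ν : T.Wt}
    (hρ : (wt ρ ν).1 = ⊤) : FiniteDimensional ℂ V := by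
  obtain ⟨w⟩ := nonempty_wittData (T.F ν) (F_symm ν)
  have := hs.1
  obtain ⟨p, v, hv, hv0⟩ := (cliffMod ρ hρ).exists_vac_ne_zero w
  exact (cliffMod ρ hρ).finiteDimensional_of_vac w
    ⟨_, FiniteDimensional.span_of_finite ℂ (Set.toFinite {v, oAct ρ w.c v}),
      fun u hu => vac_le_span hs hρ w hv hv0 hu⟩

theorem hvac_add_one_eq_bot {ρ : SuperRep T.𝔥 V} (hs : ρ.IsSimple) {ν : T.Wt}
    (hρ : (wt ρ ν).1 = ⊤) (w : WittData (T.F ν)) (hc : w.c = 0) {p : ZMod 2}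
    (hv : hvac w ρ p ≠ ⊥) : hvac w ρ (p + 1) = ⊥ := by
  obtain ⟨v, hv, hv0⟩ := Submodule.exists_mem_ne_zero_of_ne_bot hv
  rw [eq_bot_iff]
  intro u hu
  have := vac_le_span hs hρ w hv hv0 hu.1
  rw [hc, map_zero, LinearMap.zero_apply] at this
  obtain ⟨r, s, rfl⟩ := Submodule.mem_span_pair.1 this
  rw [smul_zero, add_zero] at hu ⊢
  exact eq_zero_of_par (by rw [map_smul, hv.2, smul_comm]) hu.2

/-- Simple modules with vacuum vectors of the same parity are isomorphic. -/
theorem iso_of_hvac {ρ : SuperRep T.𝔥 V} {σ : SuperRep T.𝔥 V'} (hs : ρ.IsSimple)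
    (hs' : σ.IsSimple) {ν : T.Wt} (hρ : (wt ρ ν).1 = ⊤) (hσ : (wt σ ν).1 = ⊤)
    (w : WittData (T.F ν)) {p : ZMod 2} (h : hvac w ρ p ≠ ⊥) (h' : hvac w σ p ≠ ⊥) :
    ρ.Iso σ := by
  obtain ⟨v, hv, hv0⟩ := Submodule.exists_mem_ne_zero_of_ne_bot h
  obtain ⟨v', hv', hv0'⟩ := Submodule.exists_mem_ne_zero_of_ne_bot h'
  have oprod : ∀ x, oAct (ρ.prod σ) x = (oAct ρ x).prodMap (oAct σ x) := fun x => rfl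
  have hpr : (wt (ρ.prod σ) ν).1 = ⊤ := by
    rw [eq_top_iff]
    rintro ⟨a, b⟩ _ t
    have ha : a ∈ (wt ρ ν).1 := by rw [hρ]; trivial
    have hb : b ∈ (wt σ ν).1 := by rw [hσ]; trivial
    exact Prod.ext (ha t) (hb t)
  have hV : (v, v') ∈ hvac w (ρ.prod σ) p := by
    refine ⟨fun i => ?_, ?_⟩
    · rw [oprod]; simp [hv.1 i, hv'.1 i]
    · exact Prod.ext hv.2 hv'.2
  have hz : ∀ z ∈ LinearMap.ker (T.F ν), oAct (ρ.prod σ) z = 0 := fun z hz => by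
    rw [oprod, ker_act_zero hs hρ z hz, ker_act_zero hs' hσ z hz, LinearMap.prodMap_zero]
  -- The submodule generated by the pair of vacuum vectors turns out to be the graph of the
  -- isomorphism: both projections are surjective by simplicity, and both have zero kernel.
  let G := genSub (ρ.prod σ) hpr (v, v') hV.2
  have hG : (v, v') ∈ G.1 := mem_genSub hpr hV.2
  have hGP : ∀ u ∈ G.1, w.proj (oAct (ρ.prod σ)) u ∈ Submodule.span ℂ
      {(v, v'), oAct (ρ.prod σ) w.c (v, v')} := fun u hu => proj_genSub hpr hV.2 w hz hV.1 hu
  have fst : (ρ.prod σ).IsHom ρ (LinearMap.fst ℂ V V') := ⟨fun _ => rfl, fun _ _ => rfl⟩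
  have snd : (ρ.prod σ).IsHom σ (LinearMap.snd ℂ V V') := ⟨fun _ => rfl, fun _ _ => rfl⟩
  have inl : ρ.IsHom (ρ.prod σ) (LinearMap.inl ℂ V V') :=
    ⟨fun u => Prod.ext rfl (map_zero σ.par).symm, fun x u => Prod.ext rfl (map_zero (σ.act x)).symm⟩
  have inr : σ.IsHom (ρ.prod σ) (LinearMap.inr ℂ V V') :=
    ⟨fun u => Prod.ext (map_zero ρ.par).symm rfl, fun x u => Prod.ext (map_zero (ρ.act x)).symm rfl⟩
  -- Otherwise `G` would contain `(v, 0)`. Being a vacuum vector, it would lie in the span of `(v,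
  -- v')` and `c (v, v')`. Comparing parities in the second coordinate removes the first generator;
  -- then `v` would have both parities.
  have k1 : G.1.comap (LinearMap.inl ℂ V V') = ⊥ := by
    refine (hs.2 ⟨_, inl.comap G.2⟩).resolve_right fun ht => ?_
    have hm : (v, (0 : V')) ∈ G.1 := by
      have : v ∈ G.1.comap (LinearMap.inl ℂ V V') := by
        rw [show G.1.comap (LinearMap.inl ℂ V V') = ⊤ from ht]; trivial
      exact this
    have := hGP _ hm
    rw [(cliffMod _ hpr).proj_apply_of_vac w (fun i => by rw [oprod]; simp [hv.1 i])] at this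
    obtain ⟨r, s, hrs⟩ := Submodule.mem_span_pair.1 this
    rw [oprod] at hrs
    have e1 : r • v + s • oAct ρ w.c v = v := congrArg Prod.fst hrs
    have e2 : r • v' + s • oAct σ w.c v' = 0 := congrArg Prod.snd hrs
    have e3 : σ.par (r • v') = psgn (p + 1) • (r • v') := by
      rw [eq_neg_of_add_eq_zero_left e2, map_neg, map_smul, par_oAct hσ hv'.2, smul_neg, smul_comm]
    have e4 : r • v' = 0 := eq_zero_of_par (by rw [map_smul, hv'.2, smul_comm]) e3
    have hr : r = 0 := (smul_eq_zero.1 e4).resolve_right hv0'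
    rw [hr, zero_smul, zero_add] at e1
    refine hv0 (eq_zero_of_par hv.2 ?_)
    rw [← e1, map_smul, par_oAct hρ hv.2, smul_comm]
  have k2 : G.1.comap (LinearMap.inr ℂ V V') = ⊥ := by
    refine (hs'.2 ⟨_, inr.comap G.2⟩).resolve_right fun ht => ?_
    have hm : ((0 : V), v') ∈ G.1 := by
      have : v' ∈ G.1.comap (LinearMap.inr ℂ V V') := by
        rw [show G.1.comap (LinearMap.inr ℂ V V') = ⊤ from ht]; trivial
      exact this
    have := hGP _ hm
    rw [(cliffMod _ hpr).proj_apply_of_vac w (fun i => by rw [oprod]; simp [hv'.1 i])] at this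
    obtain ⟨r, s, hrs⟩ := Submodule.mem_span_pair.1 this
    rw [oprod] at hrs
    have e1 : r • v' + s • oAct σ w.c v' = v' := congrArg Prod.snd hrs
    have e2 : r • v + s • oAct ρ w.c v = 0 := congrArg Prod.fst hrs
    have e3 : ρ.par (r • v) = psgn (p + 1) • (r • v) := by
      rw [eq_neg_of_add_eq_zero_left e2, map_neg, map_smul, par_oAct hρ hv.2, smul_neg, smul_comm]
    have e4 : r • v = 0 := eq_zero_of_par (by rw [map_smul, hv.2, smul_comm]) e3
    have hr : r = 0 := (smul_eq_zero.1 e4).resolve_right hv0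
    rw [hr, zero_smul, zero_add] at e1
    refine hv0' (eq_zero_of_par hv'.2 ?_)
    rw [← e1, map_smul, par_oAct hσ hv'.2, smul_comm]
  have hsurj1 : Function.Surjective (LinearMap.fst ℂ V V' ∘ₗ G.1.subtype) := by
    rw [← LinearMap.range_eq_top, LinearMap.range_comp, Submodule.range_subtype]
    refine (hs.2 ⟨_, fst.map G.2⟩).resolve_left fun hb => hv0 ?_
    have : v ∈ G.1.map (LinearMap.fst ℂ V V') := ⟨_, hG, rfl⟩
    rw [show G.1.map (LinearMap.fst ℂ V V') = ⊥ from hb] at this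
    exact this
  have hsurj2 : Function.Surjective (LinearMap.snd ℂ V V' ∘ₗ G.1.subtype) := by
    rw [← LinearMap.range_eq_top, LinearMap.range_comp, Submodule.range_subtype]
    refine (hs'.2 ⟨_, snd.map G.2⟩).resolve_left fun hb => hv0' ?_
    have : v' ∈ G.1.map (LinearMap.snd ℂ V V') := ⟨_, hG, rfl⟩
    rw [show G.1.map (LinearMap.snd ℂ V V') = ⊥ from hb] at this
    exact this
  refine iso_of_ker_eq (fst.comp (isHom_subtype G)) (snd.comp (isHom_subtype G)) hsurj1 hsurj2 ?_
  have z1 : LinearMap.ker (LinearMap.fst ℂ V V' ∘ₗ G.1.subtype) = ⊥ := by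
    rw [eq_bot_iff]
    rintro ⟨⟨a, b⟩, hab⟩ (h0 : a = 0)
    subst h0
    have : b ∈ G.1.comap (LinearMap.inr ℂ V V') := hab
    rw [k2] at this
    obtain rfl : b = 0 := this
    rfl
  have z2 : LinearMap.ker (LinearMap.snd ℂ V V' ∘ₗ G.1.subtype) = ⊥ := by
    rw [eq_bot_iff]
    rintro ⟨⟨a, b⟩, hab⟩ (h0 : b = 0)
    subst h0
    have : a ∈ G.1.comap (LinearMap.inl ℂ V V') := hab
    rw [k1] at this
    obtain rfl : a = 0 := this
    rfl
  rw [z1, z2]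

end TriangularDatum

namespace TriangularDatum

open SuperRep CliffMod

variable {𝔤 : Type u} [AddCommGroup 𝔤] [Module ℂ 𝔤] [LieSuperalgebra 𝔤] {T : TriangularDatum 𝔤}
  {V : Type u} [AddCommGroup V] [Module ℂ V] {V' : Type u} [AddCommGroup V'] [Module ℂ V']

/-! ### Multiplicities -/

theorem finrank_hvac_sub {ρ : SuperRep T.𝔥 V} {ν : T.Wt} (w : WittData (T.F ν)) (p : ZMod 2)
    (X : ρ.Sub) : finrank ℂ (hvac w (ρ.sub X) p) = finrank ℂ ↥(hvac w ρ p ⊓ X.1) := by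
  rw [← Submodule.finrank_map_subtype_eq]
  suffices e : (hvac w (ρ.sub X) p).map X.1.subtype = hvac w ρ p ⊓ X.1 by rw [e]
  ext v
  constructor
  · rintro ⟨u, ⟨hu, hu'⟩, rfl⟩
    exact ⟨⟨fun i => congrArg Subtype.val (hu i), congrArg Subtype.val hu'⟩, u.2⟩
  · rintro ⟨⟨hv, hv'⟩, hX⟩
    exact ⟨⟨v, hX⟩, ⟨fun i => Subtype.ext (hv i), Subtype.ext hv'⟩, rfl⟩

theorem finrank_hvac_factor [FiniteDimensional ℂ V] {ρ : SuperRep T.𝔥 V} {σ : SuperRep T.𝔥 V'}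
    {ν : T.Wt} (hρ : (wt ρ ν).1 = ⊤) (w : WittData (T.F ν)) (p : ZMod 2) {A B : ρ.Sub}
    (h : ρ.FactorIso A B σ) :
    finrank ℂ ↥(hvac w ρ p ⊓ B.1) = finrank ℂ ↥(hvac w ρ p ⊓ A.1) + finrank ℂ (hvac w σ p) := by
  obtain ⟨hAB, f, hf, hs, hk⟩ := h
  have hB : (wt (ρ.sub B) ν).1 = ⊤ := wt_sub_eq_top B (fun v _ => by rw [hρ]; trivial)
  have hσ : (wt σ ν).1 = ⊤ := wt_eq_top_of_surjective hf hs hB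
  rw [← finrank_hvac_sub, ← finrank_hvac_sub]
  refine w.finrank_vac_exact (cliffMod _ hB) (cliffMod _ hσ) (Submodule.inclusion hAB) f
    (fun _ => rfl) (fun _ _ => rfl) hf.1 (fun x v => hf.2 _ v) (Submodule.inclusion_injective hAB)
    hs ?_ p
  rw [FactorIso.ker_eq hk, Submodule.range_inclusion]

theorem exists_covBy [FiniteDimensional ℂ V] {ρ : SuperRep T.𝔥 V} {X : ρ.Sub} (hX : X ≠ ⊥) :
    ∃ A : ρ.Sub, A ⋖ X := by
  have hwf : WellFoundedGT ρ.Sub := by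
    have : WellFoundedGT (Submodule ℂ V) := inferInstance
    exact ⟨InvImage.wf (fun A : ρ.Sub => A.1) this.wf⟩
  obtain ⟨A, -, hA⟩ := exists_le_covBy_of_lt (bot_lt_iff_ne_bot.2 hX)
  exact ⟨A, hA⟩

/-- The dimension of the vacuum space of parity `p` is additive, is at most one on simple modules,
and by `iso_of_hvac` is nonzero precisely on the copies of `σ`. It therefore counts them. -/
theorem mult_eq_finrank_hvac [FiniteDimensional ℂ V] {ρ : SuperRep T.𝔥 V} {σ : SuperRep T.𝔥 V'}
    {ν : T.Wt} (hρ : (wt ρ ν).1 = ⊤) (hσ : (wt σ ν).1 = ⊤) (hs : σ.IsSimple)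
    (w : WittData (T.F ν)) {p : ZMod 2} (hp : hvac w σ p ≠ ⊥) :
    ρ.mult σ = finrank ℂ (hvac w ρ p) := by
  have h1 : finrank ℂ (hvac w σ p) = 1 := finrank_hvac_eq_one hs hσ w hp
  -- Along a chain each factor isomorphic to `σ` raises the dimension of the vacuum part by one.
  have upper : ∀ k, (∃ A B : Fin k → ρ.Sub,
      (∀ i, ρ.FactorIso (A i) (B i) σ) ∧ ∀ i j, i < j → B i ≤ A j) →
      k ≤ finrank ℂ (hvac w ρ p) := by
    rintro k ⟨A, B, hAB, hlt⟩
    have key : ∀ (n : ℕ) (hn : n < k), n + 1 ≤ finrank ℂ ↥(hvac w ρ p ⊓ (B ⟨n, hn⟩).1) := by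
      intro n
      induction n with
      | zero =>
        intro hn
        rw [finrank_hvac_factor hρ w p (hAB ⟨0, hn⟩), h1]
        omega
      | succ n ih =>
        intro hn
        rw [finrank_hvac_factor hρ w p (hAB ⟨n + 1, hn⟩), h1]
        have h2 := ih (by omega)
        have h3 : hvac w ρ p ⊓ (B ⟨n, by omega⟩).1 ≤ hvac w ρ p ⊓ (A ⟨n + 1, hn⟩).1 :=
          inf_le_inf_left _ (hlt ⟨n, by omega⟩ ⟨n + 1, hn⟩ (Nat.lt_succ_self n))
        have h4 := Submodule.finrank_mono h3
        omega
    rcases k with _ | k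
    · exact Nat.zero_le _
    · exact (key k (Nat.lt_succ_self k)).trans (Submodule.finrank_mono inf_le_left)
  -- Induction on the dimension: a maximal submodule `Y` of `X` is split off, and the chain found in
  -- `Y` is prolonged by `Y ≤ X` exactly when the factor has vacuum vectors of parity `p`.
  have lower : ∀ (n : ℕ) (X : ρ.Sub), finrank ℂ X.1 = n → ∃ A B : Fin (finrank ℂ
      ↥(hvac w ρ p ⊓ X.1)) → ρ.Sub, (∀ i, ρ.FactorIso (A i) (B i) σ) ∧
      (∀ i j, i < j → B i ≤ A j) ∧ ∀ i, B i ≤ X := by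
    intro n
    induction n using Nat.strong_induction_on with
    | _ n ih =>
      intro X hn
      by_cases hX : X = ⊥
      · have h0 : finrank ℂ ↥(hvac w ρ p ⊓ X.1) = 0 := by
          rw [hX, coe_bot, inf_bot_eq, finrank_bot]
        rw [h0]
        exact ⟨fun i => ⊥, fun i => ⊥, fun i => i.elim0, fun i => i.elim0, fun i => i.elim0⟩
      · obtain ⟨Y, hY⟩ := exists_covBy hX
        have hXw : (wt (ρ.sub X) ν).1 = ⊤ := wt_sub_eq_top X (fun v _ => by rw [hρ]; trivial)
        have hq : (wt (sq Y X) ν).1 = ⊤ :=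
          wt_eq_top_of_surjective (isHom_mkQ _) (Submodule.mkQ_surjective _) hXw
        obtain ⟨A, B, hAB, hlt, hle⟩ := ih _ (by
          rw [← hn]; exact Submodule.finrank_lt_finrank_of_lt hY.lt) Y rfl
        have hf := finrank_hvac_factor hρ w p (factorIso_sq hY.le)
        by_cases hv : hvac w (sq Y X) p = ⊥
        · rw [hv, finrank_bot, add_zero] at hf
          rw [hf]
          exact ⟨A, B, hAB, hlt, fun i => (hle i).trans hY.le⟩
        · rw [finrank_hvac_eq_one (isSimple_sq hY) hq w hv] at hf
          rw [hf]
          have hfin : ρ.FactorIso Y X σ := (factorIso_sq hY.le).trans_iso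
            (iso_of_hvac (isSimple_sq hY) hs hq hσ w hv hp)
          refine ⟨Fin.snoc (α := fun _ => ρ.Sub) A Y, Fin.snoc (α := fun _ => ρ.Sub) B X,
            fun i => ?_, fun i j hij => ?_, fun i => ?_⟩
          · refine Fin.lastCases ?_ (fun i => ?_) i
            · simpa using hfin
            · simpa using hAB i
          · revert hij
            refine Fin.lastCases ?_ (fun i => ?_) i
            · intro hij
              exact absurd hij (not_lt.2 (Fin.le_last j))
            · refine Fin.lastCases ?_ (fun j => ?_) j
              · intro _
                simpa using hle i
              · intro hij
                simpa using hlt i j hij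
          · refine Fin.lastCases ?_ (fun i => ?_) i
            · simp
            · simpa using (hle i).trans hY.le
  refine le_antisymm (csSup_le' fun k hk => upper k hk) (le_csSup ⟨_, fun k hk => upper k hk⟩ ?_)
  have := lower _ ⊤ rfl
  rw [coe_top, inf_top_eq] at this
  obtain ⟨A, B, h, h', -⟩ := this
  exact ⟨A, B, h, h'⟩

/-! ### Supercharacters in terms of vacuum vectors -/

theorem exists_hvac_ne_bot {ρ : SuperRep T.𝔥 V} (hs : ρ.IsSimple) {ν : T.Wt}
    (hρ : (wt ρ ν).1 = ⊤) (w : WittData (T.F ν)) : ∃ p, hvac w ρ p ≠ ⊥ := by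
  have := hs.1
  obtain ⟨p, v, hv, hv0⟩ := (cliffMod ρ hρ).exists_vac_ne_zero w
  exact ⟨p, fun h => hv0 ((Submodule.eq_bot_iff _).1 h v hv)⟩

theorem hvac_shift {ν : T.Wt} (w : WittData (T.F ν)) (ρ : SuperRep T.𝔥 V) (p : ZMod 2) :
    hvac w ρ.shift (p + 1) = hvac w ρ p := by
  ext v
  refine and_congr Iff.rfl ?_
  change -(ρ.par v) = psgn (p + 1) • v ↔ ρ.par v = psgn p • v
  rw [psgn_add_one, neg_smul, neg_inj]

theorem even_rk_iff {ν : T.Wt} (w : WittData (T.F ν)) : Even (T.rk ν) ↔ w.c = 0 := by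
  unfold rk
  rcases w.rank with ⟨hc, h⟩ | ⟨hc, h⟩
  · simp [hc, h]
  · have : w.c ≠ 0 := fun h0 => by rw [h0] at hc; norm_num at hc
    simp only [this, iff_false, h, Nat.not_even_iff_odd]
    exact odd_two_mul_add_one _

theorem F_c_c {ν : T.Wt} (w : WittData (T.F ν)) (h : ¬ Even (T.rk ν)) : T.F ν w.c w.c = 2 := by
  rw [even_rk_iff w] at h
  rcases w.rank with ⟨hc, -⟩ | ⟨hc, -⟩
  · exact absurd hc h
  · exact hc

/-- The coefficient of the supercharacter at `ν`, computed by vacuum vectors. -/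
theorem exists_sch_eq (C : ∀ l : T.Wt, T.SimpleMod l) {ν : T.Wt} (w : WittData (T.F ν)) :
    ∃ p, ∀ (V : Type u) [AddCommGroup V] [Module ℂ V] (ρ : SuperRep T.𝔥 V)
      [FiniteDimensional ℂ (wt ρ ν).1],
      sch C ρ ν = ((if Even (T.rk ν) then
        (finrank ℂ (hvac w (ρ.sub (wt ρ ν)) p) : ℤ) -
          (finrank ℂ (hvac w (ρ.sub (wt ρ ν)) (p + 1)) : ℤ)
        else (finrank ℂ (hvac w (ρ.sub (wt ρ ν)) p) : ℤ) : ℤ) :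
          ZMod (if Even (T.rk ν) then 0 else 2)) := by
  -- The parity `p` is one in which `C ν` has vacuum vectors; it does not depend on the module whose
  -- supercharacter is taken.
  obtain ⟨p, hp⟩ := exists_hvac_ne_bot (C ν).simple (C ν).weight w
  refine ⟨p, fun V _ _ ρ _ => ?_⟩
  have hρ : (wt (ρ.sub (wt ρ ν)) ν).1 = ⊤ := wt_sub_eq_top _ le_rfl
  unfold sch
  rw [mult_eq_finrank_hvac hρ (C ν).weight (C ν).simple w hp,
    mult_eq_finrank_hvac hρ (σ := (C ν).rep.shift) (C ν).weight (C ν).simple.shift w (p := p + 1)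
      (by rw [hvac_shift]; exact hp)]

end TriangularDatum

/-! ### Simultaneous eigenspaces -/

section Eig

variable {A V V' : Type*} [AddCommGroup A] [Module ℂ A] [AddCommGroup V] [Module ℂ V]
  [AddCommGroup V'] [Module ℂ V']

/-- The simultaneous eigenspace of the operators `f a`. -/
def eig (f : A → End ℂ V) (ν : Module.Dual ℂ A) : Submodule ℂ V where
  carrier := {v | ∀ a, f a v = ν a • v}
  add_mem' := by intro x y hx hy a; rw [map_add, hx a, hy a, smul_add]
  zero_mem' := by intro a; simp
  smul_mem' := by intro c x hx a; rw [map_smul, hx a, smul_comm]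

variable {f : A → End ℂ V}

theorem eig_stable (ν : Module.Dual ℂ A) (a : A) {v : V} (hv : v ∈ eig f ν) : f a v ∈ eig f ν := by
  rw [hv a]
  exact Submodule.smul_mem _ _ hv

/-- Applying `f a - μ a`, where `a` separates `ν` from `μ`, removes the `μ`-component and multiplies
the `ν`-component by a nonzero scalar; induction on the set of weights does the rest. -/
theorem mem_of_sum_mem_of_stable {W : Submodule ℂ V} (hW : ∀ a, ∀ v ∈ W, f a v ∈ W)
    (s : Finset (Module.Dual ℂ A)) : ∀ (v : Module.Dual ℂ A → V), (∀ ν ∈ s, v ν ∈ eig f ν) →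
      ∑ ν ∈ s, v ν ∈ W → ∀ ν ∈ s, v ν ∈ W := by
  classical
  induction s using Finset.induction_on with
  | empty => intro v _ _ ν hν; simp at hν
  | insert μ s hμ ih =>
    intro v hv hsum
    have hs : ∀ ν ∈ s, v ν ∈ W := by
      intro ν hν
      obtain ⟨a, ha⟩ : ∃ a, ν a ≠ μ a := by
        by_contra! hc
        exact hμ (LinearMap.ext hc ▸ hν)
      have h1 : ∑ ν ∈ s, (ν a - μ a) • v ν ∈ W := by
        have h2 := sub_mem (hW a _ hsum) (W.smul_mem (μ a) hsum)
        rw [Finset.sum_insert hμ, map_add, smul_add, hv μ (Finset.mem_insert_self _ _) a,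
          add_sub_add_left_eq_sub, map_sum, Finset.smul_sum, ← Finset.sum_sub_distrib] at h2
        convert h2 using 2 with κ hκ
        rw [hv κ (Finset.mem_insert_of_mem hκ) a, sub_smul]
      have h3 := ih (fun κ => (κ a - μ a) • v κ)
        (fun κ hκ => Submodule.smul_mem _ _ (hv κ (Finset.mem_insert_of_mem hκ))) h1 ν hν
      exact (W.smul_mem_iff (sub_ne_zero.2 ha)).1 h3
    intro ν hν
    rcases Finset.mem_insert.1 hν with rfl | hν
    · rw [Finset.sum_insert hμ] at hsum
      exact (W.add_mem_iff_left (W.sum_mem hs)).1 hsum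
    · exact hs ν hν

theorem exists_finsupp_of_mem {S : Set (Module.Dual ℂ A)} {v : V}
    (hv : v ∈ ⨆ ν ∈ S, eig f ν) : ∃ u : Module.Dual ℂ A →₀ V, (∀ ν, u ν ∈ eig f ν) ∧
      (∀ ν, u ν ≠ 0 → ν ∈ S) ∧ ∑ ν ∈ u.support, u ν = v := by
  obtain ⟨u, hu, hsum⟩ := (Submodule.mem_iSup_iff_exists_finsupp _ _).1 hv
  refine ⟨u, fun ν => (iSup_le fun _ => le_rfl : (⨆ _ : ν ∈ S, eig f ν) ≤ eig f ν) (hu ν),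
    fun ν hν => ?_, hsum⟩
  by_contra hS
  have := hu ν
  rw [iSup_neg hS] at this
  exact hν this

theorem mem_iSup_inf_of_stable {W : Submodule ℂ V} (hW : ∀ a, ∀ v ∈ W, f a v ∈ W)
    {S : Set (Module.Dual ℂ A)} {v : V} (hv : v ∈ ⨆ ν ∈ S, eig f ν) (hvW : v ∈ W) :
    v ∈ ⨆ ν ∈ S, eig f ν ⊓ W := by
  obtain ⟨u, hu, hS, rfl⟩ := exists_finsupp_of_mem hv
  refine Submodule.sum_mem _ fun ν hν => ?_
  have := mem_of_sum_mem_of_stable hW _ u (fun ν _ => hu ν) hvW ν hν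
  exact (le_iSup₂_of_le ν (hS ν (Finsupp.mem_support_iff.1 hν)) le_rfl :
    eig f ν ⊓ W ≤ ⨆ ν ∈ S, eig f ν ⊓ W) ⟨hu ν, this⟩

theorem stable_iSup (S : Set (Module.Dual ℂ A)) (a : A) (v : V) (hv : v ∈ ⨆ ν ∈ S, eig f ν) :
    f a v ∈ ⨆ ν ∈ S, eig f ν := by
  suffices h : (⨆ ν ∈ S, eig f ν) ≤ (⨆ ν ∈ S, eig f ν).comap (f a) from h hv
  exact iSup₂_le fun ν hν u hu =>
    (le_iSup₂_of_le ν hν le_rfl : eig f ν ≤ ⨆ ν ∈ S, eig f ν) (eig_stable ν a hu)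

/-- Independence of eigenspaces: the preceding principle is applied with `W = ⊥` to the
decomposition of `v` with the extra component `-v` at `μ`, whose total is zero. -/
theorem eq_zero_of_mem_eig {S : Set (Module.Dual ℂ A)} {μ : Module.Dual ℂ A} (hμ : μ ∉ S) {v : V}
    (hv : v ∈ ⨆ ν ∈ S, eig f ν) (hv' : v ∈ eig f μ) : v = 0 := by
  classical
  obtain ⟨u, hu, hS, hsum⟩ := exists_finsupp_of_mem hv
  have hμs : μ ∉ u.support := fun h => hμ (hS μ (Finsupp.mem_support_iff.1 h))
  have key := mem_of_sum_mem_of_stable (f := f) (W := ⊥) (by simp) (insert μ u.support)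
    (fun ν => if ν = μ then -v else u ν) (fun ν hν => by
      split_ifs with h
      · subst h; exact neg_mem hv'
      · exact hu ν) (by
      rw [Finset.sum_insert hμs, if_pos rfl]
      have : ∑ ν ∈ u.support, (if ν = μ then -v else u ν) = v := by
        rw [← hsum]
        refine Finset.sum_congr rfl fun ν hν => ?_
        rw [if_neg]
        rintro rfl
        exact hμs hν
      rw [this]; simp) μ (Finset.mem_insert_self _ _)
  simpa using key

theorem disjoint_iSup_eig {S S' : Set (Module.Dual ℂ A)} (h : Disjoint S S') :
    Disjoint (⨆ ν ∈ S, eig f ν) (⨆ ν ∈ S', eig f ν) := by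
  rw [Submodule.disjoint_def]
  intro v hv hv'
  have := mem_iSup_inf_of_stable (stable_iSup S') hv hv'
  suffices hb : (⨆ ν ∈ S, eig f ν ⊓ ⨆ ν ∈ S', eig f ν) ≤ ⊥ from hb this
  refine iSup₂_le fun ν hν u hu => ?_
  exact eq_zero_of_mem_eig (Set.disjoint_left.1 h hν) hu.2 hu.1

theorem eig_eq_of_iSup_eq_top {μ : Module.Dual ℂ A} {E : Submodule ℂ V} (hE : E ≤ eig f μ)
    {S : Set (Module.Dual ℂ A)} (hμ : μ ∉ S) (h : E ⊔ ⨆ ν ∈ S, eig f ν = ⊤) : eig f μ = E := by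
  refine le_antisymm (fun v hv => ?_) hE
  have : v ∈ E ⊔ ⨆ ν ∈ S, eig f ν := by rw [h]; trivial
  obtain ⟨e, he, u, hu, rfl⟩ := Submodule.mem_sup.1 this
  have h0 : u = 0 := eq_zero_of_mem_eig hμ hu (by
    have := sub_mem hv (hE he)
    rwa [add_sub_cancel_left] at this)
  rw [h0, add_zero]
  exact he

theorem exists_eig_lift {f' : A → End ℂ V'} {g : V →ₗ[ℂ] V'} (hg : ∀ a v, g (f a v) = f' a (g v))
    (hs : Function.Surjective g) (htop : ⨆ ν, eig f ν = ⊤) {μ : Module.Dual ℂ A} {v : V'}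
    (hv : v ∈ eig f' μ) : ∃ u ∈ eig f μ, g u = v := by
  obtain ⟨u, rfl⟩ := hs v
  have hmap : ∀ ν, ∀ x ∈ eig f ν, g x ∈ eig f' ν := fun ν x hx a => by rw [← hg, hx a, map_smul]
  have hu : u ∈ eig f μ ⊔ ⨆ ν ∈ ({μ}ᶜ : Set (Module.Dual ℂ A)), eig f ν := by
    have : (⊤ : Submodule ℂ V) ≤ eig f μ ⊔ ⨆ ν ∈ ({μ}ᶜ : Set (Module.Dual ℂ A)), eig f ν := by
      rw [← htop]
      refine iSup_le fun ν => ?_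
      by_cases h : ν = μ
      · subst h; exact le_sup_left
      · exact le_sup_of_le_right (le_iSup₂_of_le ν h le_rfl)
    exact this trivial
  obtain ⟨e, he, x, hx, rfl⟩ := Submodule.mem_sup.1 hu
  refine ⟨e, he, ?_⟩
  have h1 : g x ∈ ⨆ ν ∈ ({μ}ᶜ : Set (Module.Dual ℂ A)), eig f' ν := by
    have : (⨆ ν ∈ ({μ}ᶜ : Set (Module.Dual ℂ A)), eig f ν) ≤
        (⨆ ν ∈ ({μ}ᶜ : Set (Module.Dual ℂ A)), eig f' ν).comap g :=
      iSup₂_le fun ν hν y hy => (le_iSup₂_of_le ν hν le_rfl :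
        eig f' ν ≤ ⨆ ν ∈ ({μ}ᶜ : Set (Module.Dual ℂ A)), eig f' ν) (hmap ν y hy)
    exact this hx
  have h0 : g x = 0 := eq_zero_of_mem_eig (μ := μ) (by simp) h1 (by
    have := sub_mem hv (hmap μ e he)
    rwa [map_add, add_sub_cancel_left] at this)
  rw [map_add, h0, add_zero]

end Eig

/-! ### Signs -/

theorem zmod2_cases (i : ZMod 2) : i = 0 ∨ i = 1 := by revert i; decide

theorem sgn_comm (i j : ZMod 2) : sgn i j = sgn j i := by simp [sgn, and_comm]

theorem sgn_mul_self (i j : ZMod 2) : sgn i j * sgn i j = 1 := by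
  unfold sgn; split_ifs <;> norm_num

theorem sgn_add_right (i j k : ZMod 2) : sgn i (j + k) = sgn i j * sgn i k := by
  rcases zmod2_cases i with rfl | rfl <;> rcases zmod2_cases j with rfl | rfl <;>
    rcases zmod2_cases k with rfl | rfl <;> simp [sgn, show (1 : ZMod 2) + 1 = 0 from rfl]

theorem sgn_add_left (i j k : ZMod 2) : sgn (i + j) k = sgn i k * sgn j k := by
  rw [sgn_comm, sgn_add_right, sgn_comm k, sgn_comm k]

section Homog

variable {V : Type u} [AddCommGroup V] [Module ℂ V]

theorem mem_degOf {d : V →ₗ[ℂ] V} {i : ZMod 2} {v : V} :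
    v ∈ degOf d i ↔ d v = psgn i • v := Iff.rfl

theorem psgn_add (i j : ZMod 2) : psgn (i + j) = psgn i * psgn j := by
  rcases zmod2_cases i with rfl | rfl <;> rcases zmod2_cases j with rfl | rfl <;>
    simp [psgn, show (1 : ZMod 2) + 1 = 0 from rfl]

variable {𝔤 : Type u} [AddCommGroup 𝔤] [Module ℂ 𝔤] [LieSuperalgebra 𝔤]

theorem δ_of_deg {i : ZMod 2} {x : 𝔤} (hx : x ∈ deg 𝔤 i) : δ x = psgn i • x := hx

theorem br_mem_deg {i j : ZMod 2} {x y : 𝔤} (hx : x ∈ deg 𝔤 i) (hy : y ∈ deg 𝔤 j) :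
    br x y ∈ deg 𝔤 (i + j) := by
  rw [mem_degOf, δ_br, δ_of_deg hx, δ_of_deg hy, psgn_add]
  simp [smul_smul, mul_comm]

/-- A linear property holds for all elements if it holds for homogeneous ones. -/
theorem homog_induction {S : Submodule ℂ 𝔤} (h : ∀ i, ∀ x ∈ deg 𝔤 i, x ∈ S) (x : 𝔤) : x ∈ S := by
  obtain ⟨h0, h1, h2⟩ := half_deg x
  rw [← h2]
  exact add_mem (h 0 _ h0) (h 1 _ h1)

/-- The Jacobi identity, with brackets from the right. -/
theorem jacobi_right {i j k : ZMod 2} {x y z : 𝔤} (hx : x ∈ deg 𝔤 i) (hy : y ∈ deg 𝔤 j)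
    (hz : z ∈ deg 𝔤 k) : br x (br y z) = br (br x y) z - sgn j k • br (br x z) y := by
  rw [LieSuperalgebra.jacobi i j x hx y hy z,
    LieSuperalgebra.skew j (i + k) y hy _ (br_mem_deg hx hz), sgn_add_right, smul_neg, smul_smul,
    ← mul_assoc, sgn_comm j i, sgn_mul_self, one_mul, sub_eq_add_neg]

end Homog

namespace TriangularDatum

variable {𝔤 : Type u} [AddCommGroup 𝔤] [Module ℂ 𝔤] [LieSuperalgebra 𝔤] (T : TriangularDatum 𝔤)

/-! ### The triangular decomposition -/

variable {T} in
theorem br_mem_wtSpace {α β : T.Wt} {x y : 𝔤} (hx : x ∈ wtSpace T.𝔱 α) (hy : y ∈ wtSpace T.𝔱 β) :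
    br x y ∈ wtSpace T.𝔱 (α + β) := by
  intro a
  rw [jacobi_even _ x y (T.toral.le_even a.2), hx a, hy a]
  simp [add_smul]

variable {T} in
theorem mem_rootSum {S : Set T.Wt} {α : T.Wt} (hα : α ∈ S) {x : 𝔤} (hx : x ∈ wtSpace T.𝔱 α) :
    x ∈ rootSum S :=
  (le_iSup₂_of_le α hα le_rfl : wtSpace T.𝔱 α ≤ rootSum S) hx

variable {T} in
theorem br_mem_rootSum {S S' R : Set T.Wt}
    (h : ∀ α ∈ S, ∀ β ∈ S', wtSpace T.𝔱 (α + β) ≠ ⊥ → α + β ∈ R) {x y : 𝔤}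
    (hx : x ∈ rootSum S) (hy : y ∈ rootSum S') : br x y ∈ rootSum R := by
  have h1 : ∀ α ∈ S, ∀ x ∈ wtSpace T.𝔱 α, ∀ y ∈ rootSum S', br x y ∈ rootSum R := by
    intro α hα x hx y hy
    suffices h : (rootSum S' : Submodule ℂ 𝔤) ≤ (rootSum R : Submodule ℂ 𝔤).comap (br x) from h hy
    refine iSup₂_le fun β hβ y hy => ?_
    have hxy := br_mem_wtSpace hx hy
    by_cases hb : wtSpace T.𝔱 (α + β) = ⊥
    · rw [hb] at hxy
      rw [Submodule.mem_comap, (Submodule.mem_bot ℂ).1 hxy]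
      exact zero_mem _
    · exact mem_rootSum (h α hα β hβ hb) hxy
  suffices h : (rootSum S : Submodule ℂ 𝔤) ≤ (rootSum R : Submodule ℂ 𝔤).comap (br.flip y) from
    h hx
  exact iSup₂_le fun α hα x hx => h1 α hα x hx y hy

/-- `𝔫⁻`. -/
def nneg : Submodule ℂ 𝔤 := rootSum (negRoots T.γ)

/-- `𝔫⁺`. -/
def npos : Submodule ℂ 𝔤 := rootSum (posRoots T.γ)

theorem 𝔥_eq_rootSum : T.𝔥 = rootSum ({0} : Set T.Wt) := by simp [𝔥, rootSum]

variable {T} in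
theorem mem_negRoots_add {α β : T.Wt} (hα : α ∈ negRoots T.γ) (hβ : β ∈ negRoots T.γ)
    (h : wtSpace T.𝔱 (α + β) ≠ ⊥) : α + β ∈ negRoots T.γ := by
  obtain ⟨hα, hα'⟩ := hα
  obtain ⟨hβ, hβ'⟩ := hβ
  have hs : T.γ ⟨α, AddSubgroup.subset_closure hα⟩ + T.γ ⟨β, AddSubgroup.subset_closure hβ⟩ =
      T.γ ⟨α + β, add_mem (AddSubgroup.subset_closure hα) (AddSubgroup.subset_closure hβ)⟩ := by
    rw [← map_add]; rfl
  have h0 : α + β ≠ 0 := by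
    intro h0
    have : T.γ ⟨α + β, add_mem (AddSubgroup.subset_closure hα) (AddSubgroup.subset_closure hβ)⟩
        = 0 := by
      rw [← map_zero T.γ]; congr 1; exact Subtype.ext h0
    linarith
  exact ⟨⟨h0, h⟩, by linarith⟩

variable {T} in
theorem mem_posRoots_add {α β : T.Wt} (hα : α ∈ posRoots T.γ) (hβ : β ∈ posRoots T.γ)
    (h : wtSpace T.𝔱 (α + β) ≠ ⊥) : α + β ∈ posRoots T.γ := by
  obtain ⟨hα, hα'⟩ := hα
  obtain ⟨hβ, hβ'⟩ := hβ
  have hs : T.γ ⟨α, AddSubgroup.subset_closure hα⟩ + T.γ ⟨β, AddSubgroup.subset_closure hβ⟩ =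
      T.γ ⟨α + β, add_mem (AddSubgroup.subset_closure hα) (AddSubgroup.subset_closure hβ)⟩ := by
    rw [← map_add]; rfl
  have h0 : α + β ≠ 0 := by
    intro h0
    have : T.γ ⟨α + β, add_mem (AddSubgroup.subset_closure hα) (AddSubgroup.subset_closure hβ)⟩
        = 0 := by
      rw [← map_zero T.γ]; congr 1; exact Subtype.ext h0
    linarith
  exact ⟨⟨h0, h⟩, by linarith⟩

theorem disjoint_neg_pos : Disjoint (negRoots T.γ) (posRoots T.γ) := by
  rw [Set.disjoint_left]
  rintro α ⟨h, h1⟩ ⟨_, h2⟩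
  exact lt_asymm h1 h2

theorem zero_notMem_neg : (0 : T.Wt) ∉ negRoots T.γ := fun ⟨h, _⟩ => h.1 rfl

theorem zero_notMem_pos : (0 : T.Wt) ∉ posRoots T.γ := fun ⟨h, _⟩ => h.1 rfl

theorem rootSum_union (S S' : Set T.Wt) :
    (rootSum (S ∪ S') : Submodule ℂ 𝔤) = rootSum S ⊔ rootSum S' := iSup_union

theorem sup_eq_top : T.nneg ⊔ T.𝔥 ⊔ T.npos = ⊤ := by
  rw [eq_top_iff, ← T.toral.diagonal, 𝔥_eq_rootSum, nneg, npos, ← rootSum_union, ← rootSum_union]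
  refine iSup_le fun ν x hx => ?_
  by_cases hb : wtSpace T.𝔱 ν = ⊥
  · rw [hb] at hx
    rw [(Submodule.mem_bot ℂ).1 hx]
    exact zero_mem _
  · refine mem_rootSum ?_ hx
    by_cases h0 : ν = 0
    · exact Or.inl (Or.inr h0)
    · rcases lt_or_gt_of_ne (T.γ_ne_zero ν ⟨h0, hb⟩) with h | h
      · exact Or.inl (Or.inl ⟨⟨h0, hb⟩, h⟩)
      · exact Or.inr ⟨⟨h0, hb⟩, h⟩

theorem isCompl_nneg : IsCompl T.nneg (T.𝔥 ⊔ T.npos) := by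
  refine ⟨?_, codisjoint_iff.2 (by rw [← sup_assoc, sup_eq_top])⟩
  rw [𝔥_eq_rootSum, nneg, npos, ← rootSum_union]
  refine disjoint_iSup_eig ?_
  rw [Set.disjoint_union_right]
  exact ⟨Set.disjoint_singleton_right.2 T.zero_notMem_neg, T.disjoint_neg_pos⟩

theorem isCompl_𝔥 : IsCompl T.𝔥 (T.nneg ⊔ T.npos) := by
  refine ⟨?_, codisjoint_iff.2 (by rw [← sup_assoc, sup_comm T.𝔥, sup_eq_top])⟩
  rw [𝔥_eq_rootSum, nneg, npos, ← rootSum_union]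
  refine disjoint_iSup_eig ?_
  rw [Set.disjoint_union_right]
  exact ⟨Set.disjoint_singleton_left.2 T.zero_notMem_neg,
    Set.disjoint_singleton_left.2 T.zero_notMem_pos⟩

/-- The projection `𝔤 → 𝔫⁻`. -/
def prNeg : 𝔤 →ₗ[ℂ] T.nneg := Submodule.projectionOnto _ _ T.isCompl_nneg

/-- The projection `𝔤 → 𝔥`. -/
def prH : 𝔤 →ₗ[ℂ] T.𝔥 := Submodule.projectionOnto _ _ T.isCompl_𝔥

theorem prNeg_of_nneg (x : T.nneg) : T.prNeg x = x :=
  Submodule.projectionOnto_apply_left T.isCompl_nneg x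

theorem prNeg_of_𝔥 (x : T.𝔥) : T.prNeg x = 0 :=
  Submodule.projectionOnto_apply_of_mem_right T.isCompl_nneg (Submodule.mem_sup_left x.2)

theorem prNeg_of_npos {x : 𝔤} (hx : x ∈ T.npos) : T.prNeg x = 0 :=
  Submodule.projectionOnto_apply_of_mem_right T.isCompl_nneg (Submodule.mem_sup_right hx)

theorem prH_of_nneg (x : T.nneg) : T.prH x = 0 :=
  Submodule.projectionOnto_apply_of_mem_right T.isCompl_𝔥 (Submodule.mem_sup_left x.2)

theorem prH_of_𝔥 (x : T.𝔥) : T.prH x = x :=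
  Submodule.projectionOnto_apply_left T.isCompl_𝔥 x

theorem prH_of_npos {x : 𝔤} (hx : x ∈ T.npos) : T.prH x = 0 :=
  Submodule.projectionOnto_apply_of_mem_right T.isCompl_𝔥 (Submodule.mem_sup_right hx)

/-- A linear property holds on `𝔤` if it holds on `𝔫⁻`, `𝔥` and `𝔫⁺`. -/
theorem triangular_induction {S : Submodule ℂ 𝔤} (hn : ∀ x ∈ T.nneg, x ∈ S)
    (hh : ∀ x ∈ T.𝔥, x ∈ S) (hp : ∀ x ∈ T.npos, x ∈ S) (x : 𝔤) : x ∈ S := by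
  have h : T.nneg ⊔ T.𝔥 ⊔ T.npos ≤ S := sup_le (sup_le hn hh) hp
  rw [T.sup_eq_top] at h
  exact h trivial

theorem δ_mem_nneg {x : 𝔤} (hx : x ∈ T.nneg) : δ x ∈ T.nneg := T.δ_mem_rootSum _ x hx

theorem δ_mem_npos {x : 𝔤} (hx : x ∈ T.npos) : δ x ∈ T.npos := T.δ_mem_rootSum _ x hx

theorem br_mem_nneg {x y : 𝔤} (hx : x ∈ T.nneg) (hy : y ∈ T.nneg) : br x y ∈ T.nneg :=
  br_mem_rootSum (fun _ hα _ hβ => mem_negRoots_add hα hβ) hx hy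

theorem br_mem_npos {x y : 𝔤} (hx : x ∈ T.npos) (hy : y ∈ T.npos) : br x y ∈ T.npos :=
  br_mem_rootSum (fun _ hα _ hβ => mem_posRoots_add hα hβ) hx hy

theorem br_𝔥_rootSum {S : Set T.Wt} {x y : 𝔤} (hx : x ∈ T.𝔥) (hy : y ∈ rootSum S) :
    br x y ∈ rootSum S := by
  rw [𝔥_eq_rootSum] at hx
  refine br_mem_rootSum (fun α hα β hβ _ => ?_) hx hy
  rw [show α = 0 from hα, zero_add]
  exact hβ

theorem br_rootSum_𝔥 {S : Set T.Wt} {x y : 𝔤} (hx : x ∈ rootSum S) (hy : y ∈ T.𝔥) :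
    br x y ∈ rootSum S := by
  rw [𝔥_eq_rootSum] at hy
  refine br_mem_rootSum (fun α hα β hβ _ => ?_) hx hy
  rw [show β = 0 from hβ, add_zero]
  exact hα

theorem prNeg_δ (x : 𝔤) : (T.prNeg (δ x) : 𝔤) = δ (T.prNeg x : 𝔤) := by
  let S : Submodule ℂ 𝔤 := LinearMap.ker (T.nneg.subtype ∘ₗ T.prNeg ∘ₗ δ -
    δ ∘ₗ T.nneg.subtype ∘ₗ T.prNeg)
  have h : x ∈ S := by
    refine T.triangular_induction (fun x hx => ?_) (fun x hx => ?_) (fun x hx => ?_) x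
    · have h1 := T.prNeg_of_nneg ⟨x, hx⟩
      have h2 := T.prNeg_of_nneg ⟨δ x, T.δ_mem_nneg hx⟩
      simp only at h1 h2
      simp [S, h1, h2]
    · have h1 := T.prNeg_of_𝔥 ⟨x, hx⟩
      have h2 := T.prNeg_of_𝔥 ⟨δ x, T.δ_mem_𝔥 x hx⟩
      simp only at h1 h2
      simp [S, h1, h2]
    · simp [S, T.prNeg_of_npos hx, T.prNeg_of_npos (T.δ_mem_npos hx)]
  have := LinearMap.mem_ker.1 h
  simpa [sub_eq_zero] using this

theorem prH_δ (x : 𝔤) : (T.prH (δ x) : 𝔤) = δ (T.prH x : 𝔤) := by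
  let S : Submodule ℂ 𝔤 := LinearMap.ker (T.𝔥.subtype ∘ₗ T.prH ∘ₗ δ - δ ∘ₗ T.𝔥.subtype ∘ₗ T.prH)
  have h : x ∈ S := by
    refine T.triangular_induction (fun x hx => ?_) (fun x hx => ?_) (fun x hx => ?_) x
    · have h1 := T.prH_of_nneg ⟨x, hx⟩
      have h2 := T.prH_of_nneg ⟨δ x, T.δ_mem_nneg hx⟩
      simp only at h1 h2
      simp [S, h1, h2]
    · have h1 := T.prH_of_𝔥 ⟨x, hx⟩
      have h2 := T.prH_of_𝔥 ⟨δ x, T.δ_mem_𝔥 x hx⟩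
      simp only at h1 h2
      simp [S, h1, h2]
    · simp [S, T.prH_of_npos hx, T.prH_of_npos (T.δ_mem_npos hx)]
  have := LinearMap.mem_ker.1 h
  simpa [sub_eq_zero] using this

theorem eq_add_of_triangular (x : 𝔤) :
    ∃ y ∈ T.npos, x = T.prNeg x + T.prH x + y := by
  let S : Submodule ℂ 𝔤 :=
    T.npos.comap (LinearMap.id - T.nneg.subtype ∘ₗ T.prNeg - T.𝔥.subtype ∘ₗ T.prH)
  have h : x ∈ S := by
    refine T.triangular_induction (fun x hx => ?_) (fun x hx => ?_) (fun x hx => ?_) x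
    · have h1 := T.prNeg_of_nneg ⟨x, hx⟩
      have h2 := T.prH_of_nneg ⟨x, hx⟩
      simp only at h1 h2
      simp [S, h1, h2]
    · have h1 := T.prNeg_of_𝔥 ⟨x, hx⟩
      have h2 := T.prH_of_𝔥 ⟨x, hx⟩
      simp only at h1 h2
      simp [S, h1, h2]
    · simpa [S, T.prNeg_of_npos hx, T.prH_of_npos hx] using hx
  exact ⟨_, h, by simp⟩

theorem coe_nneg_mem_degOf (i : ZMod 2) (x : T.nneg)
    (hx : x ∈ degOf ((δ (𝔤 := 𝔤)).restrict fun _ => T.δ_mem_nneg) i) : (x : 𝔤) ∈ deg 𝔤 i :=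
  congrArg Subtype.val hx

instance : LieSuperalgebra T.nneg where
  δ := (δ (𝔤 := 𝔤)).restrict fun _ => T.δ_mem_nneg
  δ_δ := by intro x; ext; simp [δ_δ]
  br :=
    { toFun := fun x => (br (x : 𝔤)).restrict fun _ => T.br_mem_nneg x.2
      map_add' := by intro x y; ext v; simp
      map_smul' := by intro c x; ext v; simp }
  δ_br := by intro x y; ext; simp [δ_br]
  skew := by
    intro i j x hx y hy
    ext
    simpa using LieSuperalgebra.skew i j _ (T.coe_nneg_mem_degOf i x hx) _
      (T.coe_nneg_mem_degOf j y hy)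
  jacobi := by
    intro i j x hx y hy z
    ext
    simpa using LieSuperalgebra.jacobi i j _ (T.coe_nneg_mem_degOf i x hx) _
      (T.coe_nneg_mem_degOf j y hy) (z : 𝔤)

theorem coe_br_nneg (x y : T.nneg) : ((br x y : T.nneg) : 𝔤) = br (x : 𝔤) (y : 𝔤) := rfl

theorem coe_δ_nneg (x : T.nneg) : ((δ x : T.nneg) : 𝔤) = δ (x : 𝔤) := rfl

theorem mem_deg_nneg {i : ZMod 2} {x : T.nneg} : x ∈ deg T.nneg i ↔ (x : 𝔤) ∈ deg 𝔤 i :=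
  Subtype.ext_iff

theorem mem_deg_𝔥 {i : ZMod 2} {x : T.𝔥} : x ∈ deg T.𝔥 i ↔ (x : 𝔤) ∈ deg 𝔤 i :=
  Subtype.ext_iff

theorem prNeg_mem_deg {i : ZMod 2} {x : 𝔤} (hx : x ∈ deg 𝔤 i) : T.prNeg x ∈ deg T.nneg i := by
  rw [mem_deg_nneg, mem_degOf, ← prNeg_δ, δ_of_deg hx, map_smul]
  rfl

theorem prH_mem_deg {i : ZMod 2} {x : 𝔤} (hx : x ∈ deg 𝔤 i) : T.prH x ∈ deg T.𝔥 i := by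
  rw [mem_deg_𝔥, mem_degOf, ← prH_δ, δ_of_deg hx, map_smul]
  rfl

end TriangularDatum

/-! ### Modules as modules over the enveloping algebra -/

section Enveloping

variable {𝔤 : Type u} [AddCommGroup 𝔤] [Module ℂ 𝔤] [LieSuperalgebra 𝔤]
  {V : Type u} [AddCommGroup V] [Module ℂ V]

theorem adjoin_range_Uι : Algebra.adjoin ℂ (Set.range (Uι : 𝔤 → U 𝔤)) = ⊤ := by
  have h1 : Function.Surjective (Umk (𝔤 := 𝔤)) := RingQuot.mkAlgHom_surjective ℂ (URel 𝔤)
  have h2 : Set.range (Uι : 𝔤 → U 𝔤) = Umk '' Set.range (TensorAlgebra.ι ℂ) := by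
    rw [← Set.range_comp]; rfl
  rw [h2, ← AlgHom.map_adjoin, TensorAlgebra.adjoin_range_ι, Algebra.map_top,
    (AlgHom.range_eq_top _).2 h1]

/-- The action of `U(𝔤)` on a module. -/
def SuperRep.actU (ρ : SuperRep 𝔤 V) : U 𝔤 →ₐ[ℂ] End ℂ V :=
  Ulift ρ.act (by
    intro i j x hx y hy
    ext v
    have := ρ.act_br i j x hx y hy v
    simp only [Module.End.mul_apply, LinearMap.add_apply, LinearMap.smul_apply, this]
    abel)

@[simp] theorem SuperRep.actU_ι (ρ : SuperRep 𝔤 V) (x : 𝔤) : ρ.actU (Uι x) = ρ.act x :=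
  Ulift_ι _ _ x

theorem SuperRep.par_actU (ρ : SuperRep 𝔤 V) (a : U 𝔤) (v : V) :
    ρ.par (ρ.actU a v) = ρ.actU (Uδ a) (ρ.par v) := by
  have ha : a ∈ Algebra.adjoin ℂ (Set.range (Uι : 𝔤 → U 𝔤)) := by rw [adjoin_range_Uι]; trivial
  induction ha using Algebra.adjoin_induction generalizing v with
  | mem x hx => obtain ⟨x, rfl⟩ := hx; simp [ρ.par_act]
  | algebraMap r => simp
  | add x y _ _ hx hy => simp [hx, hy]
  | mul x y _ _ hx hy => simp [hx, hy]

theorem IsHom_actU {V' : Type u} [AddCommGroup V'] [Module ℂ V'] {ρ : SuperRep 𝔤 V}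
    {σ : SuperRep 𝔤 V'} {f : V →ₗ[ℂ] V'} (hf : ρ.IsHom σ f) (a : U 𝔤) (v : V) :
    f (ρ.actU a v) = σ.actU a (f v) := by
  have ha : a ∈ Algebra.adjoin ℂ (Set.range (Uι : 𝔤 → U 𝔤)) := by rw [adjoin_range_Uι]; trivial
  induction ha using Algebra.adjoin_induction generalizing v with
  | mem x hx => obtain ⟨x, rfl⟩ := hx; simp [hf.2]
  | algebraMap r => simp
  | add x y _ _ hx hy => simp [hx, hy]
  | mul x y _ _ hx hy => simp [hx, hy]

theorem sub_half (x : 𝔤) {i : ZMod 2} (hx : x ∈ deg 𝔤 i) :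
    (2⁻¹ : ℂ) • (x + δ x) = (if i = 0 then 1 else 0 : ℂ) • x ∧
      (2⁻¹ : ℂ) • (x - δ x) = (if i = 0 then 0 else 1 : ℂ) • x := by
  rw [δ_of_deg hx]
  unfold psgn
  split_ifs <;> constructor <;> module

end Enveloping

/-! ### Left multiplication on `U(𝔫) ⊗ V` -/

section LeftMul

variable {𝔫 : Type u} [AddCommGroup 𝔫] [Module ℂ 𝔫] [LieSuperalgebra 𝔫]
  {V : Type u} [AddCommGroup V] [Module ℂ V]

/-- Left multiplication by `y` on `U(𝔫) ⊗ V`. -/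
def lmul : 𝔫 →ₗ[ℂ] End ℂ (U 𝔫 ⊗[ℂ] V) :=
  LinearMap.rTensorHom V ∘ₗ LinearMap.mul ℂ (U 𝔫) ∘ₗ Uι

theorem lmul_tmul (y : 𝔫) (a : U 𝔫) (v : V) : lmul y (a ⊗ₜ[ℂ] v) = (Uι y * a) ⊗ₜ[ℂ] v := rfl

theorem lmul_lmul {i j : ZMod 2} {y z : 𝔫} (hy : y ∈ deg 𝔫 i) (hz : z ∈ deg 𝔫 j)
    (w : U 𝔫 ⊗[ℂ] V) : lmul y (lmul z w) = sgn i j • lmul z (lmul y w) + lmul (br y z) w := by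
  induction w with
  | zero => simp
  | tmul a v =>
    simp only [lmul_tmul, ← mul_assoc, Uι_mul i j y z hy hz, TensorProduct.smul_tmul',
      ← TensorProduct.add_tmul, ← smul_mul_assoc, ← add_mul]
  | add a b ha hb => simp only [map_add, smul_add, ha, hb]; abel

/-- `U(𝔫)` is generated by `𝔫`. Restricting the step to homogeneous `y` keeps the signs of the super
identities available in later inductions. -/
theorem lmul_induction {S : Submodule ℂ (U 𝔫 ⊗[ℂ] V)} (h1 : ∀ v : V, 1 ⊗ₜ[ℂ] v ∈ S)
    (h2 : ∀ i, ∀ y ∈ deg 𝔫 i, ∀ w ∈ S, lmul y w ∈ S) (w : U 𝔫 ⊗[ℂ] V) : w ∈ S := by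
  have h2' : ∀ y, ∀ w ∈ S, lmul y w ∈ S := fun y w hw =>
    homog_induction (S := S.comap (lmul.flip w)) (fun i x hx => h2 i x hx w hw) y
  have key : ∀ (a : U 𝔫), ∀ w ∈ S, LinearMap.rTensor V (LinearMap.mul ℂ (U 𝔫) a) w ∈ S := by
    intro a
    have ha : a ∈ Algebra.adjoin ℂ (Set.range (Uι : 𝔫 → U 𝔫)) := by rw [adjoin_range_Uι]; trivial
    induction ha using Algebra.adjoin_induction with
    | mem x hx => obtain ⟨x, rfl⟩ := hx; exact h2' x
    | algebraMap r =>
      intro w hw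
      have e : LinearMap.mul ℂ (U 𝔫) (algebraMap ℂ (U 𝔫) r) = r • LinearMap.id :=
        LinearMap.ext fun z => (Algebra.smul_def r z).symm
      rw [e, LinearMap.rTensor_smul, LinearMap.rTensor_id]
      exact S.smul_mem r hw
    | add x y _ _ hx hy =>
      intro w hw
      rw [map_add, LinearMap.rTensor_add, LinearMap.add_apply]
      exact S.add_mem (hx w hw) (hy w hw)
    | mul x y _ _ hx hy =>
      intro w hw
      have e : LinearMap.mul ℂ (U 𝔫) (x * y) = LinearMap.mul ℂ (U 𝔫) x ∘ₗ LinearMap.mul ℂ (U 𝔫) y :=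
        LinearMap.ext fun z => mul_assoc x y z
      rw [e, LinearMap.rTensor_comp]
      exact hx _ (hy w hw)
  induction w with
  | zero => exact zero_mem _
  | tmul a v => simpa using key a _ (h1 v)
  | add a b ha hb => exact add_mem ha hb

end LeftMul

namespace TriangularDatum

variable {𝔤 : Type u} [AddCommGroup 𝔤] [Module ℂ 𝔤] [LieSuperalgebra 𝔤] (T : TriangularDatum 𝔤)
  {V : Type u} [AddCommGroup V] [Module ℂ V]

/-! ### The `𝔫⁻`-module `Hom(𝔤, W)` -/

section HomMod

variable (V) in
/-- The carrier of the Verma module. -/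
abbrev VC : Type u := U T.nneg ⊗[ℂ] V

/-- The action of `𝔫⁻` on `Hom(𝔤, U(𝔫⁻) ⊗ V)`. -/
def homAct : T.nneg →ₗ[ℂ] End ℂ (𝔤 →ₗ[ℂ] T.VC V) where
  toFun y :=
    { toFun := fun θ => lmul ((2⁻¹ : ℂ) • (y + δ y)) ∘ₗ θ +
        lmul ((2⁻¹ : ℂ) • (y - δ y)) ∘ₗ θ ∘ₗ δ + θ ∘ₗ br.flip (y : 𝔤)
      map_add' := by
        intro θ θ'
        ext x
        simp only [LinearMap.add_apply, LinearMap.comp_apply, map_add]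
        abel
      map_smul' := by
        intro c θ
        ext x
        simp only [LinearMap.add_apply, LinearMap.comp_apply, LinearMap.smul_apply, map_smul,
          smul_add, RingHom.id_apply] }
  map_add' := by
    intro y y'
    ext θ x
    simp only [LinearMap.add_apply, LinearMap.comp_apply, LinearMap.coe_mk, AddHom.coe_mk,
      map_add, Submodule.coe_add, smul_add, smul_sub, map_sub, LinearMap.sub_apply]
    abel
  map_smul' := by
    intro c y
    ext θ x
    simp only [LinearMap.add_apply, LinearMap.comp_apply, LinearMap.coe_mk, AddHom.coe_mk,
      map_smul, Submodule.coe_smul, smul_add, smul_sub, map_sub, LinearMap.sub_apply, map_add,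
      LinearMap.smul_apply, RingHom.id_apply, smul_comm c]

/-- The rule is forced by the intended use: if `θ` is `x ↦ x w`, then the new map must be `x ↦ x (y
w) = ± y (x w) + [x, y] w`. In the definition the sign is made linear by splitting `y` into even and
odd part and inserting `δ`. -/
theorem homAct_apply {j k : ZMod 2} {y : T.nneg} (hy : y ∈ deg T.nneg j) {x : 𝔤}
    (hx : x ∈ deg 𝔤 k) (θ : 𝔤 →ₗ[ℂ] T.VC V) :
    T.homAct y θ x = sgn j k • lmul y (θ x) + θ (br x (y : 𝔤)) := by
  change lmul ((2⁻¹ : ℂ) • (y + δ y)) (θ x) + lmul ((2⁻¹ : ℂ) • (y - δ y)) (θ (δ x)) +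
    θ (br x (y : 𝔤)) = _
  congr 1
  obtain ⟨h1, h2⟩ := sub_half y hy
  rw [h1, h2, δ_of_deg hx]
  simp only [map_smul, LinearMap.smul_apply]
  rcases zmod2_cases j with rfl | rfl <;> rcases zmod2_cases k with rfl | rfl <;>
    simp [sgn, psgn]

/-- This is the super Jacobi identity for brackets from the right. It makes `Hom(𝔤, U(𝔫⁻) ⊗ V)` a
module over `U(𝔫⁻)`, so that a recursive definition along `U(𝔫⁻)` is consistent with its relations.
-/
theorem homAct_homAct {i j : ZMod 2} {y z : T.nneg} (hy : y ∈ deg T.nneg i)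
    (hz : z ∈ deg T.nneg j) : T.homAct (V := V) y * T.homAct z =
      sgn i j • (T.homAct z * T.homAct y) + T.homAct (br y z) := by
  ext1 θ
  have key : ∀ x : 𝔤, x ∈ LinearMap.ker (T.homAct y (T.homAct z θ) -
      (sgn i j • T.homAct z (T.homAct y θ) + T.homAct (br y z) θ)) := by
    refine homog_induction fun k x hx => ?_
    have hy' := T.mem_deg_nneg.1 hy
    have hz' := T.mem_deg_nneg.1 hz
    rw [LinearMap.mem_ker, LinearMap.sub_apply, sub_eq_zero]
    simp only [LinearMap.add_apply, LinearMap.smul_apply]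
    rw [T.homAct_apply hy hx, T.homAct_apply hz hx, T.homAct_apply hz (br_mem_deg hx hy'),
      T.homAct_apply hz hx, T.homAct_apply hy hx, T.homAct_apply hy (br_mem_deg hx hz'),
      T.homAct_apply (br_mem_deg hy hz) hx, coe_br_nneg, jacobi_right hx hy' hz']
    simp only [map_add, map_sub, map_smul, smul_add]
    rw [lmul_lmul hy hz]
    simp only [smul_add, smul_smul, sgn_add_left, sgn_add_right]
    have e1 := sgn_mul_self i j
    rw [sgn_comm j i]
    match_scalars <;> first | ring1 | linear_combination (-sgn i k) * e1
  exact LinearMap.ext fun x => sub_eq_zero.1 (key x)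

end HomMod

end TriangularDatum

namespace TriangularDatum

variable {𝔤 : Type u} [AddCommGroup 𝔤] [Module ℂ 𝔤] [LieSuperalgebra 𝔤] (T : TriangularDatum 𝔤)
  {V : Type u} [AddCommGroup V] [Module ℂ V]

/-! ### The Verma module on `U(𝔫⁻) ⊗ V` -/

instance homEndRing : Ring (End ℂ (𝔤 →ₗ[ℂ] T.VC V)) :=
  Module.End.instRing (N₁ := 𝔤 →ₗ[ℂ] T.VC V)

instance homEndAlgebra : Algebra ℂ (End ℂ (𝔤 →ₗ[ℂ] T.VC V)) :=
  Module.End.instAlgebra ℂ ℂ (𝔤 →ₗ[ℂ] T.VC V)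

variable (V) in
/-- The action of `U(𝔫⁻)` on `Hom(𝔤, U(𝔫⁻) ⊗ V)`. -/
def homActU : U T.nneg →ₐ[ℂ] End ℂ (𝔤 →ₗ[ℂ] T.VC V) :=
  Ulift (A := End ℂ (𝔤 →ₗ[ℂ] T.VC V)) T.homAct fun _ _ _ hy _ hz => T.homAct_homAct hy hz

/-- The map `x ↦ x (1 ⊗ v)`, from which the action on the Verma module is built. -/
def vInit (σ : SuperRep T.𝔥 V) : V →ₗ[ℂ] 𝔤 →ₗ[ℂ] T.VC V :=
  LinearMap.mk₂ ℂ (fun v x => Uι (T.prNeg x) ⊗ₜ[ℂ] v + 1 ⊗ₜ[ℂ] σ.act (T.prH x) v)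
    (by intro v v' x; simp only [TensorProduct.tmul_add, map_add]; abel)
    (by intro c v x; simp only [TensorProduct.tmul_smul, map_smul, smul_add])
    (by intro v x x'
        simp only [TensorProduct.tmul_add, TensorProduct.add_tmul, map_add, LinearMap.add_apply]
        abel)
    (by intro c v x
        simp only [TensorProduct.tmul_smul, ← TensorProduct.smul_tmul', map_smul, smul_add,
          LinearMap.smul_apply])

/-- The action of `𝔤` on the Verma module. -/
def vAct (σ : SuperRep T.𝔥 V) : 𝔤 →ₗ[ℂ] T.VC V →ₗ[ℂ] T.VC V :=
  LinearMap.flip (TensorProduct.lift (LinearMap.mk₂ ℂ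
    (fun (a : U T.nneg) (v : V) => T.homActU V a (T.vInit σ v))
    (by intro a b v; rw [map_add]; rfl)
    (by intro c a v; rw [map_smul]; rfl)
    (by intro a v v'; rw [map_add, map_add])
    (by intro c a v; rw [map_smul, map_smul])))

variable (σ : SuperRep T.𝔥 V)

theorem vAct_tmul (x : 𝔤) (a : U T.nneg) (v : V) :
    T.vAct σ x (a ⊗ₜ[ℂ] v) = T.homActU V a (T.vInit σ v) x := rfl

theorem vAct_one (x : 𝔤) (v : V) :
    T.vAct σ x (1 ⊗ₜ[ℂ] v) = Uι (T.prNeg x) ⊗ₜ[ℂ] v + 1 ⊗ₜ[ℂ] σ.act (T.prH x) v := by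
  rw [vAct_tmul, map_one]
  rfl

/-- The recursion that, together with the values on `1 ⊗ v`, determines the action; it is read off
from the action on `Hom(𝔤, U(𝔫⁻) ⊗ V)`. -/
theorem vAct_lmul {j k : ZMod 2} {y : T.nneg} (hy : y ∈ deg T.nneg j) {x : 𝔤}
    (hx : x ∈ deg 𝔤 k) (w : T.VC V) :
    T.vAct σ x (lmul y w) = sgn j k • lmul y (T.vAct σ x w) + T.vAct σ (br x (y : 𝔤)) w := by
  induction w using TensorProduct.induction_on with
  | zero => simp
  | tmul a v =>
    have h : T.homActU V (Uι y * a) (T.vInit σ v) = T.homAct y (T.homActU V a (T.vInit σ v)) := by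
      rw [map_mul, homActU, Ulift_ι]
      rfl
    rw [lmul_tmul, vAct_tmul, vAct_tmul, vAct_tmul, h, T.homAct_apply hy hx]
  | add a b ha hb => simp only [map_add, ha, hb, smul_add]; abel

theorem vAct_nneg (x : T.nneg) (w : T.VC V) : T.vAct σ (x : 𝔤) w = lmul x w := by
  have key : w ∈ ⨅ x : T.nneg, LinearMap.ker (T.vAct σ (x : 𝔤) - lmul x) := by
    refine lmul_induction (fun v => ?_) (fun j y hy w hw => ?_) w
    · rw [Submodule.mem_iInf]
      intro x
      rw [LinearMap.mem_ker, LinearMap.sub_apply, vAct_one, prNeg_of_nneg, prH_of_nneg, lmul_tmul]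
      simp
    · simp only [Submodule.mem_iInf, LinearMap.mem_ker, LinearMap.sub_apply, sub_eq_zero] at hw ⊢
      refine fun x => homog_induction (S := LinearMap.eqLocus
        ((T.vAct σ ∘ₗ T.nneg.subtype).flip (lmul y w)) (lmul.flip (lmul y w))) ?_ x
      intro k x hx
      change T.vAct σ (x : 𝔤) (lmul y w) = lmul x (lmul y w)
      rw [T.vAct_lmul σ hy (T.mem_deg_nneg.1 hx), hw x, ← coe_br_nneg, hw, lmul_lmul hx hy,
        sgn_comm]
  simp only [Submodule.mem_iInf, LinearMap.mem_ker, LinearMap.sub_apply, sub_eq_zero] at key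
  exact key x

/-- The parity operator of the Verma module. -/
def vPar : T.VC V →ₗ[ℂ] T.VC V := TensorProduct.map Uδ.toLinearMap σ.par

theorem vPar_tmul (a : U T.nneg) (v : V) : T.vPar σ (a ⊗ₜ[ℂ] v) = Uδ a ⊗ₜ[ℂ] σ.par v := rfl

theorem vPar_lmul (y : T.nneg) (w : T.VC V) :
    T.vPar σ (lmul y w) = lmul (δ y) (T.vPar σ w) := by
  induction w using TensorProduct.induction_on with
  | zero => simp
  | tmul a v => simp [lmul_tmul, vPar_tmul]
  | add a b ha hb => simp only [map_add, ha, hb]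

theorem vPar_vAct (x : 𝔤) (w : T.VC V) :
    T.vPar σ (T.vAct σ x w) = T.vAct σ (δ x) (T.vPar σ w) := by
  have key : w ∈ ⨅ x : 𝔤, LinearMap.ker (T.vPar σ ∘ₗ T.vAct σ x -
      T.vAct σ (δ x) ∘ₗ T.vPar σ) := by
    refine lmul_induction (fun v => ?_) (fun j y hy w hw => ?_) w
    · rw [Submodule.mem_iInf]
      intro x
      have h1 : T.prNeg (δ x) = δ (T.prNeg x) := Subtype.ext (T.prNeg_δ x)
      have h2 : T.prH (δ x) = δ (T.prH x) := Subtype.ext (T.prH_δ x)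
      rw [LinearMap.mem_ker, LinearMap.sub_apply, LinearMap.comp_apply, LinearMap.comp_apply,
        vAct_one, map_add, vPar_tmul, vPar_tmul, vPar_tmul, map_one, vAct_one, h1, h2, σ.par_act,
        Uδ_ι, sub_self]
    · simp only [Submodule.mem_iInf, LinearMap.mem_ker, LinearMap.sub_apply, sub_eq_zero,
        LinearMap.comp_apply] at hw ⊢
      refine fun x => homog_induction (S := LinearMap.eqLocus
        (T.vPar σ ∘ₗ (T.vAct σ).flip (lmul y w)) ((T.vAct σ).flip (T.vPar σ (lmul y w)) ∘ₗ δ)) ?_ x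
      intro k x hx
      change T.vPar σ (T.vAct σ x (lmul y w)) = T.vAct σ (δ x) (T.vPar σ (lmul y w))
      rw [T.vAct_lmul σ hy hx, map_add, map_smul, vPar_lmul, vPar_lmul, hw, hw,
        T.vAct_lmul σ (δ_mem_deg hy) (δ_mem_deg hx), δ_br, coe_δ_nneg]
  simp only [Submodule.mem_iInf, LinearMap.mem_ker, LinearMap.sub_apply, sub_eq_zero,
    LinearMap.comp_apply] at key
  exact key x

/-- In `𝔥 ⊕ 𝔫⁺` the summand `𝔫⁺` is an ideal, so projecting to `𝔥` respects brackets there. -/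
theorem br_of_prNeg_eq_zero {x z : 𝔤} (hx : T.prNeg x = 0) (hz : T.prNeg z = 0) :
    T.prNeg (br x z) = 0 ∧ T.prH (br x z) = br (T.prH x) (T.prH z) := by
  obtain ⟨y, hy, hxy⟩ := T.eq_add_of_triangular x
  obtain ⟨y', hy', hzy⟩ := T.eq_add_of_triangular z
  rw [hx, ZeroMemClass.coe_zero, zero_add] at hxy
  rw [hz, ZeroMemClass.coe_zero, zero_add] at hzy
  obtain ⟨u, hu, he⟩ : ∃ u ∈ T.npos, br x z = (br (T.prH x) (T.prH z) : T.𝔥) + u := by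
    refine ⟨br (T.prH x : 𝔤) y' + br y (T.prH z : 𝔤) + br y y', add_mem (add_mem
      (T.br_𝔥_rootSum (T.prH x).2 hy') (T.br_rootSum_𝔥 hy (T.prH z).2)) (T.br_mem_npos hy hy'), ?_⟩
    change _ = br (T.prH x : 𝔤) (T.prH z : 𝔤) + _
    conv_lhs => rw [hxy, hzy]
    simp only [map_add, LinearMap.add_apply]
    abel
  rw [he, map_add, map_add, prNeg_of_𝔥, prH_of_𝔥, T.prNeg_of_npos hu, T.prH_of_npos hu]
  simp

/-- The defect of the representation property. -/
def vDefect (i j : ZMod 2) (x z : 𝔤) : End ℂ (T.VC V) :=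
  T.vAct σ (br x z) - (T.vAct σ x ∘ₗ T.vAct σ z - sgn i j • T.vAct σ z ∘ₗ T.vAct σ x)

theorem vDefect_apply (i j : ZMod 2) (x z : 𝔤) (w : T.VC V) : T.vDefect σ i j x z w =
    T.vAct σ (br x z) w -
      (T.vAct σ x (T.vAct σ z w) - sgn i j • T.vAct σ z (T.vAct σ x w)) := rfl

theorem vDefect_swap {i j : ZMod 2} {x z : 𝔤} (hx : x ∈ deg 𝔤 i) (hz : z ∈ deg 𝔤 j)
    (w : T.VC V) : T.vDefect σ i j x z w = -(sgn i j • T.vDefect σ j i z x w) := by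
  rw [vDefect_apply, vDefect_apply, LieSuperalgebra.skew i j x hx z hz, sgn_comm j i]
  have e := sgn_mul_self i j
  simp only [map_neg, map_smul, LinearMap.neg_apply, LinearMap.smul_apply, smul_sub, smul_smul, e,
    one_smul]
  abel

theorem vDefect_nneg {i j : ZMod 2} {x : 𝔤} {z : T.nneg} (hx : x ∈ deg 𝔤 i)
    (hz : z ∈ deg T.nneg j) (w : T.VC V) : T.vDefect σ i j x z w = 0 := by
  rw [vDefect_apply, vAct_nneg, vAct_nneg, T.vAct_lmul σ hz hx, sgn_comm j i]
  abel

/-- Both arguments are split into their `𝔫⁻`-part and the rest. If one argument lies in `𝔫⁻`, the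
defect vanishes by the recursion; on the rest the action on `1 ⊗ V` is `σ` composed with the
homomorphism `prH`. -/
theorem vDefect_one {i j : ZMod 2} {x z : 𝔤} (hx : x ∈ deg 𝔤 i) (hz : z ∈ deg 𝔤 j)
    (v : V) : T.vDefect σ i j x z (1 ⊗ₜ v) = 0 := by
  have hx1 := T.prNeg_mem_deg hx
  have hz1 := T.prNeg_mem_deg hz
  set n := T.prNeg x
  set m := T.prNeg z
  have hx2 : x - n ∈ deg 𝔤 i := sub_mem hx (T.mem_deg_nneg.1 hx1)
  have hz2 : z - m ∈ deg 𝔤 j := sub_mem hz (T.mem_deg_nneg.1 hz1)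
  have hx3 : T.prNeg (x - n) = 0 := by rw [map_sub, prNeg_of_nneg, sub_self]
  have hz3 : T.prNeg (z - m) = 0 := by rw [map_sub, prNeg_of_nneg, sub_self]
  have a1 := T.vDefect_nneg σ hx hz1 (1 ⊗ₜ[ℂ] v)
  have a2 : T.vDefect σ i j n (z - m) (1 ⊗ₜ[ℂ] v) = 0 := by
    rw [T.vDefect_swap σ (T.mem_deg_nneg.1 hx1) hz2, T.vDefect_nneg σ hz2 hx1, smul_zero, neg_zero]
  have a3 : T.vDefect σ i j (x - n) (z - m) (1 ⊗ₜ[ℂ] v) = 0 := by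
    obtain ⟨h1, h2⟩ := T.br_of_prNeg_eq_zero hx3 hz3
    have h4 := σ.act_br i j _ (T.prH_mem_deg hx2) _ (T.prH_mem_deg hz2) v
    rw [vDefect_apply, vAct_one, vAct_one, vAct_one, h1, hx3, hz3, h2, h4]
    simp only [map_zero, TensorProduct.zero_tmul, zero_add, vAct_one, hx3, hz3]
    rw [TensorProduct.tmul_sub, TensorProduct.tmul_smul, sub_self]
  have e : T.vDefect σ i j x z (1 ⊗ₜ[ℂ] v) = T.vDefect σ i j x m (1 ⊗ₜ[ℂ] v) +
      T.vDefect σ i j n (z - m) (1 ⊗ₜ[ℂ] v) + T.vDefect σ i j (x - n) (z - m) (1 ⊗ₜ[ℂ] v) := by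
    simp only [vDefect_apply, map_sub, LinearMap.sub_apply, smul_sub]
    abel
  rw [e, a1, a2, a3]
  simp

/-- Induction on the vector: by the Jacobi identity the defect of `(x, z)` on `y w` is a combination
of the defects on `w` of `(x, z)`, `(x, [z, y])` and `([x, y], z)`. All pairs are therefore treated
simultaneously. -/
theorem vDefect_eq_zero {i j : ZMod 2} {x z : 𝔤} (hx : x ∈ deg 𝔤 i) (hz : z ∈ deg 𝔤 j)
    (w : T.VC V) : T.vDefect σ i j x z w = 0 := by
  have key : w ∈ ⨅ (i) (j) (x) (z) (_ : x ∈ deg 𝔤 i) (_ : z ∈ deg 𝔤 j),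
      LinearMap.ker (T.vDefect σ i j x z) := by
    refine lmul_induction (fun v => ?_) (fun k y hy w hw => ?_) w
    · simp only [Submodule.mem_iInf, LinearMap.mem_ker]
      exact fun i j x z hx hz => T.vDefect_one σ hx hz v
    · simp only [Submodule.mem_iInf, LinearMap.mem_ker] at hw ⊢
      intro i j x z hx hz
      have hy' := T.mem_deg_nneg.1 hy
      have hxy := br_mem_deg hx hy'
      have hzy := br_mem_deg hz hy'
      have d1 := hw i j x z hx hz
      have d2 := hw i (j + k) x _ hx hzy
      have d3 := hw (i + k) j _ z hxy hz
      rw [vDefect_apply, sub_eq_zero] at d1 d2 d3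
      rw [jacobi_right hx hz hy'] at d2
      rw [vDefect_apply, T.vAct_lmul σ hy (br_mem_deg hx hz), T.vAct_lmul σ hy hz,
        T.vAct_lmul σ hy hx]
      simp only [map_add, map_smul]
      rw [T.vAct_lmul σ hy hx, T.vAct_lmul σ hy hz, d1]
      simp only [map_sub, map_smul, LinearMap.sub_apply, LinearMap.smul_apply, smul_sub, smul_add,
        sgn_add_left, sgn_add_right, smul_smul] at d2 d3 ⊢
      rw [d3, sub_eq_iff_eq_add] at d2
      rw [d2]
      have e1 := sgn_mul_self j k
      rw [sgn_comm k i, sgn_comm k j]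
      simp only [smul_sub, smul_smul]
      match_scalars <;> first | ring1 | linear_combination (-sgn i j) * e1
  simp only [Submodule.mem_iInf, LinearMap.mem_ker] at key
  exact key i j x z hx hz

/-- The Verma module. -/
def verma : SuperRep 𝔤 (T.VC V) where
  par := T.vPar σ
  par_par := by
    intro w
    induction w using TensorProduct.induction_on with
    | zero => simp
    | tmul a v => rw [vPar_tmul, vPar_tmul, Uδ_Uδ, σ.par_par]
    | add a b ha hb => rw [map_add, map_add, ha, hb]
  act := T.vAct σ
  par_act := T.vPar_vAct σ
  act_br := fun _ _ _ hx _ hy w => sub_eq_zero.1 (T.vDefect_eq_zero σ hx hy w)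

end TriangularDatum

theorem U_induction {𝔫 : Type u} [AddCommGroup 𝔫] [Module ℂ 𝔫] [LieSuperalgebra 𝔫]
    {S : Submodule ℂ (U 𝔫)} (h1 : 1 ∈ S) (h2 : ∀ y : 𝔫, ∀ w ∈ S, Uι y * w ∈ S) (a : U 𝔫) :
    a ∈ S := by
  suffices h : ∀ w ∈ S, a * w ∈ S by simpa using h 1 h1
  have ha : a ∈ Algebra.adjoin ℂ (Set.range (Uι : 𝔫 → U 𝔫)) := by rw [adjoin_range_Uι]; trivial
  induction ha using Algebra.adjoin_induction with
  | mem x hx => obtain ⟨x, rfl⟩ := hx; exact h2 x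
  | algebraMap r => intro w hw; rw [← Algebra.smul_def]; exact S.smul_mem r hw
  | add x y _ _ hx hy => intro w hw; rw [add_mul]; exact S.add_mem (hx w hw) (hy w hw)
  | mul x y _ _ hx hy => intro w hw; rw [mul_assoc]; exact hx _ (hy w hw)

namespace TriangularDatum

variable {𝔤 : Type u} [AddCommGroup 𝔤] [Module ℂ 𝔤] [LieSuperalgebra 𝔤] (T : TriangularDatum 𝔤)
  {V : Type u} [AddCommGroup V] [Module ℂ V] {E : Type u} [AddCommGroup E] [Module ℂ E]

/-- The natural map `U(𝔫⁻) → U(𝔤)`. -/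
def jU : U T.nneg →ₐ[ℂ] U 𝔤 :=
  Ulift (Uι ∘ₗ T.nneg.subtype) fun i j _ hx _ hy =>
    Uι_mul i j _ _ (T.mem_deg_nneg.1 hx) (T.mem_deg_nneg.1 hy)

@[simp] theorem jU_ι (x : T.nneg) : T.jU (Uι x) = Uι (x : 𝔤) := Ulift_ι _ _ x

theorem jU_Uδ (a : U T.nneg) : T.jU (Uδ a) = Uδ (T.jU a) := by
  have h : T.jU.comp Uδ = Uδ.comp T.jU := U_hom_ext _ _ fun x => by simp [coe_δ_nneg]
  exact DFunLike.congr_fun h a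

variable (σ : SuperRep T.𝔥 V)

/-! ### The universal property of the induced module -/

section Lift

variable {T σ}
variable {ρ : SuperRep 𝔤 E} {f : V →ₗ[ℂ] E}

/-- The morphism from an induced module given by a morphism of `𝔥`-modules with image killed by
`𝔫⁺`. -/
def indLift (hf : σ.IsHom (T.res ρ) f) (hp : ∀ x ∈ T.npos, ∀ v, ρ.act x (f v) = 0) :
    ((U 𝔤 ⊗[ℂ] V) ⧸ (T.indSub σ).1) →ₗ[ℂ] E :=
  (T.indSub σ).1.liftQ (TensorProduct.lift (LinearMap.lcomp ℂ E f ∘ₗ ρ.actU.toLinearMap)) (by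
    refine Submodule.span_le.2 ?_
    rintro w (⟨u, x, v, rfl⟩ | ⟨u, x, v, hx, rfl⟩)
    · rw [SetLike.mem_coe, LinearMap.mem_ker, map_sub, sub_eq_zero]
      simp [hf.2 x v, res]
    · simp [hp x hx v])

theorem indLift_mk (hf : σ.IsHom (T.res ρ) f) (hp : ∀ x ∈ T.npos, ∀ v, ρ.act x (f v) = 0)
    (a : U 𝔤) (v : V) :
    indLift hf hp ((T.indSub σ).1.mkQ (a ⊗ₜ[ℂ] v)) = ρ.actU a (f v) := rfl

theorem isHom_indLift (hf : σ.IsHom (T.res ρ) f) (hp : ∀ x ∈ T.npos, ∀ v, ρ.act x (f v) = 0) :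
    (T.ind σ).IsHom ρ (indLift hf hp) := by
  constructor
  · intro w
    obtain ⟨w, rfl⟩ := (T.indSub σ).1.mkQ_surjective w
    induction w using TensorProduct.induction_on with
    | zero => simp
    | tmul a v =>
      change indLift hf hp ((T.indSub σ).1.mkQ (Uδ a ⊗ₜ[ℂ] σ.par v)) = _
      rw [indLift_mk, indLift_mk, ρ.par_actU, hf.1]
      rfl
    | add a b ha hb => rw [map_add, map_add, map_add, ha, hb, map_add, map_add]
  · intro x w
    obtain ⟨w, rfl⟩ := (T.indSub σ).1.mkQ_surjective w
    induction w using TensorProduct.induction_on with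
    | zero => simp
    | tmul a v =>
      change indLift hf hp ((T.indSub σ).1.mkQ ((Uι x * a) ⊗ₜ[ℂ] v)) = _
      rw [indLift_mk, indLift_mk, map_mul, SuperRep.actU_ι]
      rfl
    | add a b ha hb => rw [map_add, map_add, map_add, ha, hb, map_add, map_add]

end Lift

/-! ### The induced module is the Verma module -/

theorem isHom_one : σ.IsHom (T.res (T.verma σ)) (TensorProduct.mk ℂ (U T.nneg) V 1) := by
  constructor
  · intro v
    change _ = T.vPar σ (1 ⊗ₜ v)
    rw [vPar_tmul, map_one Uδ]
    rfl
  · intro x v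
    change _ = T.vAct σ (x : 𝔤) (1 ⊗ₜ v)
    rw [vAct_one, prNeg_of_𝔥, prH_of_𝔥]
    simp

theorem verma_npos_one {x : 𝔤} (hx : x ∈ T.npos) (v : V) :
    (T.verma σ).act x (TensorProduct.mk ℂ (U T.nneg) V 1 v) = 0 := by
  change T.vAct σ x (1 ⊗ₜ v) = 0
  rw [vAct_one, T.prNeg_of_npos hx, T.prH_of_npos hx]
  simp

/-- The morphism from the induced module to the Verma module. -/
def toVerma : ((U 𝔤 ⊗[ℂ] V) ⧸ (T.indSub σ).1) →ₗ[ℂ] T.VC V :=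
  indLift (T.isHom_one σ) fun _ hx v => T.verma_npos_one σ hx v

/-- The morphism from the Verma module to the induced module. -/
def ofVerma : T.VC V →ₗ[ℂ] ((U 𝔤 ⊗[ℂ] V) ⧸ (T.indSub σ).1) :=
  (T.indSub σ).1.mkQ ∘ₗ LinearMap.rTensor V T.jU.toLinearMap

theorem ofVerma_tmul (a : U T.nneg) (v : V) :
    T.ofVerma σ (a ⊗ₜ v) = (T.indSub σ).1.mkQ (T.jU a ⊗ₜ v) := rfl

theorem ofVerma_lmul (y : T.nneg) (w : T.VC V) :
    T.ofVerma σ (lmul y w) = (T.ind σ).act (y : 𝔤) (T.ofVerma σ w) := by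
  induction w using TensorProduct.induction_on with
  | zero => simp
  | tmul a v =>
    rw [lmul_tmul, ofVerma_tmul, map_mul, jU_ι]
    rfl
  | add a b ha hb => simp only [map_add, ha, hb]

/-- The recursion defining the Verma action holds in the induced module as a case of `act_br`, and
the values on `1 ⊗ v` agree by the relations of the induced module. -/
theorem isHom_ofVerma : (T.verma σ).IsHom (T.ind σ) (T.ofVerma σ) := by
  constructor
  · intro w
    induction w using TensorProduct.induction_on with
    | zero => simp
    | tmul a v =>
      change T.ofVerma σ (Uδ a ⊗ₜ σ.par v) = _
      rw [ofVerma_tmul, jU_Uδ]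
      rfl
    | add a b ha hb => simp only [map_add, ha, hb]
  · intro x w
    have key : w ∈ ⨅ x : 𝔤, LinearMap.ker (T.ofVerma σ ∘ₗ T.vAct σ x -
        (T.ind σ).act x ∘ₗ T.ofVerma σ) := by
      refine lmul_induction (fun v => ?_) (fun j y hy w hw => ?_) w
      · rw [Submodule.mem_iInf]
        intro x
        rw [LinearMap.mem_ker, LinearMap.sub_apply, LinearMap.comp_apply, LinearMap.comp_apply,
          vAct_one, map_add, ofVerma_tmul, ofVerma_tmul, ofVerma_tmul, map_one, jU_ι, sub_eq_zero]
        obtain ⟨y, hy, hxy⟩ := T.eq_add_of_triangular x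
        have h1 : (T.indSub σ).1.mkQ ((1 * Uι (T.prH x : 𝔤)) ⊗ₜ[ℂ] v) =
            (T.indSub σ).1.mkQ (1 ⊗ₜ[ℂ] σ.act (T.prH x) v) := by
          rw [← sub_eq_zero, ← map_sub]
          exact (Submodule.Quotient.mk_eq_zero _).2
            (Submodule.subset_span (Or.inl ⟨1, T.prH x, v, rfl⟩))
        have h2 : (T.indSub σ).1.mkQ ((1 * Uι y) ⊗ₜ[ℂ] v) = 0 :=
          (Submodule.Quotient.mk_eq_zero _).2 (Submodule.subset_span (Or.inr ⟨1, y, v, hy, rfl⟩))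
        change _ = (T.indSub σ).1.mkQ ((Uι x * 1) ⊗ₜ[ℂ] v)
        rw [one_mul] at h1 h2
        rw [mul_one, ← h1]
        conv_rhs => rw [hxy]
        simp only [map_add, TensorProduct.add_tmul, h2, add_zero]
      · simp only [Submodule.mem_iInf, LinearMap.mem_ker, LinearMap.sub_apply, sub_eq_zero,
          LinearMap.comp_apply] at hw ⊢
        refine fun x => homog_induction (S := LinearMap.eqLocus
          (T.ofVerma σ ∘ₗ (T.vAct σ).flip (lmul y w))
          ((T.ind σ).act.flip (T.ofVerma σ (lmul y w)))) ?_ x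
        intro k x hx
        change T.ofVerma σ (T.vAct σ x (lmul y w)) = (T.ind σ).act x (T.ofVerma σ (lmul y w))
        rw [T.vAct_lmul σ hy hx, map_add, map_smul, ofVerma_lmul, ofVerma_lmul, hw, hw,
          (T.ind σ).act_br k j x hx y (T.mem_deg_nneg.1 hy), sgn_comm]
        abel
    simp only [Submodule.mem_iInf, LinearMap.mem_ker, LinearMap.sub_apply, sub_eq_zero,
      LinearMap.comp_apply] at key
    exact key x

theorem toVerma_ofVerma (w : T.VC V) : T.toVerma σ (T.ofVerma σ w) = w := by
  have h1 : (T.ind σ).IsHom (T.verma σ) (T.toVerma σ) := isHom_indLift _ _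
  have key : w ∈ LinearMap.eqLocus (T.toVerma σ ∘ₗ T.ofVerma σ) LinearMap.id := by
    refine lmul_induction (fun v => ?_) (fun j y hy w hw => ?_) w
    · change T.toVerma σ (T.ofVerma σ (1 ⊗ₜ v)) = 1 ⊗ₜ v
      rw [ofVerma_tmul, toVerma, indLift_mk, map_one, map_one]
      rfl
    · change T.toVerma σ (T.ofVerma σ (lmul y w)) = lmul y w
      change T.toVerma σ (T.ofVerma σ w) = w at hw
      rw [ofVerma_lmul, h1.2, hw]
      exact T.vAct_nneg σ y w
  exact key

theorem ofVerma_toVerma (w : (U 𝔤 ⊗[ℂ] V) ⧸ (T.indSub σ).1) :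
    T.ofVerma σ (T.toVerma σ w) = w := by
  obtain ⟨w, rfl⟩ := (T.indSub σ).1.mkQ_surjective w
  induction w using TensorProduct.induction_on with
  | zero => simp
  | tmul a v =>
    have h : ∀ b, (T.ind σ).actU a ((T.indSub σ).1.mkQ (b ⊗ₜ v)) =
        (T.indSub σ).1.mkQ ((a * b) ⊗ₜ v) := by
      have ha : a ∈ Algebra.adjoin ℂ (Set.range (Uι : 𝔤 → U 𝔤)) := by
        rw [adjoin_range_Uι]; trivial
      induction ha using Algebra.adjoin_induction with
      | mem x hx =>
        obtain ⟨x, rfl⟩ := hx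
        intro b
        rw [SuperRep.actU_ι]
        rfl
      | algebraMap r =>
        intro b
        rw [AlgHom.commutes, ← Algebra.smul_def, ← TensorProduct.smul_tmul', map_smul]
        rfl
      | add x y _ _ hx hy =>
        intro b
        rw [map_add, LinearMap.add_apply, hx, hy, ← map_add, ← TensorProduct.add_tmul, add_mul]
      | mul x y _ _ hx hy => intro b; rw [map_mul, Module.End.mul_apply, hy, hx, mul_assoc]
    rw [toVerma, indLift_mk, IsHom_actU (T.isHom_ofVerma σ)]
    change (T.ind σ).actU a (T.ofVerma σ (1 ⊗ₜ v)) = _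
    rw [ofVerma_tmul, map_one, h, mul_one]
  | add a b ha hb => simp only [map_add, ha, hb]

/-- The isomorphism of the Verma module with the induced module. -/
def vermaEquiv : T.VC V ≃ₗ[ℂ] ((U 𝔤 ⊗[ℂ] V) ⧸ (T.indSub σ).1) :=
  LinearEquiv.ofLinearMap (T.ofVerma σ) (T.toVerma σ) (LinearMap.ext (T.ofVerma_toVerma σ))
    (LinearMap.ext (T.toVerma_ofVerma σ))

theorem isHom_vermaEquiv : (T.verma σ).IsHom (T.ind σ) (T.vermaEquiv σ).toLinearMap :=
  T.isHom_ofVerma σ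

end TriangularDatum

/-! ### Eigenspaces determined by a spanning family -/

section Eig

variable {A V : Type*} [AddCommGroup A] [Module ℂ A] [AddCommGroup V] [Module ℂ V]
  {f : A → End ℂ V} {S : Set (Module.Dual ℂ A)} {E : Module.Dual ℂ A → Submodule ℂ V}

theorem eig_eq_of_family (hE : ∀ ν ∈ S, E ν ≤ eig f ν) (htop : ⨆ ν ∈ S, E ν = ⊤)
    {μ : Module.Dual ℂ A} (hμ : μ ∈ S) : eig f μ = E μ := by
  refine eig_eq_of_iSup_eq_top (hE μ hμ) (S := {μ}ᶜ) (by simp) (eq_top_iff.2 ?_)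
  rw [← htop]
  refine iSup₂_le fun ν hν => ?_
  by_cases h : ν = μ
  · subst h; exact le_sup_left
  · exact le_sup_of_le_right (le_iSup₂_of_le ν h (hE ν hν))

theorem eig_eq_bot_of_family (hE : ∀ ν ∈ S, E ν ≤ eig f ν) (htop : ⨆ ν ∈ S, E ν = ⊤)
    {μ : Module.Dual ℂ A} (hμ : μ ∉ S) : eig f μ = ⊥ := by
  rw [eq_bot_iff]
  intro v hv
  have : v ∈ ⨆ ν ∈ S, eig f ν :=
    (iSup₂_mono hE : (⨆ ν ∈ S, E ν) ≤ ⨆ ν ∈ S, eig f ν) (by rw [htop]; trivial)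
  exact eq_zero_of_mem_eig hμ this hv

end Eig

/-- Transport of structure. -/
def SuperRep.congr {𝔤 : Type u} [AddCommGroup 𝔤] [Module ℂ 𝔤] [LieSuperalgebra 𝔤] {V V' : Type u}
    [AddCommGroup V] [Module ℂ V] [AddCommGroup V'] [Module ℂ V'] (ρ : SuperRep 𝔤 V)
    (e : V ≃ₗ[ℂ] V') : SuperRep 𝔤 V' where
  par := e.conj ρ.par
  par_par := by intro v; simp [LinearEquiv.conj_apply, ρ.par_par]
  act := e.conj.toLinearMap ∘ₗ ρ.act
  par_act := by intro x v; simp [LinearEquiv.conj_apply, ρ.par_act]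
  act_br := by intro i j x hx y hy v; simp [LinearEquiv.conj_apply, ρ.act_br i j x hx y hy]

theorem Uι_even_mul {𝔤 : Type u} [AddCommGroup 𝔤] [Module ℂ 𝔤] [LieSuperalgebra 𝔤] {a : 𝔤}
    (ha : a ∈ deg 𝔤 0) (y : 𝔤) : Uι a * Uι y = Uι y * Uι a + Uι (br a y) := by
  refine homog_induction (S := LinearMap.eqLocus (LinearMap.mul ℂ (U 𝔤) (Uι a) ∘ₗ Uι)
    ((LinearMap.mul ℂ (U 𝔤)).flip (Uι a) ∘ₗ Uι + Uι ∘ₗ br a)) (fun i x hx => ?_) y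
  have := Uι_mul 0 i a x ha hx
  simpa [sgn] using this

namespace TriangularDatum

variable {𝔤 : Type u} [AddCommGroup 𝔤] [Module ℂ 𝔤] [LieSuperalgebra 𝔤] (T : TriangularDatum 𝔤)
  {V : Type u} [AddCommGroup V] [Module ℂ V]

/-! ### The adjoint action of `𝔥` on `U(𝔫⁻)` -/

/-- The trivial `𝔥`-module. -/
def trivRep : SuperRep T.𝔥 (ULift.{u} ℂ) where
  par := LinearMap.id
  par_par := fun _ => rfl
  act := 0
  par_act := by simp
  act_br := by simp

/-- `U(𝔫⁻) ⊗ ℂ = U(𝔫⁻)`. -/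
def ridU : T.VC (ULift.{u} ℂ) ≃ₗ[ℂ] U T.nneg :=
  (TensorProduct.congr (LinearEquiv.refl ℂ _) ULift.moduleEquiv).trans (TensorProduct.rid ℂ _)

theorem ridU_tmul (a : U T.nneg) (c : ULift.{u} ℂ) : T.ridU (a ⊗ₜ c) = c.down • a := by
  simp [ridU]

theorem ridU_symm (a : U T.nneg) : T.ridU.symm a = a ⊗ₜ ULift.up 1 := by
  rw [LinearEquiv.symm_apply_eq, ridU_tmul, one_smul]

/-- The `𝔥`-module `U(𝔫⁻)`. -/
def adRep : SuperRep T.𝔥 (U T.nneg) := (T.res (T.verma T.trivRep)).congr T.ridU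

theorem adRep_par (a : U T.nneg) : T.adRep.par a = Uδ a := by
  change T.ridU (T.vPar T.trivRep (T.ridU.symm a)) = _
  rw [ridU_symm, vPar_tmul, ridU_tmul]
  exact one_smul _ _

theorem adRep_act (x : T.𝔥) (a : U T.nneg) :
    T.adRep.act x a = T.ridU (T.vAct T.trivRep x (T.ridU.symm a)) := rfl

theorem adRep_one (x : T.𝔥) : T.adRep.act x 1 = 0 := by
  rw [adRep_act, ridU_symm, vAct_one, prNeg_of_𝔥]
  simp [trivRep]

theorem ridU_lmul (y : T.nneg) (w : T.VC (ULift.{u} ℂ)) : T.ridU (lmul y w) = Uι y * T.ridU w := by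
  induction w using TensorProduct.induction_on with
  | zero => simp
  | tmul a c => simp [lmul_tmul, ridU_tmul]
  | add a b ha hb => simp only [map_add, ha, hb, mul_add]

/-- The bracket `𝔥 × 𝔫⁻ → 𝔫⁻`. -/
def brHN (x : T.𝔥) (y : T.nneg) : T.nneg := ⟨br (x : 𝔤) (y : 𝔤), T.br_𝔥_rootSum x.2 y.2⟩

/-- For the trivial coefficient module the recursion says that `𝔥` acts by superderivations; as `1`
is killed, this is the adjoint action. -/
theorem adRep_mul {j k : ZMod 2} {y : T.nneg} (hy : y ∈ deg T.nneg j) {x : T.𝔥}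
    (hx : x ∈ deg T.𝔥 k) (a : U T.nneg) : T.adRep.act x (Uι y * a) =
      sgn j k • (Uι y * T.adRep.act x a) + Uι (T.brHN x y) * a := by
  have e : T.ridU.symm (Uι y * a) = lmul y (T.ridU.symm a) := by
    rw [ridU_symm, ridU_symm, lmul_tmul]
  have e2 : br (x : 𝔤) (y : 𝔤) = (T.brHN x y : 𝔤) := rfl
  rw [adRep_act, e, T.vAct_lmul _ hy (T.mem_deg_𝔥.1 hx), e2, vAct_nneg, map_add, map_smul,
    ridU_lmul, ridU_lmul, LinearEquiv.apply_symm_apply, adRep_act]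

theorem adRep_mul_even {x : T.𝔥} (hx : x ∈ deg T.𝔥 0) (y : T.nneg) (a : U T.nneg) :
    T.adRep.act x (Uι y * a) = Uι y * T.adRep.act x a + Uι (T.brHN x y) * a := by
  let ad : T.nneg →ₗ[ℂ] T.nneg := (br (x : 𝔤)).restrict fun y hy => T.br_𝔥_rootSum x.2 hy
  refine homog_induction (S := LinearMap.eqLocus
    (T.adRep.act x ∘ₗ (LinearMap.mul ℂ (U T.nneg)).flip a ∘ₗ Uι)
    ((LinearMap.mul ℂ (U T.nneg)).flip (T.adRep.act x a) ∘ₗ Uι +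
      (LinearMap.mul ℂ (U T.nneg)).flip a ∘ₗ Uι ∘ₗ ad)) (fun i y hy => ?_) y
  have := T.adRep_mul hy hx a
  simp only [sgn, zero_ne_one, and_false, if_false, one_smul] at this
  exact this

variable (σ : SuperRep T.𝔥 V)

theorem verma_act_even {x : T.𝔥} (hx : x ∈ deg T.𝔥 0) (w : T.VC V) :
    (T.verma σ).act x w = TensorProduct.map (T.adRep.act x) LinearMap.id w +
      TensorProduct.map LinearMap.id (σ.act x) w := by
  have key : w ∈ LinearMap.eqLocus (T.vAct σ x) (TensorProduct.map (T.adRep.act x) LinearMap.id +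
      TensorProduct.map LinearMap.id (σ.act x)) := by
    refine lmul_induction (fun v => ?_) (fun j y hy w hw => ?_) w
    · change T.vAct σ x (1 ⊗ₜ v) = T.adRep.act x 1 ⊗ₜ[ℂ] v + 1 ⊗ₜ[ℂ] σ.act x v
      rw [vAct_one, prNeg_of_𝔥, prH_of_𝔥, adRep_one, map_zero]
    · change T.vAct σ x (lmul y w) = _
      change T.vAct σ x w = _ at hw
      have e2 : br (x : 𝔤) (y : 𝔤) = (T.brHN x y : 𝔤) := rfl
      rw [T.vAct_lmul σ hy (T.mem_deg_𝔥.1 hx), hw, e2, vAct_nneg]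
      simp only [sgn, zero_ne_one, and_false, if_false, one_smul, LinearMap.add_apply]
      clear hw
      induction w using TensorProduct.induction_on with
      | zero => simp
      | tmul a v =>
        simp only [lmul_tmul, TensorProduct.map_tmul, map_add, LinearMap.id_apply,
          T.adRep_mul_even hx, TensorProduct.add_tmul]
        abel
      | add a b ha hb =>
        simp only [map_add] at ha hb ⊢
        rw [add_add_add_comm (lmul y _), add_add_add_comm, ha, hb]
        abel
  exact key

/-- Both sides obey the same recursion. The operator `Uδ` supplies the Koszul sign, so the action
has precisely the form of `tensorO`. -/
theorem verma_act_odd {x : T.𝔥} (hx : x ∈ deg T.𝔥 1) (w : T.VC V) :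
    (T.verma σ).act x w = TensorProduct.map (T.adRep.act x) LinearMap.id w +
      TensorProduct.map Uδ.toLinearMap (σ.act x) w := by
  have key : w ∈ LinearMap.eqLocus (T.vAct σ x) (TensorProduct.map (T.adRep.act x) LinearMap.id +
      TensorProduct.map Uδ.toLinearMap (σ.act x)) := by
    refine lmul_induction (fun v => ?_) (fun j y hy w hw => ?_) w
    · change T.vAct σ x (1 ⊗ₜ v) = T.adRep.act x 1 ⊗ₜ[ℂ] v + Uδ 1 ⊗ₜ[ℂ] σ.act x v
      rw [vAct_one, prNeg_of_𝔥, prH_of_𝔥, adRep_one, map_zero, map_one Uδ]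
    · change T.vAct σ x (lmul y w) = _
      change T.vAct σ x w = _ at hw
      have e2 : br (x : 𝔤) (y : 𝔤) = (T.brHN x y : 𝔤) := rfl
      have e3 : psgn j = sgn j 1 := by
        rcases zmod2_cases j with rfl | rfl <;> simp [psgn, sgn]
      rw [T.vAct_lmul σ hy (T.mem_deg_𝔥.1 hx), hw, e2, vAct_nneg]
      simp only [LinearMap.add_apply]
      clear hw
      induction w using TensorProduct.induction_on with
      | zero => simp
      | tmul a v =>
        simp only [lmul_tmul, TensorProduct.map_tmul, map_add, LinearMap.id_apply,
          T.adRep_mul hy hx, TensorProduct.add_tmul, AlgHom.toLinearMap_apply, map_mul, Uδ_ι,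
          δ_of_deg hy, map_smul, smul_mul_assoc, ← TensorProduct.smul_tmul', smul_add, e3]
        abel
      | add a b ha hb =>
        simp only [map_add, smul_add] at ha hb ⊢
        rw [← sub_eq_zero] at ha hb ⊢
        have := congrArg₂ (· + ·) ha hb
        simp only [add_zero] at this
        rw [← this]
        abel
  exact key

/-! ### Weights of `U(𝔫⁻)` -/

theorem mem_Qneg {β : T.Wt} (hβ : β ∈ T.Qneg) : ∃ h : β ∈ AddSubgroup.closure (roots T.𝔱),
    β = 0 ∨ T.γ ⟨β, h⟩ < 0 := by
  induction hβ using AddSubmonoid.closure_induction with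
  | mem x hx =>
    obtain ⟨h, h'⟩ := hx
    exact ⟨_, Or.inr h'⟩
  | zero => exact ⟨zero_mem _, Or.inl rfl⟩
  | add x y _ _ hx hy =>
    obtain ⟨h, h'⟩ := hx
    obtain ⟨k, k'⟩ := hy
    rcases h' with rfl | h'
    · exact ⟨by simpa using k, by simpa using k'⟩
    rcases k' with rfl | k'
    · exact ⟨by simpa using h, by right; simpa using h'⟩
    refine ⟨add_mem h k, Or.inr ?_⟩
    have : T.γ ⟨x + y, add_mem h k⟩ = T.γ ⟨x, h⟩ + T.γ ⟨y, k⟩ := by rw [← map_add]; rfl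
    rw [this]
    exact add_neg h' k'

theorem eq_zero_of_Qneg {α β : T.Wt} (hα : α ∈ T.Qneg) (hβ : β ∈ T.Qneg) (h : α + β = 0) :
    α = 0 := by
  obtain ⟨h1, h1'⟩ := T.mem_Qneg hα
  obtain ⟨h2, h2'⟩ := T.mem_Qneg hβ
  refine h1'.resolve_right fun h1' => ?_
  have e : T.γ ⟨α, h1⟩ + T.γ ⟨β, h2⟩ = 0 := by
    rw [← map_add, ← map_zero T.γ]
    exact congrArg T.γ (Subtype.ext h)
  rcases h2' with rfl | h2'
  · rw [add_zero] at h
    subst h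
    rw [show (⟨0, h1⟩ : AddSubgroup.closure (roots T.𝔱)) = 0 from rfl, map_zero] at h1'
    exact lt_irrefl _ h1'
  · linarith

theorem adRep_mul_wt {α β : T.Wt} {y : T.nneg} (hy : (y : 𝔤) ∈ wtSpace T.𝔱 α) {a : U T.nneg}
    (ha : a ∈ (wt T.adRep β).1) : Uι y * a ∈ (wt T.adRep (α + β)).1 := by
  intro t
  have e : T.brHN ⟨t, T.𝔱_le_𝔥 t.2⟩ y = α t • y := Subtype.ext (hy t)
  rw [T.adRep_mul_even (𝔱_even t.2), ha t, e]
  simp [add_smul, add_comm]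

theorem one_mem_wt : (1 : U T.nneg) ∈ (wt T.adRep 0).1 := by
  intro t
  rw [adRep_one]
  simp

/-- Keeping the line of `1` apart from the weights in `Q⁻ \ {0}` shows that weight zero occurs only
on that line, hence that the top weight space of `M(λ)` is `C(λ)`. Multiplication by `𝔫⁻` never
returns to weight zero, because `γ` is negative on `Q⁻ \ {0}`. -/
theorem sup_wt_adRep :
    Submodule.span ℂ {(1 : U T.nneg)} ⊔ ⨆ β ∈ {β | β ∈ T.Qneg ∧ β ≠ 0}, (wt T.adRep β).1 = ⊤ := by
  set S := Submodule.span ℂ {(1 : U T.nneg)} ⊔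
    ⨆ β ∈ {β | β ∈ T.Qneg ∧ β ≠ 0}, (wt T.adRep β).1 with hS
  have hmem : ∀ {β a}, β ∈ T.Qneg → β ≠ 0 → a ∈ (wt T.adRep β).1 → a ∈ S := by
    intro β a hβ h0 ha
    exact (le_sup_of_le_right (le_iSup₂_of_le β ⟨hβ, h0⟩ le_rfl) : (wt T.adRep β).1 ≤ S) ha
  refine eq_top_iff.2 fun a _ => U_induction (S := S)
    (Submodule.mem_sup_left (Submodule.mem_span_singleton_self _)) (fun y w hw => ?_) a
  have hy : ∀ α ∈ negRoots T.γ, ∀ y : T.nneg, (y : 𝔤) ∈ wtSpace T.𝔱 α → Uι y * w ∈ S := by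
    intro α hα y hy
    have hα0 : α ∈ T.Qneg := AddSubmonoid.subset_closure hα
    have hne : α ≠ 0 := fun h => T.zero_notMem_neg (h ▸ hα)
    suffices h : S ≤ S.comap (LinearMap.mul ℂ (U T.nneg) (Uι y)) from h hw
    refine sup_le ?_ (iSup₂_le fun β hβ a ha => ?_)
    · rw [Submodule.span_singleton_le_iff_mem]
      refine hmem hα0 hne ?_
      have := T.adRep_mul_wt hy T.one_mem_wt
      rwa [add_zero] at this
    · exact hmem (add_mem hα0 hβ.1) (fun h => hne (T.eq_zero_of_Qneg hα0 hβ.1 h))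
        (T.adRep_mul_wt hy ha)
  -- The step holds for root vectors; linearity in `y` extends it to `𝔫⁻`, which is a sum of root
  -- spaces only inside `𝔤`.
  have hle : T.nneg ≤ (S.comap ((LinearMap.mul ℂ (U T.nneg)).flip w ∘ₗ Uι)).map T.nneg.subtype :=
    iSup₂_le fun α hα x hx => ⟨⟨x, mem_rootSum hα hx⟩, hy α hα _ hx, rfl⟩
  obtain ⟨y', hy', e⟩ := hle y.2
  rw [Subtype.ext e] at hy'
  exact hy'

theorem iSup_wt_adRep : ⨆ β ∈ (T.Qneg : Set T.Wt), (wt T.adRep β).1 = ⊤ := by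
  rw [eq_top_iff, ← sup_wt_adRep]
  refine sup_le ?_ (iSup₂_mono' fun β hβ => ⟨β, hβ.1, le_rfl⟩)
  rw [Submodule.span_singleton_le_iff_mem]
  exact (le_iSup₂_of_le 0 (zero_mem T.Qneg) le_rfl : (wt T.adRep 0).1 ≤ _) T.one_mem_wt

theorem wt_adRep_zero : (wt T.adRep 0).1 = Submodule.span ℂ {(1 : U T.nneg)} := by
  refine eig_eq_of_iSup_eq_top (E := Submodule.span ℂ {(1 : U T.nneg)}) ?_
    (S := {β | β ∈ T.Qneg ∧ β ≠ 0}) (by simp) T.sup_wt_adRep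
  rw [Submodule.span_singleton_le_iff_mem]
  exact T.one_mem_wt

/-- An element `a` is recovered from its image in `U(𝔤)` by acting on the generator of a Verma
module. This identifies the weight spaces of `U(𝔫⁻)` with subspaces of those assumed
finite-dimensional inside `U(𝔤)`. -/
theorem jU_injective : Function.Injective T.jU := by
  have h : ∀ a : U T.nneg, (T.verma T.trivRep).actU (T.jU a) (1 ⊗ₜ ULift.up 1) =
      a ⊗ₜ ULift.up 1 := by
    intro a
    have h := T.toVerma_ofVerma T.trivRep (a ⊗ₜ ULift.up 1)
    rwa [ofVerma_tmul, toVerma, indLift_mk] at h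
  intro a b hab
  rw [← T.ridU.symm.injective.eq_iff, ridU_symm, ridU_symm, ← h, ← h b, hab]

theorem jU_adRep (t : T.𝔱) (a : U T.nneg) : T.jU (T.adRep.act ⟨t, T.𝔱_le_𝔥 t.2⟩ a) =
    Uι (t : 𝔤) * T.jU a - T.jU a * Uι (t : 𝔤) := by
  refine U_induction (S := LinearMap.eqLocus (T.jU.toLinearMap ∘ₗ T.adRep.act ⟨t, T.𝔱_le_𝔥 t.2⟩)
    ((LinearMap.mul ℂ (U 𝔤) (Uι (t : 𝔤)) - (LinearMap.mul ℂ (U 𝔤)).flip (Uι (t : 𝔤))) ∘ₗ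
      T.jU.toLinearMap)) ?_ (fun y w hw => ?_) a
  · change T.jU _ = Uι (t : 𝔤) * T.jU 1 - T.jU 1 * Uι (t : 𝔤)
    rw [adRep_one]
    simp
  · change T.jU _ = Uι (t : 𝔤) * T.jU w - T.jU w * Uι (t : 𝔤) at hw
    change T.jU _ = Uι (t : 𝔤) * T.jU (Uι y * w) - T.jU (Uι y * w) * Uι (t : 𝔤)
    have e : ((T.brHN ⟨t, T.𝔱_le_𝔥 t.2⟩ y : T.nneg) : 𝔤) = br (t : 𝔤) (y : 𝔤) := rfl
    rw [T.adRep_mul_even (𝔱_even t.2), map_add, map_mul, map_mul, map_mul, hw, jU_ι, jU_ι, e,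
      ← mul_assoc, Uι_even_mul (T.toral.le_even t.2)]
    noncomm_ring

theorem jU_mem (a : U T.nneg) :
    T.jU a ∈ Algebra.adjoin ℂ (Uι '' (rootSum (negRoots T.γ) : Set 𝔤)) := by
  refine U_induction (S := (Algebra.adjoin ℂ (Uι '' (rootSum (negRoots T.γ) : Set 𝔤))).toSubmodule.comap
    T.jU.toLinearMap) ?_ (fun y w hw => ?_) a
  · change T.jU 1 ∈ Algebra.adjoin ℂ _
    rw [map_one]
    exact one_mem _
  · change T.jU (Uι y * w) ∈ Algebra.adjoin ℂ _
    rw [map_mul, jU_ι]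
    exact mul_mem (Algebra.subset_adjoin ⟨y, y.2, rfl⟩) hw

theorem finiteDimensional_wt_adRep {β : T.Wt} (hβ : β ∈ T.Qneg) :
    FiniteDimensional ℂ (wt T.adRep β).1 := by
  have := T.finite_UwtSpace β (T.mem_Qneg hβ).1
  refine FiniteDimensional.of_injective (LinearMap.restrict T.jU.toLinearMap
    (p := (wt T.adRep β).1) (q := UwtSpace (negRoots T.γ) β) fun a ha => ⟨T.jU_mem a, fun t => ?_⟩)
    fun a b hab => ?_
  · rw [AlgHom.toLinearMap_apply, ← jU_adRep, ha t, map_smul]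
  · exact Subtype.ext (T.jU_injective (congrArg Subtype.val hab))

end TriangularDatum

theorem WittData.finrank_vac_equiv {Q V₁ V₂ : Type*} [AddCommGroup Q] [Module ℂ Q]
    [AddCommGroup V₁] [Module ℂ V₁] [AddCommGroup V₂] [Module ℂ V₂]
    {B : Q →ₗ[ℂ] Q →ₗ[ℂ] ℂ} (w : WittData B) {par₁ : End ℂ V₁} {o₁ : Q →ₗ[ℂ] End ℂ V₁}
    {par₂ : End ℂ V₂} {o₂ : Q →ₗ[ℂ] End ℂ V₂} (e : V₁ ≃ₗ[ℂ] V₂)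
    (ep : ∀ v, e (par₁ v) = par₂ (e v)) (eo : ∀ x v, e (o₁ x v) = o₂ x (e v)) (p : ZMod 2) :
    finrank ℂ (w.vac o₁ par₁ p) = finrank ℂ (w.vac o₂ par₂ p) := by
  have h : (w.vac o₁ par₁ p).map e.toLinearMap = w.vac o₂ par₂ p := by
    ext v
    constructor
    · rintro ⟨u, ⟨hu, hu'⟩, rfl⟩
      exact ⟨fun i => by
        change o₂ _ (e u) = 0
        rw [← eo, hu, map_zero], by
        change par₂ (e u) = psgn p • e u
        rw [← ep, hu', map_smul]⟩
    · rintro ⟨hv, hv'⟩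
      refine ⟨e.symm v, ⟨fun i => e.injective ?_, e.injective ?_⟩, e.apply_symm_apply v⟩
      · rw [eo, e.apply_symm_apply, hv, map_zero]
      · rw [ep, map_smul, e.apply_symm_apply, hv']
  rw [← h]
  exact (LinearEquiv.finrank_map_eq e _).symm

/-! ### Vacuum counts for a form that splits as a sum -/

section Tensor

variable {Q V V' : Type*} [AddCommGroup Q] [Module ℂ Q] [AddCommGroup V] [Module ℂ V]
  [AddCommGroup V'] [Module ℂ V'] [FiniteDimensional ℂ Q] [FiniteDimensional ℂ V]
  [FiniteDimensional ℂ V'] {B B' B'' : Q →ₗ[ℂ] Q →ₗ[ℂ] ℂ} {par : End ℂ V} {o : Q →ₗ[ℂ] End ℂ V}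
  {par' : End ℂ V'} {o' : Q →ₗ[ℂ] End ℂ V'}

/-- The third form stays a variable because the hyperbolic pairs are chosen for `F ν`, which equals
`F (ν - l) + F l` only through a rewriting of the weight. -/
theorem finrank_vac_tensor_eq_of_eq (h : CliffMod B par o) (h' : CliffMod B' par' o')
    (hs : ∀ x y, B x y = B y x) (hB : B ≠ 0) (w : WittData B'') (e : B'' = B + B')
    (hc : finrank ℂ (LinearMap.ker B') ≤ 1)
    (hodd : Odd (finrank ℂ Q) → finrank ℂ (LinearMap.ker B') = 0) (p q : ZMod 2) :
    finrank ℂ (w.vac (tensorO o par o') (TensorProduct.map par par') p) =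
      finrank ℂ (w.vac (tensorO o par o') (TensorProduct.map par par') q) := by
  subst e
  exact finrank_vac_tensor_eq h h' hs hB w hc hodd p q

theorem even_finrank_vac_tensor_of_eq (h : CliffMod B par o) (h' : CliffMod B' par' o')
    (hs : ∀ x y, B x y = B y x) (hs' : ∀ x y, B' x y = B' y x) (hB : B ≠ 0)
    (w : WittData B'') (e : B'' = B + B') (hw : B'' w.c w.c = 2)
    (hc : finrank ℂ (LinearMap.ker B') ≤ 1)
    (hodd : Odd (finrank ℂ Q) → finrank ℂ (LinearMap.ker B') = 0) (p : ZMod 2) :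
    Even (finrank ℂ (w.vac (tensorO o par o') (TensorProduct.map par par') p)) := by
  subst e
  exact even_finrank_vac_tensor h h' hs hs' hB w hw hc hodd p

end Tensor

namespace TriangularDatum

variable {𝔤 : Type u} [AddCommGroup 𝔤] [Module ℂ 𝔤] [LieSuperalgebra 𝔤] {T : TriangularDatum 𝔤}
  {V : Type u} [AddCommGroup V] [Module ℂ V]

theorem F_add (α β : T.Wt) : T.F (α + β) = T.F α + T.F β := rfl

/-! ### Weights of the Verma module -/

section VermaWeights

/-- The subspace `U(𝔫⁻)_β ⊗ V` of the Verma module. -/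
def vWt (T : TriangularDatum 𝔤) (V : Type u) [AddCommGroup V] [Module ℂ V] (β : T.Wt) :
    Submodule ℂ (T.VC V) :=
  LinearMap.range (LinearMap.rTensor V (wt T.adRep β).1.subtype)

theorem tmul_mem_vWt {β : T.Wt} {a : U T.nneg} (ha : a ∈ (wt T.adRep β).1) (v : V) :
    a ⊗ₜ v ∈ vWt T V β := ⟨⟨a, ha⟩ ⊗ₜ v, rfl⟩

variable {σ : SuperRep T.𝔥 V} {l : T.Wt} (hσ : (wt σ l).1 = ⊤)
include hσ

theorem vWt_le (β : T.Wt) : vWt T V β ≤ (wt (T.res (T.verma σ)) (β + l)).1 := by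
  rintro _ ⟨w, rfl⟩
  induction w using TensorProduct.induction_on with
  | zero => simp
  | tmul a v =>
    intro t
    have hv : v ∈ (wt σ l).1 := by rw [hσ]; trivial
    change (T.verma σ).act _ ((a : U T.nneg) ⊗ₜ v) = _ • ((a : U T.nneg) ⊗ₜ v)
    have := T.verma_act_even σ (𝔱_even t.2) ((a : U T.nneg) ⊗ₜ[ℂ] v)
    refine this.trans ?_
    rw [TensorProduct.map_tmul, TensorProduct.map_tmul, a.2 t, hv t, LinearMap.add_apply, add_smul,
      TensorProduct.smul_tmul', TensorProduct.tmul_smul]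
    rfl
  | add a b ha hb => rw [map_add]; exact add_mem ha hb

omit hσ in
theorem iSup_vWt : ⨆ β ∈ (T.Qneg : Set T.Wt), vWt T V β = ⊤ := by
  refine eq_top_iff.2 fun w _ => ?_
  induction w using TensorProduct.induction_on with
  | zero => exact zero_mem _
  | tmul a v =>
    have h : (⊤ : Submodule ℂ (U T.nneg)) ≤ (⨆ β ∈ (T.Qneg : Set T.Wt), vWt T V β).comap
        ((TensorProduct.mk ℂ (U T.nneg) V).flip v) := by
      rw [← iSup_wt_adRep]
      exact iSup₂_le fun β hβ a ha =>
        (le_iSup₂_of_le β hβ le_rfl : vWt T V β ≤ _) (tmul_mem_vWt ha v)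
    exact h (trivial : a ∈ _)
  | add a b ha hb => exact add_mem (ha trivial) (hb trivial)

omit hσ in
theorem iSup_vWt_sub (l : T.Wt) : ⨆ ν ∈ {ν | T.le ν l}, vWt T V (ν - l) = ⊤ := by
  rw [eq_top_iff, ← iSup_vWt]
  refine iSup₂_le fun β hβ => le_iSup₂_of_le (β + l) ?_ ?_
  · change β + l - l ∈ T.Qneg
    rwa [add_sub_cancel_right]
  · rw [add_sub_cancel_right]

theorem vWt_sub_le (ν : T.Wt) : vWt T V (ν - l) ≤ (wt (T.res (T.verma σ)) ν).1 := by
  have := vWt_le hσ (ν - l)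
  rwa [sub_add_cancel] at this

theorem wt_verma {ν : T.Wt} (hν : T.le ν l) :
    (wt (T.res (T.verma σ)) ν).1 = vWt T V (ν - l) :=
  eig_eq_of_family (S := {ν | T.le ν l}) (E := fun ν => vWt T V (ν - l))
    (fun ν _ => vWt_sub_le hσ ν) (iSup_vWt_sub l) hν

theorem wt_verma_eq_bot {ν : T.Wt} (hν : ¬ T.le ν l) : (wt (T.res (T.verma σ)) ν).1 = ⊥ :=
  eig_eq_bot_of_family (S := {ν | T.le ν l}) (E := fun ν => vWt T V (ν - l))
    (fun ν _ => vWt_sub_le hσ ν) (iSup_vWt_sub l) hν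

theorem iSup_wt_verma : ⨆ ν : T.Wt, (wt (T.res (T.verma σ)) ν).1 = ⊤ := by
  rw [eq_top_iff, ← iSup_vWt_sub l]
  exact iSup₂_le fun ν _ => le_iSup_of_le ν (vWt_sub_le hσ ν)

theorem finiteDimensional_wt_verma [FiniteDimensional ℂ V] (ν : T.Wt) :
    FiniteDimensional ℂ (wt (T.res (T.verma σ)) ν).1 := by
  by_cases hν : T.le ν l
  · have := T.finiteDimensional_wt_adRep hν
    rw [wt_verma hσ hν]
    unfold vWt
    infer_instance
  · rw [wt_verma_eq_bot hσ hν]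
    infer_instance

theorem wt_verma_top : (wt (T.res (T.verma σ)) l).1 =
    LinearMap.range (TensorProduct.mk ℂ (U T.nneg) V 1) := by
  have hl : T.le l l := by unfold le; rw [sub_self]; exact zero_mem _
  rw [wt_verma hσ hl, sub_self]
  apply le_antisymm
  · rintro _ ⟨w, rfl⟩
    induction w using TensorProduct.induction_on with
    | zero => simp
    | tmul a v =>
      have ha : (a : U T.nneg) ∈ Submodule.span ℂ {(1 : U T.nneg)} := T.wt_adRep_zero.le a.2
      obtain ⟨c, hc⟩ := Submodule.mem_span_singleton.1 ha
      refine ⟨c • v, ?_⟩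
      change 1 ⊗ₜ[ℂ] (c • v) = (a : U T.nneg) ⊗ₜ[ℂ] v
      rw [← hc, TensorProduct.smul_tmul]
    | add a b ha hb => rw [map_add]; exact add_mem ha hb
  · rintro _ ⟨v, rfl⟩
    exact tmul_mem_vWt T.one_mem_wt v

/-- `M_{β + l} ≅ U(𝔫⁻)_β ⊗ V` as Clifford modules. -/
theorem finrank_hvac_verma {ν : T.Wt} (hν : T.le ν l) {B : T.𝔥₁ →ₗ[ℂ] T.𝔥₁ →ₗ[ℂ] ℂ}
    (w : WittData B) (p : ZMod 2) :
    finrank ℂ (w.vac (oAct ((T.res (T.verma σ)).sub (wt (T.res (T.verma σ)) ν)))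
        ((T.res (T.verma σ)).sub (wt (T.res (T.verma σ)) ν)).par p) =
      finrank ℂ (w.vac (tensorO (oAct (T.adRep.sub (wt T.adRep (ν - l))))
        (T.adRep.sub (wt T.adRep (ν - l))).par (oAct σ))
        (TensorProduct.map (T.adRep.sub (wt T.adRep (ν - l))).par σ.par) p) := by
  let f : (wt T.adRep (ν - l)).1 ⊗[ℂ] V →ₗ[ℂ] T.VC V :=
    LinearMap.rTensor V (wt T.adRep (ν - l)).1.subtype
  have hf : Function.Injective f :=
    Module.Flat.rTensor_preserves_injective_linearMap _ (Submodule.injective_subtype _)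
  have hr : LinearMap.range f = (wt (T.res (T.verma σ)) ν).1 := (wt_verma hσ hν).symm
  let e := (LinearEquiv.ofInjective f hf).trans (LinearEquiv.ofEq _ _ hr)
  have he : ∀ w, (e w : T.VC V) = f w := fun w => rfl
  refine (w.finrank_vac_equiv e (fun v => Subtype.ext ?_) (fun x v => Subtype.ext ?_) p).symm
  · change f _ = T.vPar σ (f v)
    induction v using TensorProduct.induction_on with
    | zero => simp
    | tmul a v =>
      change ((T.adRep.par a) ⊗ₜ[ℂ] σ.par v : T.VC V) = Uδ (a : U T.nneg) ⊗ₜ σ.par v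
      rw [adRep_par]
    | add a b ha hb => simp only [map_add, ha, hb]
  · change f _ = (T.verma σ).act x (f v)
    rw [T.verma_act_odd σ (odd_mem x)]
    induction v using TensorProduct.induction_on with
    | zero => simp
    | tmul a v =>
      change (T.adRep.act _ a ⊗ₜ[ℂ] v + T.adRep.par a ⊗ₜ[ℂ] σ.act _ v : T.VC V) =
        T.adRep.act _ a ⊗ₜ[ℂ] v + Uδ (a : U T.nneg) ⊗ₜ[ℂ] σ.act _ v
      rw [adRep_par]
      rfl
    | add a b ha hb =>
      simp only [map_add] at ha hb ⊢
      rw [ha, hb]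
      abel

end VermaWeights

/-- For `ν < l` the weight space is a Clifford module `U(𝔫⁻)_{ν-l} ⊗ C(l)`, to which the tensor
product lemmas apply with `B = F (ν - l)`, nonzero by (A2), and `B' = F l`. For even rank the two
multiplicities cancel; for odd rank the multiplicity is even. -/
theorem sch_verma_eq_zero (C : ∀ l : T.Wt, T.SimpleMod l) (hA : T.A2) {l ν : T.Wt} (hνl : ν ≠ l)
    (hc : T.corank l ≤ 1) (hodd : Odd (finrank ℂ T.𝔥₁) → T.corank l = 0) :
    sch C (T.res (T.verma (C l).rep)) ν = 0 := by
  have hσ := (C l).weight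
  have := IsSimple.finiteDimensional (C l).simple hσ
  have hfin := finiteDimensional_wt_verma hσ ν
  obtain ⟨w⟩ := nonempty_wittData (T.F ν) (F_symm ν)
  obtain ⟨p, hp⟩ := exists_sch_eq C w
  rw [hp]
  by_cases hν : T.le ν l
  · have hadd : T.F ν = T.F (ν - l) + T.F l := by rw [← F_add, sub_add_cancel]
    have hF := hA (ν - l) hν (sub_ne_zero.2 hνl)
    have hfd := T.finiteDimensional_wt_adRep hν
    have h1 : (wt (T.adRep.sub (wt T.adRep (ν - l))) (ν - l)).1 = ⊤ := wt_sub_eq_top _ le_rfl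
    have hvac : ∀ p, finrank ℂ (hvac w _ p) = _ := fun p => finrank_hvac_verma hσ hν w p
    rw [hvac, hvac]
    have c1 := cliffMod _ h1
    have c2 := cliffMod _ hσ
    split_ifs with he
    · rw [finrank_vac_tensor_eq_of_eq c1 c2 (F_symm _) hF w hadd hc hodd p (p + 1), sub_self,
        Int.cast_zero]
    -- In odd rank the coefficient is a residue modulo `2`, so evenness of the vacuum dimension is
    -- what is required.
    · have hev := even_finrank_vac_tensor_of_eq c1 c2 (F_symm _) (F_symm _) hF w hadd (F_c_c w he)
        hc hodd p
      have h2 : (if Even (T.rk ν) then 0 else 2) = 2 := if_neg he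
      rw [h2]
      obtain ⟨n, hn⟩ := hev
      rw [hn, ← two_mul]
      push_cast
      rw [show (2 : ZMod 2) = 0 from rfl, zero_mul]
  · have h0 := wt_verma_eq_bot hσ hν
    have hsub : Subsingleton (wt (T.res (T.verma (C l).rep)) ν).1 := by
      rw [h0]; infer_instance
    simp [Module.finrank_zero_of_subsingleton]

end TriangularDatum

namespace TriangularDatum

variable {𝔤 : Type u} [AddCommGroup 𝔤] [Module ℂ 𝔤] [LieSuperalgebra 𝔤] {T : TriangularDatum 𝔤}
  {V : Type u} [AddCommGroup V] [Module ℂ V] {V' : Type u} [AddCommGroup V'] [Module ℂ V']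
  {V'' : Type u} [AddCommGroup V''] [Module ℂ V'']

/-! ### Weight modules -/

/-- Weight modules with finite-dimensional weight spaces and weights `≤ l`. -/
structure WtMod (ρ : SuperRep T.𝔥 V) (l : T.Wt) : Prop where
  diagonal : ⨆ ν : T.Wt, (wt ρ ν).1 = ⊤
  finite_wt : ∀ ν : T.Wt, FiniteDimensional ℂ (wt ρ ν).1
  le : ∀ ν : T.Wt, (wt ρ ν).1 ≠ ⊥ → T.le ν l

variable {ρ : SuperRep T.𝔥 V} {σ : SuperRep T.𝔥 V'} {τ : SuperRep T.𝔥 V''} {l : T.Wt}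
  {f : V →ₗ[ℂ] V'} {g : V' →ₗ[ℂ] V''}

theorem exists_wt_lift (hf : ρ.IsHom σ f) (hs : Function.Surjective f)
    (htop : ⨆ ν : T.Wt, (wt ρ ν).1 = ⊤) {ν : T.Wt} {v : V'} (hv : v ∈ (wt σ ν).1) :
    ∃ u ∈ (wt ρ ν).1, f u = v :=
  exists_eig_lift (f := fun t : T.𝔱 => ρ.act ⟨t, T.𝔱_le_𝔥 t.2⟩)
    (f' := fun t : T.𝔱 => σ.act ⟨t, T.𝔱_le_𝔥 t.2⟩) (fun _ v => hf.2 _ v) hs htop hv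

theorem mem_wt_of_injective (hf : ρ.IsHom σ f) (hi : Function.Injective f) {ν : T.Wt} {v : V}
    (hv : f v ∈ (wt σ ν).1) : v ∈ (wt ρ ν).1 := fun t => hi (by rw [hf.2, hv t, map_smul])

theorem WtMod.of_injective (h : WtMod σ l) (hf : ρ.IsHom σ f) (hi : Function.Injective f) :
    WtMod ρ l := by
  refine ⟨eq_top_iff.2 fun v _ => ?_, fun ν => ?_, fun ν hν => h.le ν fun hb => hν ?_⟩
  · have hv : f v ∈ ⨆ ν ∈ (Set.univ : Set T.Wt),
        eig (fun t : T.𝔱 => σ.act ⟨t, T.𝔱_le_𝔥 t.2⟩) ν := by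
      simp only [Set.mem_univ, iSup_pos]
      exact h.diagonal.ge trivial
    have h2 := mem_iSup_inf_of_stable (W := LinearMap.range f)
      (fun t u hu => hf.range.2 _ u hu) hv ⟨v, rfl⟩
    have h3 : (⨆ ν ∈ (Set.univ : Set T.Wt), eig (fun t : T.𝔱 => σ.act ⟨t, T.𝔱_le_𝔥 t.2⟩) ν ⊓
        LinearMap.range f) ≤ (⨆ ν : T.Wt, (wt ρ ν).1).map f := by
      refine iSup₂_le fun ν _ => ?_
      rintro _ ⟨hu, ⟨u, rfl⟩⟩
      exact ⟨u, (le_iSup (fun ν : T.Wt => (wt ρ ν).1) ν) (mem_wt_of_injective hf hi hu), rfl⟩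
    obtain ⟨u, hu, e⟩ := h3 h2
    rwa [← hi e]
  · have := h.finite_wt ν
    exact FiniteDimensional.of_injective (f.restrict (p := (wt ρ ν).1) (q := (wt σ ν).1)
      fun v hv => IsHom.map_wt hf hv) fun a b hab => Subtype.ext (hi (congrArg Subtype.val hab))
  · rw [eq_bot_iff]
    intro v hv
    have := IsHom.map_wt hf hv
    rw [hb] at this
    exact hi (this.trans (map_zero f).symm)

theorem WtMod.of_surjective (h : WtMod ρ l) (hf : ρ.IsHom σ f) (hs : Function.Surjective f) :
    WtMod σ l := by
  refine ⟨eq_top_iff.2 fun v _ => ?_, fun ν => ?_, fun ν hν => h.le ν fun hb => hν ?_⟩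
  · obtain ⟨u, rfl⟩ := hs v
    have : (⨆ ν : T.Wt, (wt ρ ν).1) ≤ (⨆ ν : T.Wt, (wt σ ν).1).comap f :=
      iSup_le fun ν u hu => (le_iSup (fun ν : T.Wt => (wt σ ν).1) ν) (IsHom.map_wt hf hu)
    exact this (h.diagonal.ge trivial)
  · have := h.finite_wt ν
    refine FiniteDimensional.of_surjective (f.restrict (p := (wt ρ ν).1) (q := (wt σ ν).1)
      fun v hv => IsHom.map_wt hf hv) fun v => ?_
    obtain ⟨u, hu, e⟩ := exists_wt_lift hf hs h.diagonal v.2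
    exact ⟨⟨u, hu⟩, Subtype.ext e⟩
  · rw [eq_bot_iff]
    intro v hv
    obtain ⟨u, hu, rfl⟩ := exists_wt_lift hf hs h.diagonal hv
    rw [hb] at hu
    rw [(Submodule.mem_bot ℂ).1 hu, map_zero]
    exact zero_mem _

theorem IsHom.restrict_wt (hf : ρ.IsHom σ f) (ν : T.Wt) :
    (ρ.sub (wt ρ ν)).IsHom (σ.sub (wt σ ν))
      (f.restrict (p := (wt ρ ν).1) (q := (wt σ ν).1) fun _ hv => IsHom.map_wt hf hv) :=
  ⟨fun v => Subtype.ext (hf.1 v), fun x v => Subtype.ext (hf.2 x v)⟩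

variable (C : ∀ l : T.Wt, T.SimpleMod l)

/-- Weight spaces are exact on diagonalizable modules and vacuum vectors are exact on Clifford
modules. -/
theorem sch_add (h : WtMod σ l) (hf : ρ.IsHom σ f) (hg : σ.IsHom τ g) (hi : Function.Injective f)
    (hs : Function.Surjective g) (hfg : LinearMap.range f = LinearMap.ker g) (ν : T.Wt) :
    sch C σ ν = sch C ρ ν + sch C τ ν := by
  have f1 := h.finite_wt ν
  have f2 := (h.of_injective hf hi).finite_wt ν
  have f3 := (h.of_surjective hg hs).finite_wt ν
  obtain ⟨w⟩ := nonempty_wittData (T.F ν) (F_symm ν)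
  obtain ⟨p, hp⟩ := exists_sch_eq C w
  have key : ∀ p, finrank ℂ (hvac w (σ.sub (wt σ ν)) p) =
      finrank ℂ (hvac w (ρ.sub (wt ρ ν)) p) + finrank ℂ (hvac w (τ.sub (wt τ ν)) p) := by
    refine fun p => w.finrank_vac_exact
      (cliffMod (σ.sub (wt σ ν)) (wt_sub_eq_top _ le_rfl))
      (cliffMod (τ.sub (wt τ ν)) (wt_sub_eq_top _ le_rfl)) _ _
      (IsHom.restrict_wt hf ν).1 (fun x v => (IsHom.restrict_wt hf ν).2 _ v)
      (IsHom.restrict_wt hg ν).1 (fun x v => (IsHom.restrict_wt hg ν).2 _ v)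
      (fun a b hab => Subtype.ext (hi (congrArg Subtype.val hab))) (fun v => ?_) ?_ p
    · obtain ⟨u, hu, e⟩ := exists_wt_lift hg hs h.diagonal v.2
      exact ⟨⟨u, hu⟩, Subtype.ext e⟩
    · ext v
      rw [LinearMap.mem_ker]
      have hv : (v : V') ∈ LinearMap.range f ↔ g v = 0 := by rw [hfg, LinearMap.mem_ker]
      constructor
      · rintro ⟨u, rfl⟩
        exact Subtype.ext (hv.1 ⟨u, rfl⟩)
      · intro h0
        obtain ⟨u, hu⟩ := hv.2 (congrArg Subtype.val h0)
        exact ⟨⟨u, mem_wt_of_injective hf hi (hu ▸ v.2)⟩, Subtype.ext hu⟩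
  rw [hp, hp, hp, key, key]
  split_ifs <;> push_cast <;> ring

theorem sch_eq_zero_of_wt_eq_bot {ν : T.Wt} (h : (wt ρ ν).1 = ⊥) : sch C ρ ν = 0 := by
  have hsub : Subsingleton (wt ρ ν).1 := by rw [h]; infer_instance
  obtain ⟨w⟩ := nonempty_wittData (T.F ν) (F_symm ν)
  obtain ⟨p, hp⟩ := exists_sch_eq C w
  rw [hp]
  simp [Module.finrank_zero_of_subsingleton]

/-- An isomorphism is a short exact sequence with zero third term. -/
theorem sch_iso (h : WtMod ρ l) (e : ρ.Iso σ) (ν : T.Wt) : sch C ρ ν = sch C σ ν := by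
  obtain ⟨e, he⟩ := e
  have hq := sch_add C (τ := ρ.quot ⊤) h he.symm (SuperRep.isHom_mkQ _) e.symm.injective
    (Submodule.mkQ_surjective _) (by
      rw [Submodule.ker_mkQ]; exact LinearMap.range_eq_top.2 e.symm.surjective) ν
  have : Subsingleton (V ⧸ (⊤ : ρ.Sub).1) :=
    inferInstanceAs (Subsingleton (V ⧸ (⊤ : Submodule ℂ V)))
  rw [hq, sch_eq_zero_of_wt_eq_bot C (ρ := ρ.quot ⊤) Submodule.eq_bot_of_subsingleton, add_zero]

/-- The parity shift exchanges the two vacuum spaces. In even rank this negates the coefficient, in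
odd rank the two dimensions agree. -/
theorem sch_shift_eq_zero {ν : T.Wt} [FiniteDimensional ℂ (wt ρ ν).1] (h : sch C ρ ν = 0) :
    sch C ρ.shift ν = 0 := by
  obtain ⟨w⟩ := nonempty_wittData (T.F ν) (F_symm ν)
  obtain ⟨p, hp⟩ := exists_sch_eq C w
  have : FiniteDimensional ℂ (wt ρ.shift ν).1 := ‹FiniteDimensional ℂ (wt ρ ν).1›
  have hsh : ∀ p, finrank ℂ (hvac w (ρ.shift.sub (wt ρ.shift ν)) (p + 1)) =
      finrank ℂ (hvac w (ρ.sub (wt ρ ν)) p) := fun p =>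
    congrArg (fun S : Submodule ℂ (wt ρ ν).1 => finrank ℂ S) (hvac_shift w (ρ.sub (wt ρ ν)) p)
  have h1 : (p + 1) + 1 = p := by rw [add_assoc, show (1 : ZMod 2) + 1 = 0 from rfl, add_zero]
  have hsh' : finrank ℂ (hvac w (ρ.shift.sub (wt ρ.shift ν)) p) =
      finrank ℂ (hvac w (ρ.sub (wt ρ ν)) (p + 1)) := by
    rw [← hsh, h1]
  rw [hp] at h ⊢
  rw [hsh, hsh']
  split_ifs at h ⊢ with he
  · rw [← neg_sub, Int.cast_neg, h, neg_zero]
  · have hc : CliffMod (T.F ν) _ _ := cliffMod (ρ.sub (wt ρ ν)) (wt_sub_eq_top _ le_rfl)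
    have e := hc.finrank_vac_eq_of_trace w
      (hc.trace_par_mul_proj_of_odd w (F_c_c w he)) p (p + 1)
    have e' : finrank ℂ (hvac w (ρ.sub (wt ρ ν)) p) =
      finrank ℂ (hvac w (ρ.sub (wt ρ ν)) (p + 1)) := e
    rw [← e']
    exact h

end TriangularDatum

namespace TriangularDatum

variable {𝔤 : Type u} [AddCommGroup 𝔤] [Module ℂ 𝔤] [LieSuperalgebra 𝔤] {T : TriangularDatum 𝔤}
  {V : Type u} [AddCommGroup V] [Module ℂ V] {V' : Type u} [AddCommGroup V'] [Module ℂ V']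
  {ρ : SuperRep 𝔤 V} {ρ' : SuperRep 𝔤 V'}

theorem isHom_res {f : V →ₗ[ℂ] V'} (hf : ρ.IsHom ρ' f) : (T.res ρ).IsHom (T.res ρ') f :=
  ⟨hf.1, fun x v => hf.2 x v⟩

theorem iso_res (h : ρ.Iso ρ') : (T.res ρ).Iso (T.res ρ') := by
  obtain ⟨e, he⟩ := h
  exact ⟨e, isHom_res he⟩

/-! ### Simple `𝔥`-modules -/

/-- A vacuum vector has one of only two parities, and a shift brings those of `τ` to the parity of
those of `σ`. -/
theorem isoUpToShift_of_isSimple {σ : SuperRep T.𝔥 V} {τ : SuperRep T.𝔥 V'} (hσ : σ.IsSimple)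
    (hτ : τ.IsSimple) {ν : T.Wt} (hσν : (wt σ ν).1 = ⊤) (hτν : (wt τ ν).1 = ⊤) :
    σ.IsoUpToShift τ := by
  obtain ⟨w⟩ := nonempty_wittData (T.F ν) (F_symm ν)
  obtain ⟨p, hp⟩ := exists_hvac_ne_bot hσ hσν w
  obtain ⟨q, hq⟩ := exists_hvac_ne_bot hτ hτν w
  by_cases h : p = q
  · subst h
    exact Or.inl (iso_of_hvac hσ hτ hσν hτν w hp hq)
  · have h' : p = q + 1 := by
      have key : ∀ p q : ZMod 2, p ≠ q → p = q + 1 := by decide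
      exact key p q h
    subst h'
    exact Or.inr (iso_of_hvac hσ hτ.shift hσν hτν w hp (by rwa [hvac_shift]))

theorem exists_simple_sub {σ : SuperRep T.𝔥 V} [FiniteDimensional ℂ V] [Nontrivial V] :
    ∃ A : σ.Sub, (σ.sub A).IsSimple := by
  have hwf : WellFoundedLT σ.Sub := by
    have : WellFoundedLT (Submodule ℂ V) := inferInstance
    exact ⟨InvImage.wf (fun A : σ.Sub => A.1) this.wf⟩
  have hlt : (⊥ : σ.Sub) < ⊤ := by
    rw [bot_lt_iff_ne_bot]
    intro h
    exact bot_ne_top (α := Submodule ℂ V) (congrArg Subtype.val h).symm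
  obtain ⟨A, hA, -⟩ := exists_covBy_le_of_lt hlt
  refine ⟨A, SuperRep.Iso.isSimple (σ := σ.sub A) ?_ (SuperRep.isSimple_sq hA)⟩
  refine SuperRep.FactorIso.iso (SuperRep.factorIso_sq hA.le)
    ⟨hA.le, LinearMap.id, ⟨fun _ => rfl, fun _ _ => rfl⟩, Function.surjective_id, fun v => ?_⟩
  change v = 0 ↔ (v : V) ∈ (⊥ : Submodule ℂ V)
  rw [Submodule.mem_bot]
  exact Subtype.ext_iff

/-! ### The modules `M(λ)` -/

section HighestWeight

variable {l : T.Wt} (C : T.SimpleMod l)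

/-- The embedding of `C(λ)` into `M(λ)`. -/
def hw : C.carrier →ₗ[ℂ] ((U 𝔤 ⊗[ℂ] C.carrier) ⧸ (T.indSub C.rep).1) :=
  (T.vermaEquiv C.rep).toLinearMap ∘ₗ TensorProduct.mk ℂ (U T.nneg) C.carrier 1

theorem hw_eq (v : C.carrier) : hw C v = (T.indSub C.rep).1.mkQ (1 ⊗ₜ v) := by
  change T.ofVerma _ (1 ⊗ₜ v) = _
  rw [ofVerma_tmul, map_one]

theorem isHom_hw : C.rep.IsHom (T.res (M C)) (hw C) :=
  SuperRep.IsHom.comp (isHom_res (T.isHom_vermaEquiv C.rep)) (T.isHom_one C.rep)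

theorem isHom_vermaEquiv_symm :
    (M C).IsHom (T.verma C.rep) (T.vermaEquiv C.rep).symm.toLinearMap :=
  (T.isHom_vermaEquiv C.rep).symm

theorem wtMod_M : WtMod (T.res (M C)) l := by
  have := IsSimple.finiteDimensional C.simple C.weight
  have h : WtMod (T.res (T.verma C.rep)) l :=
    ⟨iSup_wt_verma C.weight, finiteDimensional_wt_verma C.weight, fun ν hν => by
      by_contra hc
      exact hν (wt_verma_eq_bot C.weight hc)⟩
  exact h.of_injective (isHom_res (isHom_vermaEquiv_symm C)) (LinearEquiv.injective _)

theorem wt_M_top : (wt (T.res (M C)) l).1 = LinearMap.range (hw C) := by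
  ext v
  rw [hw, LinearMap.range_comp, ← wt_verma_top C.weight]
  constructor
  · intro hv
    exact ⟨_, IsHom.map_wt (isHom_res (isHom_vermaEquiv_symm C)) hv,
      (T.vermaEquiv C.rep).apply_symm_apply v⟩
  · rintro ⟨u, hu, rfl⟩
    exact IsHom.map_wt (isHom_res (T.isHom_vermaEquiv C.rep)) hu

theorem eq_top_of_hw_mem {W : (M C).Sub} (h : ∀ v, hw C v ∈ W.1) : W = ⊤ := by
  refine Subtype.ext (eq_top_iff.2 fun w _ => ?_)
  rw [← (T.vermaEquiv C.rep).apply_symm_apply w]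
  refine lmul_induction (S := W.1.comap (T.vermaEquiv C.rep).toLinearMap) h
    (fun i y _ w hw => ?_) _
  change T.ofVerma C.rep (lmul y w) ∈ W.1
  rw [ofVerma_lmul]
  exact W.2.2 _ _ hw

/-- The augmentation `ε` of `U(𝔫⁻)`, which kills `𝔫⁻`, provides a left inverse of `v ↦ 1 ⊗ v`. -/
theorem hw_injective : Function.Injective (hw C) := by
  refine (T.vermaEquiv C.rep).injective.comp ?_
  let ε : U T.nneg →ₐ[ℂ] End ℂ C.carrier := Ulift 0 (by simp)
  exact Function.LeftInverse.injective (g := TensorProduct.lift ε.toLinearMap) fun v => by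
    rw [TensorProduct.mk_apply, TensorProduct.lift.tmul, AlgHom.toLinearMap_apply, map_one]
    rfl

theorem wt_M_ne_bot : (wt (T.res (M C)) l).1 ≠ ⊥ := by
  intro h
  have := C.simple.1
  rw [wt_M_top, LinearMap.range_eq_bot] at h
  obtain ⟨v, hv⟩ := exists_ne (0 : C.carrier)
  exact hv (hw_injective C (by rw [h]; rfl))

/-- A submodule is the sum of its weight components. Its part in the top weight space is an
`𝔥`-submodule of the simple `C(λ)`: if it were everything it would generate `M(λ)`, so it is zero.
Consequently the sum of all proper submodules is still proper. -/
theorem le_iSup_wt_of_ne_top {W : (M C).Sub} (hW : W ≠ ⊤) :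
    W.1 ≤ ⨆ ν ∈ ({l}ᶜ : Set T.Wt), (wt (T.res (M C)) ν).1 := by
  have h0 : ∀ v ∈ (wt (T.res (M C)) l).1, v ∈ W.1 → v = 0 := by
    have hinv : (W.1.comap (hw C)) = ⊥ := by
      refine (C.simple.2 ⟨_, (isHom_hw C).comap (W := W.1) ⟨W.2.1, fun x => W.2.2 x⟩⟩).resolve_right
        fun ht => hW (eq_top_of_hw_mem C fun v => ?_)
      have : v ∈ W.1.comap (hw C) := ht.ge trivial
      exact this
    intro v hv hvW
    rw [wt_M_top] at hv
    obtain ⟨u, rfl⟩ := hv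
    have : u ∈ W.1.comap (hw C) := hvW
    rw [hinv] at this
    rw [(Submodule.mem_bot ℂ).1 this, map_zero]
  intro v hv
  have hv' : v ∈ ⨆ ν ∈ (Set.univ : Set T.Wt),
      eig (fun t : T.𝔱 => (T.res (M C)).act ⟨t, T.𝔱_le_𝔥 t.2⟩) ν := by
    simp only [Set.mem_univ, iSup_pos]
    exact (wtMod_M C).diagonal.ge trivial
  have h2 := mem_iSup_inf_of_stable (W := W.1) (fun t u hu => W.2.2 _ u hu) hv' hv
  refine (iSup₂_le fun ν _ u hu => ?_ : _ ≤ ⨆ ν ∈ ({l}ᶜ : Set T.Wt), (wt (T.res (M C)) ν).1) h2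
  by_cases hν : ν = l
  · subst hν
    rw [h0 u hu.1 hu.2]
    exact zero_mem _
  · exact (le_iSup₂_of_le ν hν le_rfl : (wt (T.res (M C)) ν).1 ≤ _) hu.1

theorem radical_le_iSup :
    (M C).radical.1 ≤ ⨆ ν ∈ ({l}ᶜ : Set T.Wt), (wt (T.res (M C)) ν).1 :=
  sSup_le fun W hW => le_iSup_wt_of_ne_top C (W := ⟨W, hW.1⟩)
    fun h => hW.2 (congrArg Subtype.val h)

theorem wt_radical {v} (hv : v ∈ (M C).radical.1) (hv' : v ∈ (wt (T.res (M C)) l).1) : v = 0 :=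
  eq_zero_of_mem_eig (S := {l}ᶜ) (f := fun t : T.𝔱 => (T.res (M C)).act ⟨t, T.𝔱_le_𝔥 t.2⟩)
    (by simp) (radical_le_iSup C hv) hv'

theorem radical_ne_top : (M C).radical ≠ ⊤ := by
  intro h
  refine wt_M_ne_bot C (eq_bot_iff.2 fun v hv => ?_)
  exact wt_radical C (h.ge (trivial : v ∈ (⊤ : Submodule ℂ _))) hv

theorem le_radical {W : (M C).Sub} (hW : W ≠ ⊤) : W ≤ (M C).radical :=
  show W.1 ≤ sSup {W | (M C).Invariant W ∧ W ≠ ⊤} from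
    le_sSup ⟨W.2, fun h => hW (Subtype.ext h)⟩

theorem wt_L_ne_bot : (wt (T.res (L C)) l).1 ≠ ⊥ := by
  intro h
  refine wt_M_ne_bot C (eq_bot_iff.2 fun v hv => wt_radical C ?_ hv)
  have := IsHom.map_wt (isHom_res (SuperRep.isHom_mkQ (M C).radical)) hv
  rw [h] at this
  exact (Submodule.Quotient.mk_eq_zero _).1 this

/-- The induced map `F` from `M(λ)` is onto by simplicity, and its kernel lies in the radical. The
image of the radical is zero or everything; the latter would force the radical to be all of `M(λ)`.
-/
theorem iso_L_of_isHom (hs : ρ.IsSimple) {f : C.carrier →ₗ[ℂ] V} (hf : C.rep.IsHom (T.res ρ) f)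
    (hp : ∀ x ∈ T.npos, ∀ v, ρ.act x (f v) = 0) (hf0 : f ≠ 0) : ρ.Iso (L C) := by
  set F := indLift hf hp
  have hF : (M C).IsHom ρ F := isHom_indLift hf hp
  have hsurj : LinearMap.range F = ⊤ := by
    refine (hs.2 ⟨_, hF.range⟩).resolve_left fun h => hf0 ?_
    ext v
    have : F (hw C v) = 0 := by
      have hm : F (hw C v) ∈ LinearMap.range F := ⟨_, rfl⟩
      rw [show LinearMap.range F = ⊥ from h] at hm
      exact hm
    rw [hw_eq, indLift_mk, map_one] at this
    exact this
  have hs' := hs.1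
  have hker : (⟨_, hF.ker⟩ : (M C).Sub) ≠ ⊤ := by
    intro h
    have h0 : F = 0 := LinearMap.ker_eq_top.1 (congrArg Subtype.val h)
    rw [h0, LinearMap.range_zero] at hsurj
    exact bot_ne_top hsurj
  have hle := le_radical C hker
  have hrad : (M C).radical.1.map F = ⊥ := by
    refine (hs.2 ⟨_, hF.map (M C).radical.2⟩).resolve_right fun h => radical_ne_top C ?_
    refine Subtype.ext (eq_top_iff.2 fun v _ => ?_)
    have : F v ∈ (M C).radical.1.map F := by
      rw [show (M C).radical.1.map F = ⊤ from h]; trivial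
    obtain ⟨u, hu, e⟩ := this
    have : v - u ∈ (M C).radical.1 := hle (by
      change F (v - u) = 0
      rw [map_sub, e, sub_self])
    simpa using add_mem this hu
  refine SuperRep.iso_of_ker_eq hF (SuperRep.isHom_mkQ _) (LinearMap.range_eq_top.1 hsurj)
    (Submodule.mkQ_surjective _) ?_
  rw [Submodule.ker_mkQ]
  exact le_antisymm hle fun v hv => (Submodule.eq_bot_iff _).1 hrad _ ⟨v, hv, rfl⟩

end HighestWeight

/-! ### Simple weight modules -/

theorem act_mem_wt {α ν : T.Wt} {x : 𝔤} (hx : x ∈ wtSpace T.𝔱 α) {v : V}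
    (hv : v ∈ (wt (T.res ρ) ν).1) : ρ.act x v ∈ (wt (T.res ρ) (α + ν)).1 := by
  intro t
  change ρ.act (t : 𝔤) (ρ.act x v) = _
  have h : ρ.act (t : 𝔤) (ρ.act x v) = ρ.act x (ρ.act (t : 𝔤) v) + ρ.act (br (t : 𝔤) x) v := by
    refine homog_induction (S := LinearMap.eqLocus (ρ.act (t : 𝔤) ∘ₗ ρ.act.flip v)
      (ρ.act.flip (ρ.act (t : 𝔤) v) + ρ.act.flip v ∘ₗ br (t : 𝔤))) (fun i x hx => ?_) x
    have := ρ.act_br 0 i t (T.toral.le_even t.2) x hx v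
    simp only [sgn, zero_ne_one, false_and, if_false, one_smul] at this
    change ρ.act (t : 𝔤) (ρ.act x v) = ρ.act x (ρ.act (t : 𝔤) v) + ρ.act (br (t : 𝔤) x) v
    rw [this]
    abel
  have hv' : ρ.act (t : 𝔤) v = ν t • v := hv t
  rw [h, hx t, hv', map_smul, map_smul, LinearMap.smul_apply, LinearMap.add_apply, add_smul,
    add_comm]

/-- By (A1) only finitely many values of `γ` lie above that of a given weight, so some weight has
maximal value; positive roots raise the value and must annihilate its weight space. -/
theorem exists_highest_weight (hA : T.A1) {l : T.Wt} (h : WtMod (T.res ρ) l) [Nontrivial V] :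
    ∃ μ : T.Wt, (wt (T.res ρ) μ).1 ≠ ⊥ ∧
      ∀ x ∈ T.npos, ∀ v ∈ (wt (T.res ρ) μ).1, ρ.act x v = 0 := by
  obtain ⟨μ₀, hμ₀⟩ : ∃ μ : T.Wt, (wt (T.res ρ) μ).1 ≠ ⊥ := by
    by_contra! hc
    have := h.diagonal
    simp only [hc, iSup_bot] at this
    exact bot_ne_top this
  have hle₀ := h.le _ hμ₀
  obtain ⟨k₀, -⟩ := T.mem_Qneg hle₀
  let S : Set ℝ := {r | T.γ ⟨μ₀ - l, k₀⟩ ≤ r ∧ ∃ μ : T.Wt, (wt (T.res ρ) μ).1 ≠ ⊥ ∧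
    ∃ k : μ - l ∈ AddSubgroup.closure (roots T.𝔱), T.γ ⟨μ - l, k⟩ = r}
  have hfin : S.Finite := (hA (T.γ ⟨μ₀ - l, k₀⟩)).subset (by
    rintro r ⟨hr, μ, hμ, k, hk⟩
    exact ⟨hr, ⟨μ - l, k⟩, h.le _ hμ, hk⟩)
  obtain ⟨r, ⟨hr, μ, hμ, k, hk⟩, hmax⟩ := Set.exists_max_image S id hfin
    ⟨_, le_rfl, μ₀, hμ₀, k₀, rfl⟩
  refine ⟨μ, hμ, fun x hx v hv => ?_⟩
  have hle : T.npos ≤ LinearMap.ker (ρ.act.flip v) := by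
    refine iSup₂_le fun α hα x hx => ?_
    obtain ⟨hα, hpos⟩ := hα
    by_contra h0
    have hv' := act_mem_wt hx hv
    have hne : (wt (T.res ρ) (α + μ)).1 ≠ ⊥ := fun hb => h0 (by
      rw [hb] at hv'
      exact hv')
    have hk' : α + μ - l ∈ AddSubgroup.closure (roots T.𝔱) := by
      rw [add_sub_assoc]
      exact add_mem (AddSubgroup.subset_closure hα) k
    have hsum : T.γ ⟨α + μ - l, hk'⟩ = T.γ ⟨α, AddSubgroup.subset_closure hα⟩ + r := by
      rw [← hk, ← map_add]
      exact congrArg T.γ (Subtype.ext (add_sub_assoc _ _ _))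
    have := hmax (T.γ ⟨α + μ - l, hk'⟩) ⟨by rw [hsum]; linarith, _, hne, hk', rfl⟩
    rw [id, id, hsum] at this
    linarith
  exact hle hx

/-- A highest weight space is killed by `𝔫⁺` and contains a simple `𝔥`-submodule, which is `C(μ)` up
to shift. The inclusion then extends to a map from `M(μ)`. -/
theorem isoUpToShift_L (hA : T.A1) (C : ∀ l : T.Wt, T.SimpleMod l) {l : T.Wt}
    (h : WtMod (T.res ρ) l) (hs : ρ.IsSimple) :
    ∃ μ : T.Wt, T.le μ l ∧ ρ.IsoUpToShift (L (C μ)) := by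
  have := hs.1
  obtain ⟨μ, hμ, hp⟩ := exists_highest_weight hA h
  refine ⟨μ, h.le μ hμ, ?_⟩
  have := h.finite_wt μ
  have := (Submodule.nontrivial_iff_ne_bot).2 hμ
  set σ := (T.res ρ).sub (wt (T.res ρ) μ)
  obtain ⟨A, hA⟩ := exists_simple_sub (σ := σ)
  have hσ : (wt σ μ).1 = ⊤ := wt_sub_eq_top _ le_rfl
  have hAμ : (wt (σ.sub A) μ).1 = ⊤ := wt_sub_eq_top _ (fun v _ => by rw [hσ]; trivial)
  let i : A.1 →ₗ[ℂ] V := (wt (T.res ρ) μ).1.subtype ∘ₗ A.1.subtype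
  have hi : (σ.sub A).IsHom (T.res ρ) i := ⟨fun _ => rfl, fun _ _ => rfl⟩
  have hi0 : Function.Injective i :=
    (Submodule.injective_subtype _).comp (Submodule.injective_subtype _)
  have hip : ∀ x ∈ T.npos, ∀ v, ρ.act x (i v) = 0 := fun x hx v => hp x hx _ v.1.2
  have hC := (C μ).simple.1
  have hne : ∀ e : A.1 ≃ₗ[ℂ] (C μ).carrier, i ∘ₗ e.symm.toLinearMap ≠ 0 := by
    intro e h0
    obtain ⟨v, hv⟩ := exists_ne (0 : (C μ).carrier)
    have : i (e.symm v) = 0 := LinearMap.congr_fun h0 v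
    rw [← map_zero i] at this
    exact hv (by simpa using hi0 this)
  rcases isoUpToShift_of_isSimple hA (C μ).simple hAμ (C μ).weight with ⟨e, he⟩ | ⟨e, he⟩
  · exact Or.inl (iso_L_of_isHom (C μ) hs (hi.comp he.symm) (fun x hx v => hip x hx _) (hne e))
  · right
    have h1 : (C μ).rep.IsHom (T.res ρ.shift) (i ∘ₗ e.symm.toLinearMap) := by
      have := (hi.comp he.symm).shift
      rwa [SuperRep.shift_shift] at this
    have h2 := (iso_L_of_isHom (C μ) hs.shift h1 (fun x hx v => hip x hx _) (hne e)).shift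
    rwa [SuperRep.shift_shift] at h2

end TriangularDatum

/-! ### Modular lattices with a composition series -/

section Series

variable {α : Type*} [Lattice α] [BoundedOrder α] [IsModularLattice α] {n : ℕ} {W : Fin (n + 1) → α}

/-- The jumps of the chain `W i ⊓ x`. -/
def jumps (W : Fin (n + 1) → α) (x : α) : Set (Fin n) :=
  {i | ¬ W i.succ ⊓ x ≤ W i.castSucc}

/-- A larger element has at least the same jumps. If the jumps of `x ≤ y` coincide, then `W i ⊓ y ≤
x` for all `i` by induction: at a jump `W (i + 1)` is the join of `W i` and `W (i + 1) ⊓ x`, and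
modularity gives the step. So chains are bounded by the length of the series. -/
theorem jumps_strictMono (h0 : W 0 = ⊥) (h1 : W (Fin.last n) = ⊤)
    (hW : ∀ i : Fin n, W i.castSucc ⋖ W i.succ) : StrictMono (jumps W) := by
  intro x y hxy
  have hsub : jumps W x ⊆ jumps W y := fun i hi h => hi ((inf_le_inf_left _ hxy.le).trans h)
  refine hsub.ssubset_of_ne fun heq => hxy.not_ge ?_
  have key : ∀ i : Fin (n + 1), W i ⊓ y ≤ x := by
    intro i
    induction i using Fin.induction with
    | zero => rw [h0]; exact inf_le_left.trans bot_le
    | succ i ih =>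
      by_cases hi : i ∈ jumps W y
      · rw [← heq] at hi
        have hlt : W i.castSucc < W i.castSucc ⊔ W i.succ ⊓ x := by
          rw [left_lt_sup]; exact hi
        have hle : W i.castSucc ⊔ W i.succ ⊓ x ≤ W i.succ := sup_le (hW i).le inf_le_left
        have he : W i.castSucc ⊔ W i.succ ⊓ x = W i.succ :=
          (hle.lt_or_eq.resolve_left ((hW i).2 hlt))
        rw [← he, sup_comm, sup_inf_assoc_of_le _ (inf_le_right.trans hxy.le)]
        exact sup_le inf_le_right ih
      · have : W i.succ ⊓ y ≤ W i.castSucc := not_not.1 hi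
        exact (le_inf this inf_le_right).trans ih
  simpa [h1] using key (Fin.last n)

theorem wellFounded_of_series (h0 : W 0 = ⊥) (h1 : W (Fin.last n) = ⊤)
    (hW : ∀ i : Fin n, W i.castSucc ⋖ W i.succ) : WellFoundedLT α ∧ WellFoundedGT α :=
  ⟨(jumps_strictMono h0 h1 hW).wellFoundedLT, (jumps_strictMono h0 h1 hW).wellFoundedGT⟩

end Series

/-! ### Finite length and subquotients of subquotients -/

namespace SuperRep

variable {𝔤 : Type u} [AddCommGroup 𝔤] [Module ℂ 𝔤] [LieSuperalgebra 𝔤]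
  {V : Type u} [AddCommGroup V] [Module ℂ V] {ρ : SuperRep 𝔤 V}
  {V' : Type u} [AddCommGroup V'] [Module ℂ V'] {σ : SuperRep 𝔤 V'}

theorem FiniteLength.wellFounded (h : ρ.FiniteLength) :
    WellFoundedLT ρ.Sub ∧ WellFoundedGT ρ.Sub := by
  obtain ⟨n, W, h0, h1, hW⟩ := h
  exact wellFounded_of_series (Subtype.ext h0) (Subtype.ext h1) hW

/-- A module of length two is generated by a nonzero vector of `W` and one outside `W`. This places
the extensions below in `𝒪`. -/
theorem finGen_of_covBy {W : ρ.Sub} (h0 : ⊥ ⋖ W) (h1 : W ⋖ ⊤) : ρ.FinGen := by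
  classical
  obtain ⟨v, hv, hv0⟩ := SetLike.exists_of_lt (show (⊥ : Submodule ℂ V) < W.1 from h0.lt)
  obtain ⟨u, -, hu⟩ := SetLike.exists_of_lt (show W.1 < (⊤ : Submodule ℂ V) from h1.lt)
  refine ⟨{v, u}, fun X hX => ?_⟩
  have hvX : v ∈ X.1 := hX v (by simp)
  have huX : u ∈ X.1 := hX u (by simp)
  have h2 : W ≤ X := by
    by_contra hc
    have hlt : W ⊓ X < W := inf_lt_left.2 hc
    have hb : ⊥ < W ⊓ X := by
      refine bot_lt_iff_ne_bot.2 fun hb => hv0 ?_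
      have : v ∈ (W ⊓ X).1 := ⟨hv, hvX⟩
      rw [hb] at this
      exact this
    exact h0.2 hb hlt
  have h3 : W < X := lt_of_le_of_ne h2 fun he => hu (he ▸ huX)
  by_contra hX
  exact h1.2 h3 (lt_top_iff_ne_top.2 fun h => hX (congrArg Subtype.val h))

/-- The second isomorphism theorem. -/
theorem sq_iso_sq_sup (A B : ρ.Sub) : (sq (A ⊓ B) B).Iso (sq A (A ⊔ B)) := by
  refine FactorIso.iso (factorIso_sq inf_le_right) ⟨inf_le_right,
    (subSub A (A ⊔ B)).1.mkQ ∘ₗ Submodule.inclusion (le_sup_right : B ≤ A ⊔ B),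
    (isHom_mkQ _).comp (isHom_inclusion _), fun x => ?_, fun v => ?_⟩
  · obtain ⟨⟨x, hx⟩, rfl⟩ := Submodule.mkQ_surjective _ x
    obtain ⟨a, ha, b, hb, rfl⟩ := Submodule.mem_sup.1 (show x ∈ A.1 ⊔ B.1 from hx)
    refine ⟨⟨b, hb⟩, ?_⟩
    refine (Submodule.Quotient.eq _).2 ?_
    change b - (a + b) ∈ A.1
    simpa using ha
  · refine (Submodule.Quotient.mk_eq_zero _).trans ?_
    exact ⟨fun h => ⟨h, v.2⟩, fun h => h.1⟩

/-- The submodule `B / A` of `C / A`. -/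
def sqSub (A B C : ρ.Sub) : (sq A C).Sub := ⟨_, (isHom_mkQ (subSub A C)).map (subSub B C).2⟩

variable {A B C : ρ.Sub}

theorem mkQ_subSub_eq_zero (v : C.1) : (subSub A C).1.mkQ v = 0 ↔ (v : V) ∈ A.1 :=
  Submodule.Quotient.mk_eq_zero _

theorem mkQ_subSub_eq (u v : C.1) :
    (subSub A C).1.mkQ u = (subSub A C).1.mkQ v ↔ (u : V) - v ∈ A.1 :=
  Submodule.Quotient.eq _

theorem mem_sqSub (hAB : A ≤ B) (v : C.1) :
    (subSub A C).1.mkQ v ∈ (sqSub A B C).1 ↔ (v : V) ∈ B.1 := by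
  constructor
  · rintro ⟨u, hu, e⟩
    have h := (mkQ_subSub_eq u v).1 e
    have hu' : (u : V) ∈ B.1 := hu
    simpa using sub_mem hu' (hAB h)
  · intro h
    exact ⟨v, h, rfl⟩

theorem iso_sub_sqSub (hAB : A ≤ B) (hBC : B ≤ C) : (sq A B).Iso ((sq A C).sub (sqSub A B C)) := by
  let f : B.1 →ₗ[ℂ] (sqSub A B C).1 :=
    LinearMap.codRestrict _ ((subSub A C).1.mkQ ∘ₗ Submodule.inclusion hBC)
      fun v => (mem_sqSub hAB _).2 v.2
  refine FactorIso.iso (factorIso_sq hAB)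
    ⟨hAB, f, ⟨fun _ => rfl, fun _ _ => rfl⟩, fun x => ?_, fun v => ?_⟩
  · obtain ⟨x, u, hu, rfl⟩ := x
    exact ⟨⟨u, hu⟩, rfl⟩
  · rw [Subtype.ext_iff]
    exact Submodule.Quotient.mk_eq_zero _

theorem iso_quot_sqSub (hAB : A ≤ B) (hBC : B ≤ C) :
    (sq B C).Iso ((sq A C).quot (sqSub A B C)) := by
  refine FactorIso.iso (factorIso_sq hBC) ⟨hBC, (sqSub A B C).1.mkQ ∘ₗ (subSub A C).1.mkQ,
    (isHom_mkQ _).comp (isHom_mkQ _), (Submodule.mkQ_surjective _).comp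
    (Submodule.mkQ_surjective _), fun v => ?_⟩
  exact (Submodule.Quotient.mk_eq_zero _).trans (mem_sqSub hAB v)

/-- A complement of `B / A` in `C / A` comes from a submodule between `A` and `C`. -/
theorem exists_of_isCompl_sqSub (hAB : A ≤ B) (hBC : B ≤ C) {Y : (sq A C).Sub}
    (hY : IsCompl (sqSub A B C).1 Y.1) : ∃ X : ρ.Sub, A ≤ X ∧ X ⊓ B = A ∧ X ⊔ B = C := by
  let X : ρ.Sub := ⟨(Y.1.comap (subSub A C).1.mkQ).map C.1.subtype,
    (isHom_subtype C).map ((isHom_mkQ (subSub A C)).comap Y.2)⟩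
  have hX : ∀ v : C.1, (v : V) ∈ X.1 ↔ (subSub A C).1.mkQ v ∈ Y.1 := by
    intro v
    constructor
    · rintro ⟨u, hu, e⟩
      rw [← Subtype.ext (a1 := u) (a2 := v) e]
      exact hu
    · intro h
      exact ⟨v, h, rfl⟩
  have hXC : X ≤ C := by rintro _ ⟨u, -, rfl⟩; exact u.2
  have hAX : A ≤ X := by
    intro v hv
    refine (hX ⟨v, hBC (hAB hv)⟩).2 ?_
    rw [(mkQ_subSub_eq_zero ⟨v, hBC (hAB hv)⟩).2 hv]
    exact zero_mem _
  refine ⟨X, hAX, le_antisymm ?_ (le_inf hAX hAB), le_antisymm (sup_le hXC hBC) ?_⟩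
  · rintro v ⟨hv, hvB⟩
    have h1 := (hX ⟨v, hXC hv⟩).1 hv
    have h2 := (mem_sqSub (C := C) hAB ⟨v, hXC hv⟩).2 hvB
    exact (mkQ_subSub_eq_zero ⟨v, hXC hv⟩).1 (Submodule.disjoint_def.1 hY.disjoint _ h2 h1)
  · intro v hv
    have : (subSub A C).1.mkQ ⟨v, hv⟩ ∈ (sqSub A B C).1 ⊔ Y.1 := by
      rw [hY.sup_eq_top]; trivial
    obtain ⟨b, hb, y, hy, e⟩ := Submodule.mem_sup.1 this
    obtain ⟨b, rfl⟩ := Submodule.mkQ_surjective _ b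
    obtain ⟨y, rfl⟩ := Submodule.mkQ_surjective _ y
    rw [← map_add] at e
    have h1 : ((b : V) + y) - v ∈ A.1 := (mkQ_subSub_eq (b + y) ⟨v, hv⟩).1 e
    have h2 : v = (y - ((b : V) + y - v)) + b := by abel
    rw [h2]
    exact Submodule.add_mem_sup (sub_mem ((hX y).2 hy) (hAX h1)) ((mem_sqSub hAB b).1 hb)

theorem bot_covBy_sqSub (hAB : A ⋖ B) (hBC : B ≤ C) : ⊥ ⋖ sqSub A B C := by
  have hs := (iso_sub_sqSub hAB.le hBC).isSimple (isSimple_sq hAB)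
  have := hs.1
  constructor
  · refine bot_lt_iff_ne_bot.2 fun h => ?_
    have := Submodule.nontrivial_iff_ne_bot.1 hs.1
    exact this (congrArg Subtype.val h)
  · intro Y h1 h2
    rcases hs.2 (subSub Y (sqSub A B C)) with h | h
    · refine h1.ne' (Subtype.ext (eq_bot_iff.2 fun v hv => ?_))
      have : (⟨v, h2.le hv⟩ : (sqSub A B C).1) ∈ (subSub Y (sqSub A B C)).1 := hv
      rw [h] at this
      exact congrArg Subtype.val this
    · refine h2.not_ge fun v hv => ?_
      have : (⟨v, hv⟩ : (sqSub A B C).1) ∈ (subSub Y (sqSub A B C)).1 := by rw [h]; trivial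
      exact this

theorem sqSub_covBy_top (hAB : A ≤ B) (hBC : B ⋖ C) : sqSub A B C ⋖ ⊤ := by
  have hs := (iso_quot_sqSub hAB hBC.le).isSimple (isSimple_sq hBC)
  constructor
  · refine lt_top_iff_ne_top.2 fun h => ?_
    exact (Submodule.Quotient.nontrivial_iff.1 hs.1) (congrArg Subtype.val h)
  · intro Y h1 h2
    rcases hs.2 ⟨_, (isHom_mkQ (sqSub A B C)).map Y.2⟩ with h | h
    · refine h1.not_ge fun v hv => ?_
      have : (sqSub A B C).1.mkQ v ∈ Y.1.map (sqSub A B C).1.mkQ := ⟨v, hv, rfl⟩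
      rw [show Y.1.map (sqSub A B C).1.mkQ = ⊥ from h] at this
      exact (Submodule.Quotient.mk_eq_zero _).1 this
    · refine h2.ne (Subtype.ext (eq_top_iff.2 fun v _ => ?_))
      have : (sqSub A B C).1.mkQ v ∈ Y.1.map (sqSub A B C).1.mkQ := by
        rw [show Y.1.map (sqSub A B C).1.mkQ = ⊤ from h]; trivial
      obtain ⟨u, hu, e⟩ := this
      have h3 : u - v ∈ (sqSub A B C).1 := (Submodule.Quotient.eq _).1 e
      have h4 := sub_mem hu (h1.le h3)
      simpa using h4

end SuperRep

open SuperRep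

namespace TriangularDatum

variable {𝔤 : Type u} [AddCommGroup 𝔤] [Module ℂ 𝔤] [LieSuperalgebra 𝔤] {T : TriangularDatum 𝔤}
  {V : Type u} [AddCommGroup V] [Module ℂ V] {ρ : SuperRep 𝔤 V}

/-! ### Composition factors -/

theorem WtMod.sub {l : T.Wt} (h : WtMod (T.res ρ) l) (A : ρ.Sub) : WtMod (T.res (ρ.sub A)) l :=
  h.of_injective (isHom_res (isHom_subtype A)) (Submodule.injective_subtype _)

theorem WtMod.quot {l : T.Wt} (h : WtMod (T.res ρ) l) (A : ρ.Sub) : WtMod (T.res (ρ.quot A)) l :=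
  h.of_surjective (isHom_res (isHom_mkQ A)) (Submodule.mkQ_surjective _)

theorem WtMod.sq {l : T.Wt} (h : WtMod (T.res ρ) l) (A B : ρ.Sub) : WtMod (T.res (sq A B)) l :=
  (h.sub B).quot _

theorem sq_top_iso (A : ρ.Sub) : (SuperRep.sq A ⊤).Iso (ρ.quot A) := by
  refine FactorIso.iso (factorIso_sq le_top) ⟨le_top, A.1.mkQ ∘ₗ
    (⊤ : ρ.Sub).1.subtype, (isHom_mkQ _).comp (isHom_subtype _), fun x => ?_,
    fun v => Submodule.Quotient.mk_eq_zero _⟩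
  obtain ⟨x, rfl⟩ := Submodule.mkQ_surjective _ x
  exact ⟨⟨x, trivial⟩, rfl⟩

theorem sq_iso_of_eq {A B D W : ρ.Sub} (h : D ⊓ B = A) (h' : D ⊔ B = W) :
    (SuperRep.sq A B).Iso (SuperRep.sq D W) := by
  subst h h'
  exact sq_iso_sq_sup D B

theorem wt_sq_eq_bot {l : T.Wt} (h : WtMod (T.res ρ) l) {A B : ρ.Sub} {ν : T.Wt}
    (hB : ∀ v ∈ B.1, v ∈ (wt (T.res ρ) ν).1 → v = 0) :
    (wt (T.res (SuperRep.sq A B)) ν).1 = ⊥ := by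
  refine eq_bot_iff.2 fun v hv => ?_
  obtain ⟨u, hu, rfl⟩ := exists_wt_lift (isHom_res (isHom_mkQ (subSub A B)))
    (Submodule.mkQ_surjective _) (h.sub B).diagonal hv
  have : u = 0 := Subtype.ext (hB _ u.2 (IsHom.map_wt (isHom_res (isHom_subtype B)) hu))
  rw [this, map_zero]
  exact zero_mem _

variable (C : ∀ l : T.Wt, T.SimpleMod l)

theorem sch_sub_eq_add {l : T.Wt} (h : WtMod (T.res ρ) l) {A B : ρ.Sub} (hAB : A ≤ B)
    (ν : T.Wt) : sch C (T.res (ρ.sub B)) ν =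
      sch C (T.res (ρ.sub A)) ν + sch C (T.res (SuperRep.sq A B)) ν :=
  sch_add C (h.sub B) (isHom_res (isHom_inclusion hAB))
    (isHom_res (isHom_mkQ (subSub A B))) (Submodule.inclusion_injective _)
    (Submodule.mkQ_surjective _) (by
      rw [Submodule.ker_mkQ, Submodule.range_inclusion]
      rfl) ν

theorem sch_eq_add_quot {l : T.Wt} (h : WtMod (T.res ρ) l) (A : ρ.Sub)
    (ν : T.Wt) : sch C (T.res ρ) ν = sch C (T.res (ρ.sub A)) ν + sch C (T.res (ρ.quot A)) ν :=
  sch_add C h (isHom_res (isHom_subtype A))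
    (isHom_res (isHom_mkQ A)) (Submodule.injective_subtype _)
    (Submodule.mkQ_surjective _) (by rw [Submodule.ker_mkQ, Submodule.range_subtype]) ν

theorem sch_sub_bot (ν : T.Wt) : sch C (T.res (ρ.sub ⊥)) ν = 0 :=
  sch_eq_zero_of_wt_eq_bot C (eq_bot_iff.2 fun v _ => Subtype.ext ((Submodule.mem_bot ℂ).1 v.2))

/-- The extension is `Z / X` with its submodule `Y / X`; a complement would pull back to a submodule
between `X` and `Z`. -/
theorem linked_of_covBy {l : T.Wt} (h : WtMod (T.res ρ) l) {X Y Z : ρ.Sub} (hXY : X ⋖ Y)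
    (hYZ : Y ⋖ Z) {μ ν : T.Wt} (hμ : (SuperRep.sq X Y).IsoUpToShift (L (C μ)))
    (hν : (SuperRep.sq Y Z).IsoUpToShift (L (C ν)))
    (hns : ¬ ∃ D : ρ.Sub, X ≤ D ∧ D ⊓ Y = X ∧ D ⊔ Y = Z) : Linked C μ ν := by
  refine ⟨_, _, _, SuperRep.sq X Z, sqSub X Y Z, ⟨?_, (h.sq X Z).diagonal, (h.sq X Z).finite_wt,
    {l}, fun ν hν => ⟨l, by simp, (h.sq X Z).le ν hν⟩⟩, ?_, ?_, ?_⟩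
  · exact finGen_of_covBy (bot_covBy_sqSub hXY hYZ.le) (sqSub_covBy_top hXY.le hYZ)
  · exact (iso_sub_sqSub hXY.le hYZ.le).symm.trans_isoUpToShift hμ
  · exact (iso_quot_sqSub hXY.le hYZ.le).symm.trans_isoUpToShift hν
  · rintro ⟨D, hD⟩
    exact hns (exists_of_isCompl_sqSub hXY.le hYZ.le hD)

/-- All composition factors of `M(λ)` belong to the block of `L(λ)`. -/
theorem exists_factor (hA : T.A1) {Λ : Set T.Wt} (hΛ : ∀ μ ν, Linked C μ ν → (μ ∈ Λ ↔ ν ∈ Λ))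
    {l : T.Wt} (hl : l ∈ Λ) (hfl : (M (C l)).FiniteLength) {A B : (M (C l)).Sub} (hAB : A ⋖ B) :
    ∃ μ ∈ Λ, T.le μ l ∧ (SuperRep.sq A B).IsoUpToShift (L (C μ)) := by
  obtain ⟨hlt, hgt⟩ := hfl.wellFounded
  have hM := wtMod_M (C l)
  by_contra hbad
  -- A bad factor with `A` maximal: every factor lying strictly above it belongs to `Λ`.
  obtain ⟨A, ⟨B, hAB, hbad⟩, hmax⟩ := hgt.wf.has_min
    {A : (M (C l)).Sub | ∃ B, A ⋖ B ∧ ¬ ∃ μ ∈ Λ, T.le μ l ∧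
      (SuperRep.sq A B).IsoUpToShift (L (C μ))} ⟨A, B, hAB, hbad⟩
  obtain ⟨μ, hμl, hμ⟩ := isoUpToShift_L hA C (hM.sq A B) (isSimple_sq hAB)
  have hμΛ : μ ∉ Λ := fun h => hbad ⟨μ, h, hμl, hμ⟩
  -- A maximal `W` for which `B / A` splits off from `W / A`, with complement `D / A`. The bad
  -- factor is pushed up in this way until it either becomes a quotient of `M(λ)` or meets a
  -- non-split extension.
  obtain ⟨W, ⟨hBW, D, hAD, hinf, hsup⟩, hWmax⟩ := hgt.wf.has_min
    {W : (M (C l)).Sub | B ≤ W ∧ ∃ D, A ≤ D ∧ D ⊓ B = A ∧ D ⊔ B = W}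
    ⟨B, le_rfl, A, le_rfl, inf_eq_left.2 hAB.le, sup_eq_right.2 hAB.le⟩
  by_cases hW : W = ⊤
  · subst hW
    have hD : D ≠ ⊤ := by
      rintro rfl
      rw [top_inf_eq] at hinf
      exact hAB.ne hinf.symm
    have hDr := le_radical (C l) hD
    by_cases hB : B = ⊤
    · subst hB
      rw [inf_top_eq] at hinf
      have hAr : A = (M (C l)).radical := by
        have h1 : A ≤ (M (C l)).radical := hinf ▸ hDr
        by_contra hne
        exact hAB.2 (lt_of_le_of_ne h1 hne) (lt_top_iff_ne_top.2 (radical_ne_top (C l)))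
      refine hbad ⟨l, hl, ?_, Or.inl ?_⟩
      · unfold TriangularDatum.le
        rw [sub_self]
        exact zero_mem _
      · subst hAr
        exact sq_top_iso _
    -- Two proper submodules would add up to `M(λ)`, although both lie in the radical.
    · have := sup_le hDr (le_radical (C l) hB)
      rw [hsup] at this
      exact radical_ne_top (C l) (top_le_iff.1 this)
  · obtain ⟨W', hWW', -⟩ := exists_covBy_le_of_lt (lt_top_iff_ne_top.2 hW)
    -- By modularity the factor `B / A` reappears as `W / D`, directly below `W' / W`.
    have hDW : D ⋖ W := by
      rw [← hsup]
      refine covBy_sup_of_inf_covBy_right ?_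
      rwa [hinf]
    have hDμ := (sq_iso_of_eq hinf hsup).symm.trans_isoUpToShift hμ
    obtain ⟨ν, hνΛ, -, hν⟩ : ∃ ν ∈ Λ, T.le ν l ∧
        (SuperRep.sq W W').IsoUpToShift (L (C ν)) := by
      by_contra hc
      exact hmax W ⟨W', hWW', hc⟩ (hAB.lt.trans_le hBW)
    -- If `W' / D` splits, its complement `Y` contradicts the maximality of `W`. Otherwise the bad
    -- factor is linked to `W' / W`, which lies in `Λ`.
    by_cases hsplit : ∃ Y : (M (C l)).Sub, D ≤ Y ∧ Y ⊓ W = D ∧ Y ⊔ W = W'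
    · obtain ⟨Y, hDY, hYW, hYW'⟩ := hsplit
      refine hWmax W' ⟨hBW.trans hWW'.le, Y, hAD.trans hDY, ?_, ?_⟩ hWW'.lt
      · rw [← hinf, ← hYW, inf_assoc, inf_eq_right.2 hBW]
      · rw [← hYW', ← hsup, ← sup_assoc, sup_eq_left.2 hDY]
    · exact hμΛ ((hΛ _ _ (linked_of_covBy C hM hDW hWW' hDμ hν hsplit)).2 hνΛ)

/-! ### Supercharacters of the simple modules -/

theorem sch_isoUpToShift {V' : Type u} [AddCommGroup V'] [Module ℂ V'] {ρ' : SuperRep 𝔤 V'}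
    {l : T.Wt} (h : WtMod (T.res ρ) l) (h' : WtMod (T.res ρ') l) (e : ρ.IsoUpToShift ρ') {ν : T.Wt}
    (h0 : sch C (T.res ρ') ν = 0) : sch C (T.res ρ) ν = 0 := by
  rcases e with e | e
  · rw [sch_iso C h (iso_res e), h0]
  · have e' : (T.res ρ'.shift) = (T.res ρ').shift := rfl
    have := h'.finite_wt ν
    rw [sch_iso C h (iso_res e), e', sch_shift_eq_zero C h0]

theorem wt_ne_bot_of_isoUpToShift {V' : Type u} [AddCommGroup V'] [Module ℂ V']
    {ρ' : SuperRep 𝔤 V'} (e : ρ.IsoUpToShift ρ') {ν : T.Wt} (h : (wt (T.res ρ') ν).1 ≠ ⊥) :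
    (wt (T.res ρ) ν).1 ≠ ⊥ := by
  have key : ∀ {τ : SuperRep 𝔤 V'}, ρ.Iso τ → (wt (T.res τ) ν).1 ≠ ⊥ →
      (wt (T.res ρ) ν).1 ≠ ⊥ := by
    rintro τ ⟨e, he⟩ h h0
    refine h (eq_bot_iff.2 fun v hv => ?_)
    have := IsHom.map_wt (isHom_res he.symm) hv
    rw [h0] at this
    exact e.symm.injective (this.trans (map_zero e.symm).symm)
  rcases e with e | e
  · exact key e h
  · exact key e h

theorem wtMod_L {l : T.Wt} : WtMod (T.res (L (C l))) l := (wtMod_M (C l)).quot _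

/-- The number of elements of `γ(Q⁻)` in `[c, ∞)`. -/
def height (T : TriangularDatum 𝔤) (c : ℝ) : ℕ :=
  {r : ℝ | c ≤ r ∧ ∃ ν : AddSubgroup.closure (roots T.𝔱), (ν : T.Wt) ∈ T.Qneg ∧ T.γ ν = r}.ncard

theorem WtMod.mono {l l' : T.Wt} {σ : SuperRep T.𝔥 V} (h : WtMod σ l) (hl : T.le l l') :
    WtMod σ l' :=
  ⟨h.diagonal, h.finite_wt, fun ν hν => by
    have := add_mem (h.le ν hν) hl
    rwa [sub_add_sub_cancel] at this⟩

/-- `M(λ)` has coefficient zero at `ν`, and the factors of its radical have it by induction, so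
additivity leaves zero for `L(λ)`. The induction runs on the number of values of `γ(Q⁻)` that are at
least `γ(ν - λ)`, finite by (A1). -/
theorem sch_L_eq_zero (hA1 : T.A1) (hA2 : T.A2) (hA3 : T.A3 C) {Λ : Set T.Wt}
    (hΛ : ∀ μ ν, Linked C μ ν → (μ ∈ Λ ↔ ν ∈ Λ)) (hc : ∀ l ∈ Λ, T.corank l ≤ 1)
    (hodd : ∀ l ∈ Λ, Odd (finrank ℂ T.𝔥₁) → T.corank l = 0) {ν : T.Wt} (hν : ν ∉ Λ) :
    ∀ l ∈ Λ, sch C (T.res (L (C l))) ν = 0 := by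
  have key : ∀ n, ∀ l ∈ Λ, ∀ h : ν - l ∈ AddSubgroup.closure (roots T.𝔱),
      T.height (T.γ ⟨ν - l, h⟩) = n → sch C (T.res (L (C l))) ν = 0 := by
    intro n
    induction n using Nat.strong_induction_on with
    | _ n ih =>
    intro l hl h hn
    by_cases hle : T.le ν l
    swap
    · refine sch_eq_zero_of_wt_eq_bot C ?_
      by_contra hb
      exact hle ((wtMod_L C).le ν hb)
    have hfl := hA3 l (hc l hl)
    obtain ⟨hlt, hgt⟩ := hfl.wellFounded
    have hM := wtMod_M (C l)
    have hνl : ν ≠ l := fun h => hν (h ▸ hl)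
    have hM0 : sch C (T.res (M (C l))) ν = 0 := by
      rw [sch_iso C hM (iso_res ⟨_, isHom_vermaEquiv_symm (C l)⟩)]
      exact sch_verma_eq_zero C hA2 hνl (hc l hl) (hodd l hl)
    -- Inner induction over the submodules of the radical, well-founded by finite length: one
    -- composition factor is removed at a time.
    have hsub : ∀ X : (M (C l)).Sub, X ≤ (M (C l)).radical → sch C (T.res ((M (C l)).sub X)) ν = 0 := by
      intro X
      induction X using hlt.induction with
      | _ X ihX =>
      intro hX
      by_cases hX0 : X = ⊥
      · subst hX0
        exact sch_sub_bot C ν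
      obtain ⟨A, -, hAX⟩ := exists_le_covBy_of_lt (bot_lt_iff_ne_bot.2 hX0)
      obtain ⟨μ, hμ, hμl, e⟩ := exists_factor C hA1 hΛ hl hfl hAX
      have hadd := sch_sub_eq_add C hM hAX.le ν
      rw [hadd, ihX A hAX.lt (hAX.le.trans hX), zero_add]
      refine sch_isoUpToShift C (hM.sq A X) ((wtMod_L C).mono hμl) e ?_
      -- The radical has no vectors of weight `l`, whereas `L(l)` does.
      have hne : μ ≠ l := by
        rintro rfl
        exact wt_ne_bot_of_isoUpToShift e (wt_L_ne_bot (C μ))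
          (wt_sq_eq_bot hM fun v hv => wt_radical (C μ) (hX hv))
      obtain ⟨k, hk⟩ := T.mem_Qneg hμl
      have hk := hk.resolve_left (sub_ne_zero.2 hne)
      have h' : ν - μ ∈ AddSubgroup.closure (roots T.𝔱) := by
        rw [← sub_sub_sub_cancel_right ν μ l]
        exact sub_mem h k
      have hsum : T.γ ⟨ν - l, h⟩ = T.γ ⟨ν - μ, h'⟩ + T.γ ⟨μ - l, k⟩ := by
        rw [← map_add]
        exact congrArg T.γ (Subtype.ext (sub_add_sub_cancel _ _ _).symm)
      refine ih _ ?_ μ hμ h' rfl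
      rw [← hn]
      -- As `γ(μ - l) < 0`, the bound moves up, and the value `γ(ν - l)` itself is lost.
      refine Set.ncard_lt_ncard ?_ (hA1 _)
      refine ⟨fun r hr => ⟨by linarith [hr.1], hr.2⟩, fun hs => ?_⟩
      have := (hs ⟨le_rfl, ⟨ν - l, h⟩, hle, rfl⟩).1
      linarith
    have hadd := sch_eq_add_quot C hM (M (C l)).radical ν
    rw [hM0, hsub _ le_rfl, zero_add] at hadd
    exact hadd.symm
  intro l hl
  by_cases hle : T.le ν l
  · exact key _ l hl (T.mem_Qneg hle).1 rfl
  · refine sch_eq_zero_of_wt_eq_bot C ?_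
    by_contra hb
    exact hle ((wtMod_L C).le ν hb)

/-- The parity `p` supplied by `exists_sch_eq` is not tied to the module `C ν` in its statement, so
the coefficient is determined here only up to sign. A unit suffices for solving for the `m_μ`. -/
theorem exists_sch_C (ν : T.Wt) : ∃ e : ℤ, e * e = 1 ∧ sch C (C ν).rep ν = e := by
  have hC := (C ν).weight
  have := IsSimple.finiteDimensional (C ν).simple hC
  obtain ⟨w⟩ := nonempty_wittData (T.F ν) (F_symm ν)
  obtain ⟨p, hp⟩ := exists_sch_eq C w
  obtain ⟨q, hq⟩ := exists_hvac_ne_bot (C ν).simple hC w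
  have hsub : ∀ p, finrank ℂ (hvac w ((C ν).rep.sub (wt (C ν).rep ν)) p) =
      finrank ℂ (hvac w (C ν).rep p) := fun p => by
    rw [finrank_hvac_sub, hC, inf_top_eq]
  have h1 := finrank_hvac_eq_one (C ν).simple hC w hq
  rw [hp, hsub, hsub]
  split_ifs with he
  · have h0 := hvac_add_one_eq_bot (C ν).simple hC w ((even_rk_iff w).1 he) hq
    have h0' : finrank ℂ (hvac w (C ν).rep (q + 1)) = 0 := by rw [h0, finrank_bot]
    by_cases hpq : p = q
    · subst hpq
      exact ⟨1, rfl, by rw [h1, h0']; simp⟩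
    · have h' : p = q + 1 := by
        have key : ∀ p q : ZMod 2, p ≠ q → p = q + 1 := by decide
        exact key p q hpq
      have h'' : p + 1 = q := by
        rw [h', add_assoc, show (1 : ZMod 2) + 1 = 0 from rfl, add_zero]
      exact ⟨-1, rfl, by rw [h'', h', h1, h0']; simp⟩
  · have hc := cliffMod _ hC
    have e := hc.finrank_vac_eq_of_trace w (hc.trace_par_mul_proj_of_odd w (F_c_c w he)) p q
    have e' : finrank ℂ (hvac w (C ν).rep p) = 1 := e.trans h1
    exact ⟨1, rfl, by rw [e']; simp⟩

theorem sch_C_of_ne {μ ν : T.Wt} (h : μ ≠ ν) : sch C (C μ).rep ν = 0 := by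
  refine sch_eq_zero_of_wt_eq_bot C (eq_bot_iff.2 fun v hv => ?_)
  obtain ⟨t, ht⟩ : ∃ t, μ t ≠ ν t := by
    by_contra! hc
    exact h (LinearMap.ext hc)
  have h1 : v ∈ (wt (C μ).rep μ).1 := by rw [(C μ).weight]; trivial
  have h2 : (μ t - ν t) • v = 0 := by rw [sub_smul, ← h1 t, ← hv t, sub_self]
  exact (smul_eq_zero.1 h2).resolve_left (sub_ne_zero.2 ht)

end TriangularDatum

end SuperLie

end

/-! ### The theorem -/

open SuperLie TriangularDatum in
theorem mainTheorem6 {𝔤 : Type*} [AddCommGroup 𝔤] [Module ℂ 𝔤] [LieSuperalgebra 𝔤]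
    (T : TriangularDatum 𝔤) (C : ∀ l : T.Wt, T.SimpleMod l)
    (h1 : T.A1) (h2 : T.A2) (h3 : T.A3 C)
    (Λ : Set T.Wt) (hΛ : ∃ l₀, Λ = {l | SameBlock C l₀ l})
    (h4_even : Even (Module.finrank ℂ T.𝔥₁) → ∀ l ∈ Λ, T.corank l ≤ 1)
    (h4_odd : ¬ Even (Module.finrank ℂ T.𝔥₁) → ∀ l ∈ Λ, T.corank l = 0) :
    ∀ l ∈ Λ, ∃ m : T.Wt → ℤ, sch C (T.res (L (C l))) = schSum C Λ m := by
  have hlink : ∀ μ ν, Linked C μ ν → (μ ∈ Λ ↔ ν ∈ Λ) := by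
    obtain ⟨l₀, rfl⟩ := hΛ
    exact fun μ ν h => ⟨fun h' => h'.trans _ _ _ (.rel _ _ h),
      fun h' => h'.trans _ _ _ (.symm _ _ (.rel _ _ h))⟩
  have hc : ∀ l ∈ Λ, T.corank l ≤ 1 := fun l hl => by
    by_cases he : Even (Module.finrank ℂ T.𝔥₁)
    · exact h4_even he l hl
    · rw [h4_odd he l hl]; exact zero_le_one
  have hodd : ∀ l ∈ Λ, Odd (Module.finrank ℂ T.𝔥₁) → T.corank l = 0 := fun l hl ho =>
    h4_odd (Nat.not_even_iff_odd.2 ho) l hl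
  intro l hl
  classical
  -- A coefficient is by definition the image of an integer, also in the case of residues modulo
  -- `2`.
  have hz : ∀ ν, ∃ z : ℤ, sch C (T.res (L (C l))) ν = z := fun ν => ⟨_, rfl⟩
  choose z hz using hz
  choose e he he' using exists_sch_C C
  -- Only `C(ν)` contributes at `ν`, with coefficient `e ν`, so the factor `e ν` is undone by `e ν *
  -- e ν = 1`.
  refine ⟨fun ν => z ν * e ν, funext fun ν => ?_⟩
  have hne : ∀ μ, μ ≠ ν → ∑ᶠ _ : μ ∈ Λ, (z μ * e μ) • sch C (C μ).rep ν = 0 := fun μ hμ => by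
    rw [sch_C_of_ne C hμ]
    simp
  unfold schSum
  rw [finsum_eq_single _ ν hne]
  by_cases hν : ν ∈ Λ
  · rw [finsum_eq_if, if_pos hν, he', hz, zsmul_eq_mul, ← Int.cast_mul, mul_assoc, he, mul_one]
  · rw [finsum_eq_if, if_neg hν]
    exact sch_L_eq_zero C h1 h2 h3 hlink hc hodd hν l hl
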